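/- **Setting.** Let $v:[0,\infty)\to[0,\infty)$ be non-increasing and locally Lipschitz, $m(\rho)=\rho\,v(\rho)$, and let $V,W:[0,\infty)\times\mathbb R\to\mathbb R$ be measurable in $t$ for every $x$ and satisfy, locally uniformly in $t\in[0,\infty)$: * $V(t,\cdot)$ is locally bounded and is a primitive of a function $\partial_xV(t,\cdot)$ that is locally bounded and of locally bounded variation, and $x\,V(t,x)\le C(1+x^2)$; * $W(t,\cdot)$ is continuous on $\mathbb R$ and differentiable on $\mathbb R\setminus\{0\}$; $\partial_xW(t,\cdot)$ is locally bounded, is Lipschitz on $[-r,0)$ and on $(0,r]$ for every $r>0$ (it may jump at $0$), and $-x\,\partial_xW(t,x)\le C(1+x^2)$ for $x\ne0$; * either $\partial_xW(t,0^+)\le\partial_xW(t,0^-)$ for all $t\ge 0$, or $\int_1^\infty\frac{dr}{r^2v(r)}=\infty$ (with $1/0=\infty$; this is the case for instance if $m$ is bounded). Consider the non-local traffic equation on $[0,\infty)\times\mathbb R$ $$\partial_t\rho+\partial_x\bigl[m(\rho)\,(V-\partial_xW*\rho)\bigr]=0 .\tag{1}$$ **Particles.** For an integer $N\ge1$ let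 $x_0(t)<\dots<x_N(t)$, $t\ge0$, be particles, $\rho_i^N=\frac{1}{N(x_i-x_{i-1})}$ for $1\le i\le N$, $\rho_0^N=\rho_{N+1}^N=0$, $\bar\rho^N(t,x)=\sum_{i=1}^N\rho_i^N(t)\mathbf 1_{(x_{i-1}(t),x_i(t))}(x)$, $\bar U=V-\partial_xW*\bar\rho^N$, $\bar U_i(t)=\bar U(t,x_i(t))$. The particles solve $$x_i'=v_i\bar U_i,\qquad v_i=\begin{cases}v(\rho_i^N)&\text{if }\bar U_i<0,\\ v(\rho_{i+1}^N)&\text{if }\bar U_i\ge0,\end{cases}\qquad 0\le i\le N,$$ in integral form; below $x_i'$ stands for the right hand side $v_i\bar U_i$. Let $R_0,S_0,B_0$ be constants such that at $t=0$: $\rho_i^N\le R_0$ for $1\le i\le N$, $-S_0\le x_0$ and $x_N\le S_0$, and $\sum_{i=0}^N|\rho_{i+1}^N-\rho_i^N|\le B_0$. **Quasi-entropy solutions.** Let $\mu_{0,t},\mu_{1,t}$, $t\ge0$, be locally finite non-negative Borel measures on $\mathbb R$, measurable in $t$ and with $\int_0^T\mu_{k,t}(K)\,dt<\infty$ for all $T>0$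 and all compact $K$. Let $P(t,x,u)$ be a flux such that $P$ and its weak derivative $\partial_xP$ in $x$ are measurable in $(t,x)$ for each $u\ge0$, are in $L^1_{loc}([0,\infty)\times\mathbb R)$ for $u=0$, and for every $R>0$ satisfy $|P(t,x,u)-P(t,x,w)|+|\partial_xP(t,x,u)-\partial_xP(t,x,w)|\le C_R(t)|u-w|$ for $t\ge0$, $|x|<R$, $u,w\in[0,R]$, with $C_R\in L^1_{loc}([0,\infty))$. A non-negative $u\in C([0,\infty);L^1_{loc}(\mathbb R))\cap L^\infty_{loc}([0,\infty);BV_{loc}(\mathbb R))$ is a $(\mu_0,\mu_1)$-quasi-entropy solution of $\partial_tu+\partial_x(P(t,x,u))=0$ if for every constant $c\ge0$ and every non-negative $\phi\in C^\infty_c((0,\infty)\times\mathbb R)$ $$\int_0^\infty\!\!\int_{\mathbb R}\Bigl\{|u-c|\,\partial_t\phi+\operatorname{sign}(u-c)\bigl[(P(t,x,u)-P(t,x,c))\,\partial_x\phi-\partial_xP(t,x,c)\,\phi\bigr]\Bigr\}dx\,dt\ \ge\ -\int_0^\infty\!\!\int_{\mathbb R}|\phi|\,d\mu_{0,t}\,dt-\int_0^\infty\!\!\int_{\mathbb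 R}|\partial_x\phi|\,d\mu_{1,t}\,dt ,$$ where $\operatorname{sign}(0)=0$. For equation (1) and $u=\bar\rho^N$ the flux is $P(t,x,s)=m(s)\,\bar U(t,x)$. **Proposition.** Given $v,V,W,R_0,S_0,B_0$ there is an increasing (i.e. non-decreasing) function $H:[0,\infty)\to[0,\infty)$, independent of $N$, such that for every $N\ge1$ and all particles as above, $\bar\rho^N$ is a $(0,\mu_1^N)$-quasi-entropy solution of (1), where $$\mu_{1,t}^N=\sum_{i=1}^N\Bigl\{m(\rho_i^N)\bigl|\bar U(t,x)-\bar U(t,x_{i-1})\bigr|+\rho_i^N\Bigl[|x_i'-x_{i-1}'|+\bigl|x_{i-1}'-v(\rho_i^N)\,\bar U(t,x_{i-1})\bigr|\Bigr]\Bigr\}\mathbf 1_{[x_{i-1},x_i]}(x)\,dx ,$$ and $\mu_{1,t}^N(\mathbb R)\le\frac1N H(t)$ for every $t\ge0$. -/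

import Mathlib

open MeasureTheory Set Filter Topology

noncomputable section

namespace Traffic

/-! ### Quasi-entropy solutions on `[0,∞) × ℝ` -/

/-- `D` is the weak spatial divergence of the flux `P : [0,∞) × ℝ × [0,∞) → ℝ`, and `P`, `D` satisfy
the four regularity conditions on a flux: `P(·,·,0)` and `div_x P(·,·,0)` are locally integrable on
`[0,∞) × ℝ`, and `u ↦ P(t,x,u)`, `u ↦ div_x P(t,x,u)` are locally Lipschitz, locally uniformly in
`x`, with a constant that is locally integrable in time. -/
structure IsAdmissibleFlux (P D : ℝ → ℝ → ℝ → ℝ) : Prop where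
  measurable_flux : ∀ u, 0 ≤ u → AEStronglyMeasurable (fun p : ℝ × ℝ => P p.1 p.2 u)
    (volume.restrict (Ici (0 : ℝ) ×ˢ (univ : Set ℝ)))
  measurable_div : ∀ u, 0 ≤ u → AEStronglyMeasurable (fun p : ℝ × ℝ => D p.1 p.2 u)
    (volume.restrict (Ici (0 : ℝ) ×ˢ (univ : Set ℝ)))
  weak_div : ∀ u, 0 ≤ u → ∀ᵐ t ∂(volume.restrict (Ici (0 : ℝ))), ∀ ψ : ℝ → ℝ,
    ContDiff ℝ (⊤ : ℕ∞) ψ → HasCompactSupport ψ →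
      ∫ x, P t x u * deriv ψ x = - ∫ x, D t x u * ψ x
  integrable_flux : LocallyIntegrableOn (fun p : ℝ × ℝ => P p.1 p.2 0)
    (Ici (0 : ℝ) ×ˢ (univ : Set ℝ))
  integrable_div : LocallyIntegrableOn (fun p : ℝ × ℝ => D p.1 p.2 0)
    (Ici (0 : ℝ) ×ˢ (univ : Set ℝ))
  lipschitz_flux : ∀ R : ℝ, 0 < R → ∃ C : ℝ → ℝ, LocallyIntegrableOn C (Ici 0) ∧
    ∀ t, 0 ≤ t → 0 ≤ C t ∧ ∀ x, |x| < R → ∀ u ∈ Icc 0 R, ∀ w ∈ Icc 0 R,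
      |P t x u - P t x w| ≤ C t * |u - w|
  lipschitz_div : ∀ R : ℝ, 0 < R → ∃ C : ℝ → ℝ, LocallyIntegrableOn C (Ici 0) ∧
    ∀ t, 0 ≤ t → 0 ≤ C t ∧ ∀ x, |x| < R → ∀ u ∈ Icc 0 R, ∀ w ∈ Icc 0 R,
      |D t x u - D t x w| ≤ C t * |u - w|

/-- `μ ∈ L¹_loc([0,∞); Meas₊(ℝ))`: a measurable family of locally finite Borel measures whose mass
on each compact set is locally integrable in time. -/
structure IsL1locMeasure (μ : ℝ → Measure ℝ) : Prop where
  locallyFinite : ∀ t, 0 ≤ t → IsLocallyFiniteMeasure (μ t)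
  measurable : ∀ A : Set ℝ, MeasurableSet A →
    AEMeasurable (fun t => μ t A) (volume.restrict (Ici (0 : ℝ)))
  mass_lt_top : ∀ K : Set ℝ, IsCompact K → ∀ T : ℝ, ∫⁻ t in Icc 0 T, μ t K < ⊤

/-- `u ∈ C([0,∞); L¹_loc(ℝ))`. -/
structure IsContinuousL1loc (u : ℝ → ℝ → ℝ) : Prop where
  measurable : AEStronglyMeasurable (fun p : ℝ × ℝ => u p.1 p.2)
    (volume.restrict (Ici (0 : ℝ) ×ˢ (univ : Set ℝ)))
  locallyIntegrable : ∀ t, 0 ≤ t → LocallyIntegrable (u t)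
  continuous : ∀ t₀, 0 ≤ t₀ → ∀ r : ℝ,
    Tendsto (fun t => ∫ x in Icc (-r) r, |u t x - u t₀ x|) (𝓝[Ici 0] t₀) (𝓝 0)

/-- `u ∈ L^∞_loc([0,∞); BV_loc(ℝ))`; the total variation of `u(t,·)` on `(-r,r)` is the supremum of
`∫ u(t,x) ψ'(x) dx` over `ψ ∈ C¹_c((-r,r))` with `|ψ| ≤ 1`. -/
def IsBoundedBVloc (u : ℝ → ℝ → ℝ) : Prop :=
  ∀ T r : ℝ, ∃ C : ℝ, ∀ᵐ t ∂(volume.restrict (Icc 0 T)),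
    ∫ x in Icc (-r) r, |u t x| ≤ C ∧
    ∀ ψ : ℝ → ℝ, ContDiff ℝ 1 ψ → HasCompactSupport ψ → tsupport ψ ⊆ Ioo (-r) r →
      (∀ x, |ψ x| ≤ 1) → ∫ x, u t x * deriv ψ x ≤ C

/-- The quasi-entropy inequality for `∂ₜu + div_x P(t,x,u) = 0`, where `D = div_x P`:
for every constant `c ≥ 0` and every non-negative test function `φ ∈ C^∞_c((0,∞) × ℝ)`. -/
def QuasiEntropyInequality (P D : ℝ → ℝ → ℝ → ℝ) (u : ℝ → ℝ → ℝ) (μ₀ μ₁ : ℝ → Measure ℝ) : Prop :=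
  ∀ c : ℝ, 0 ≤ c → ∀ φ : ℝ × ℝ → ℝ, ContDiff ℝ (⊤ : ℕ∞) φ → HasCompactSupport φ →
    tsupport φ ⊆ Ioi (0 : ℝ) ×ˢ (univ : Set ℝ) → (∀ p, 0 ≤ φ p) →
    - (∫ t in Ioi (0 : ℝ), ∫ x, |φ (t, x)| ∂(μ₀ t))
      - (∫ t in Ioi (0 : ℝ), ∫ x, |deriv (fun y => φ (t, y)) x| ∂(μ₁ t))
    ≤ ∫ t in Ioi (0 : ℝ), ∫ x,
        (|u t x - c| * deriv (fun s => φ (s, x)) t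
          + Real.sign (u t x - c)
            * ((P t x (u t x) - P t x c) * deriv (fun y => φ (t, y)) x - D t x c * φ (t, x)))

/-- `u` is a `(μ₀, μ₁)`-quasi-entropy solution of `∂ₜu + div_x P(t,x,u) = 0` on `[0,∞) × ℝ`.
For each `c` the weak divergence `D(·,·,c)` of `P(·,·,c)` is unique up to null sets. -/
def IsQuasiEntropySolution (P : ℝ → ℝ → ℝ → ℝ) (u : ℝ → ℝ → ℝ) (μ₀ μ₁ : ℝ → Measure ℝ) : Prop :=
  IsL1locMeasure μ₀ ∧ IsL1locMeasure μ₁ ∧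
  (∀ t, 0 ≤ t → ∀ x, 0 ≤ u t x) ∧ IsContinuousL1loc u ∧ IsBoundedBVloc u ∧
  ∃ D : ℝ → ℝ → ℝ → ℝ, IsAdmissibleFlux P D ∧ QuasiEntropyInequality P D u μ₀ μ₁

/-! ### The non-local traffic equation `∂ₜρ + ∂ₓ[ρ v(ρ) (V - ∂ₓW ∗ ρ)] = 0` -/

/-- The velocity field `U(t,x) = V(t,x) - (∂ₓW ∗ ρ)(t,x)`, the convolution being in space. -/
def velocityField (V W ρ : ℝ → ℝ → ℝ) (t x : ℝ) : ℝ :=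
  V t x - ∫ y, deriv (W t) (x - y) * ρ t y

/-- The mobility `m(ρ) = ρ v(ρ)`. -/
def mobility (v : ℝ → ℝ) (r : ℝ) : ℝ := r * v r

/-- The flux `(t,x,s) ↦ m(s) (V(t,x) - (∂ₓW ∗ ρ)(t,x))`. -/
def trafficFlux (v : ℝ → ℝ) (V W ρ : ℝ → ℝ → ℝ) (t x s : ℝ) : ℝ :=
  mobility v s * velocityField V W ρ t x

/-- Osgood condition on `v`: the integral of `1 / (r² v(r))` over `(1,∞)` diverges (the integrand is
`∞` where `v` vanishes). It holds for instance if `m` is bounded or if `v` vanishes eventually. -/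
def Osgood (v : ℝ → ℝ) : Prop :=
  ∫⁻ r in Ioi (1 : ℝ), (ENNReal.ofReal (r ^ 2 * v r))⁻¹ = ⊤

/-- Standing assumptions on the speed law `v`, the external velocity `V` and the interaction
potential `W`. All bounds are locally uniform in time. -/
structure Assumptions (v : ℝ → ℝ) (V W : ℝ → ℝ → ℝ) : Prop where
  v_nonneg : ∀ r, 0 ≤ r → 0 ≤ v r
  v_antitone : AntitoneOn v (Ici 0)
  v_lipschitz : ∀ R : ℝ, ∃ K, LipschitzOnWith K v (Icc 0 R)
  V_measurable : ∀ x, AEStronglyMeasurable (fun t => V t x) (volume.restrict (Ici (0 : ℝ)))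
  V_bounded : ∀ T r : ℝ, ∃ C : ℝ, ∀ t ∈ Icc 0 T, ∀ x ∈ Icc (-r) r, |V t x| ≤ C
  /-- `V(t,·)` is locally Lipschitz, with a derivative of locally bounded variation. -/
  V_derivative : ∃ V' : ℝ → ℝ → ℝ,
    (∀ t, 0 ≤ t → ∀ a b, IntervalIntegrable (V' t) volume a b ∧
      V t b - V t a = ∫ x in a..b, V' t x) ∧
    ∀ T r : ℝ, ∃ C : ℝ, ∀ t ∈ Icc 0 T,
      (∀ x ∈ Icc (-r) r, |V' t x| ≤ C) ∧ eVariationOn (V' t) (Icc (-r) r) ≤ ENNReal.ofReal C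
  /-- `V` grows at most linearly in the outward direction. -/
  V_growth : ∀ T : ℝ, ∃ C : ℝ, ∀ t ∈ Icc 0 T, ∀ x, x * V t x ≤ C * (1 + x ^ 2)
  W_measurable : ∀ x, AEStronglyMeasurable (fun t => W t x) (volume.restrict (Ici (0 : ℝ)))
  W_continuous : ∀ t, 0 ≤ t → Continuous (W t)
  W_differentiable : ∀ t, 0 ≤ t → ∀ x, x ≠ 0 → DifferentiableAt ℝ (W t) x
  W_bounded : ∀ T r : ℝ, ∃ C : ℝ, ∀ t ∈ Icc 0 T, ∀ x ∈ Icc (-r) r, x ≠ 0 → |deriv (W t) x| ≤ C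
  /-- `∂ₓW(t,·)` is locally Lipschitz on each side of the origin, where it may jump. -/
  W_lipschitz : ∀ T r : ℝ, ∃ C : ℝ, ∀ t ∈ Icc 0 T, ∀ x ∈ Icc (-r) r, ∀ y ∈ Icc (-r) r,
    0 < x * y → |deriv (W t) x - deriv (W t) y| ≤ C * |x - y|
  /-- The repulsion grows at most linearly. -/
  W_growth : ∀ T : ℝ, ∃ C : ℝ, ∀ t ∈ Icc 0 T, ∀ x, x ≠ 0 → - (x * deriv (W t) x) ≤ C * (1 + x ^ 2)
  /-- Either the jump of `∂ₓW(t,·)` at the origin is never attractive, or `v` is Osgood. -/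
  congestion : (∀ t, 0 ≤ t → ∀ a b : ℝ, Tendsto (deriv (W t)) (𝓝[>] 0) (𝓝 a) →
    Tendsto (deriv (W t)) (𝓝[<] 0) (𝓝 b) → a ≤ b) ∨ Osgood v

/-! ### The particle scheme; the particles are `x 0, …, x N` -/

/-- `ρᵢ(t) = 1 / (N (xᵢ(t) - xᵢ₋₁(t)))` for `1 ≤ i ≤ N`, and `ρ₀ = ρ_{N+1} = 0`. -/
def cellDensity (N : ℕ) (x : ℕ → ℝ → ℝ) (i : ℕ) (t : ℝ) : ℝ :=
  if 1 ≤ i ∧ i ≤ N then 1 / ((N : ℝ) * (x i t - x (i - 1) t)) else 0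

/-- The piecewise constant density `ρ̄ᴺ`. -/
def particleDensity (N : ℕ) (x : ℕ → ℝ → ℝ) (t y : ℝ) : ℝ :=
  ∑ i ∈ Finset.Icc 1 N, (Ioo (x (i - 1) t) (x i t)).indicator (fun _ => cellDensity N x i t) y

/-- The velocity field `Ū = V - ∂ₓW ∗ ρ̄ᴺ`. -/
def particleField (V W : ℝ → ℝ → ℝ) (N : ℕ) (x : ℕ → ℝ → ℝ) : ℝ → ℝ → ℝ :=
  velocityField V W (particleDensity N x)

/-- The right hand side `vᵢ Ūᵢ` of the equation for `xᵢ'`, where `Ūᵢ(t) = Ū(t, xᵢ(t))` and `vᵢ` is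
`v(ρᵢ)` if `Ūᵢ < 0` and `v(ρᵢ₊₁)` if `Ūᵢ ≥ 0`. -/
def particleVelocity (v : ℝ → ℝ) (V W : ℝ → ℝ → ℝ) (N : ℕ) (x : ℕ → ℝ → ℝ) (i : ℕ) (t : ℝ) : ℝ :=
  (if particleField V W N x t (x i t) < 0 then v (cellDensity N x i t)
    else v (cellDensity N x (i + 1) t)) * particleField V W N x t (x i t)

/-- The particles `x₀ < ⋯ < x_N` solve the system `xᵢ' = vᵢ Ūᵢ` on `[0,∞)` (in integral form, since
`V` and `W` need not be continuous in time). -/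
structure SolvesODE (v : ℝ → ℝ) (V W : ℝ → ℝ → ℝ) (N : ℕ) (x : ℕ → ℝ → ℝ) : Prop where
  ordered : ∀ t, 0 ≤ t → ∀ i < N, x i t < x (i + 1) t
  integrable : ∀ i ≤ N, ∀ t, 0 ≤ t →
    IntervalIntegrable (particleVelocity v V W N x i) volume 0 t
  solution : ∀ i ≤ N, ∀ t, 0 ≤ t → x i t = x i 0 + ∫ s in (0 : ℝ)..t, particleVelocity v V W N x i s

/-- The initial density is bounded by `R₀`, supported in `[-S₀,S₀]` and has total variation at most
`B₀`. -/
structure InitialBounds (R₀ S₀ B₀ : ℝ) (N : ℕ) (x : ℕ → ℝ → ℝ) : Prop where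
  density_le : ∀ i ∈ Finset.Icc 1 N, cellDensity N x i 0 ≤ R₀
  support_left : -S₀ ≤ x 0 0
  support_right : x N 0 ≤ S₀
  variation_le : ∑ i ∈ Finset.range (N + 1), |cellDensity N x (i + 1) 0 - cellDensity N x i 0| ≤ B₀

/-- The density with respect to the Lebesgue measure of the error measure `μ₁ᴺ`. -/
def errorDensity (v : ℝ → ℝ) (V W : ℝ → ℝ → ℝ) (N : ℕ) (x : ℕ → ℝ → ℝ) (t y : ℝ) : ℝ :=
  (∑ i ∈ Finset.Icc 1 N, (Icc (x (i - 1) t) (x i t)).indicator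
    (fun z => mobility v (cellDensity N x i t)
      * |particleField V W N x t z - particleField V W N x t (x (i - 1) t)|) y)
  + ∑ i ∈ Finset.Icc 1 N, (Icc (x (i - 1) t) (x i t)).indicator
    (fun _ => cellDensity N x i t
      * (|particleVelocity v V W N x i t - particleVelocity v V W N x (i - 1) t|
        + |particleVelocity v V W N x (i - 1) t
            - v (cellDensity N x i t) * particleField V W N x t (x (i - 1) t)|)) y

/-- The error measure `μ₁ᴺ`. -/
def errorMeasure (v : ℝ → ℝ) (V W : ℝ → ℝ → ℝ) (N : ℕ) (x : ℕ → ℝ → ℝ) (t : ℝ) : Measure ℝ :=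
  volume.withDensity fun y => ENNReal.ofReal (errorDensity v V W N x t y)

end Traffic

end

namespace Traffic

/-! ### Lipschitz functions of time -/

/-- `f` is Lipschitz on `[0,T]`. -/
def LipOn (T : ℝ) (f : ℝ → ℝ) : Prop :=
  ∃ K : ℝ, 0 ≤ K ∧ ∀ s ∈ Icc 0 T, ∀ t ∈ Icc 0 T, |f s - f t| ≤ K * |s - t|

namespace LipOn

variable {T : ℝ} {f g : ℝ → ℝ}

theorem lipschitzOnWith (hf : LipOn T f) : ∃ K, LipschitzOnWith K f (Icc 0 T) := by
  obtain ⟨K, hK, h⟩ := hf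
  refine ⟨⟨K, hK⟩, LipschitzOnWith.of_dist_le_mul fun s hs t ht => ?_⟩
  rw [Real.dist_eq, Real.dist_eq]
  exact h s hs t ht

theorem absolutelyContinuous (hf : LipOn T f) (hT : 0 ≤ T) :
    AbsolutelyContinuousOnInterval f 0 T := by
  obtain ⟨K, hK⟩ := hf.lipschitzOnWith
  rw [← uIcc_of_le hT] at hK
  exact hK.absolutelyContinuousOnInterval

theorem continuousOn (hf : LipOn T f) : ContinuousOn f (Icc 0 T) :=
  let ⟨_, hK⟩ := hf.lipschitzOnWith
  hK.continuousOn

theorem exists_bound (hf : LipOn T f) : ∃ C, 0 ≤ C ∧ ∀ t ∈ Icc 0 T, |f t| ≤ C := by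
  obtain ⟨C, hC⟩ := isCompact_Icc.exists_bound_of_continuousOn hf.continuousOn
  exact ⟨max C 0, le_max_right _ _, fun t ht => (hC t ht).trans (le_max_left _ _)⟩

theorem ae_differentiableAt (hf : LipOn T f) (hT : 0 ≤ T) :
    ∀ᵐ t, t ∈ Ioo 0 T → DifferentiableAt ℝ f t := by
  filter_upwards [(hf.absolutelyContinuous hT).ae_differentiableAt] with t ht h
  exact ht (by rw [uIcc_of_le hT]; exact Ioo_subset_Icc_self h)

theorem const (c : ℝ) : LipOn T fun _ => c := ⟨0, le_rfl, by simp⟩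

theorem add (hf : LipOn T f) (hg : LipOn T g) : LipOn T fun t => f t + g t := by
  obtain ⟨K, hK, hf⟩ := hf
  obtain ⟨M, hM, hg⟩ := hg
  refine ⟨K + M, by positivity, fun s hs t ht => ?_⟩
  rw [add_sub_add_comm, add_mul]
  exact (abs_add_le _ _).trans (add_le_add (hf s hs t ht) (hg s hs t ht))

theorem neg (hf : LipOn T f) : LipOn T fun t => - f t := by
  obtain ⟨K, hK, hf⟩ := hf
  refine ⟨K, hK, fun s hs t ht => ?_⟩
  rw [neg_sub_neg, abs_sub_comm]
  exact hf s hs t ht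

theorem sub (hf : LipOn T f) (hg : LipOn T g) : LipOn T fun t => f t - g t := by
  simpa only [sub_eq_add_neg] using hf.add hg.neg

theorem abs (hf : LipOn T f) : LipOn T fun t => |f t| := by
  obtain ⟨K, hK, hf⟩ := hf
  exact ⟨K, hK, fun s hs t ht => (abs_abs_sub_abs_le _ _).trans (hf s hs t ht)⟩

theorem mul (hf : LipOn T f) (hg : LipOn T g) : LipOn T fun t => f t * g t := by
  obtain ⟨A, hA, hfA⟩ := hf.exists_bound
  obtain ⟨B, hB, hgB⟩ := hg.exists_bound
  obtain ⟨K, hK, hf⟩ := hf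
  obtain ⟨M, hM, hg⟩ := hg
  refine ⟨A * M + K * B, by positivity, fun s hs t ht => ?_⟩
  calc |f s * g s - f t * g t| = |f s * (g s - g t) + (f s - f t) * g t| := by ring_nf
    _ ≤ |f s| * |g s - g t| + |f s - f t| * |g t| := by
      rw [← abs_mul, ← abs_mul]; exact abs_add_le _ _
    _ ≤ A * (M * |s - t|) + K * |s - t| * B := by
      gcongr
      exacts [hfA s hs, hg s hs t ht, hf s hs t ht, hgB t ht]
    _ = _ := by ring

theorem sum {ι : Type*} (s : Finset ι) {f : ι → ℝ → ℝ} (hf : ∀ i ∈ s, LipOn T (f i)) :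
    LipOn T fun t => ∑ i ∈ s, f i t := by
  classical
  induction s using Finset.induction_on with
  | empty => simpa using const 0
  | insert a s ha ih =>
    simp only [Finset.sum_insert ha]
    exact (hf a (Finset.mem_insert_self _ _)).add
      (ih fun i hi => hf i (Finset.mem_insert_of_mem hi))

theorem inv (hf : LipOn T f) (hpos : ∀ t ∈ Icc 0 T, 0 < f t) : LipOn T fun t => (f t)⁻¹ := by
  obtain ⟨C, hC⟩ := isCompact_Icc.exists_bound_of_continuousOn
    (hf.continuousOn.inv₀ fun t ht => (hpos t ht).ne')
  obtain ⟨K, hK, hf⟩ := hf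
  refine ⟨C ^ 2 * K, by positivity, fun s hs t ht => ?_⟩
  have h1 := hpos s hs
  have h2 := hpos t ht
  have e : (f s)⁻¹ - (f t)⁻¹ = (f s)⁻¹ * (f t)⁻¹ * (f t - f s) := by
    field_simp
  have h3 := hC s hs
  have h4 := hC t ht
  rw [Real.norm_eq_abs] at h3 h4
  have hC0 : 0 ≤ C := (abs_nonneg _).trans h3
  rw [e, abs_mul, abs_mul, abs_sub_comm, mul_assoc (C ^ 2), sq]
  gcongr
  exacts [h3, h4, hf s hs t ht]

theorem comp_lipschitz {φ : ℝ → ℝ} (hf : LipOn T f)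
    (hφ : ∀ r : ℝ, ∃ K, 0 ≤ K ∧ ∀ a ∈ Icc (-r) r, ∀ b ∈ Icc (-r) r, |φ a - φ b| ≤ K * |a - b|) :
    LipOn T fun t => φ (f t) := by
  obtain ⟨A, hA, hfA⟩ := hf.exists_bound
  obtain ⟨K, hK, hf⟩ := hf
  obtain ⟨M, hM, hφ⟩ := hφ A
  refine ⟨M * K, by positivity, fun s hs t ht => ?_⟩
  rw [mul_assoc]
  refine (hφ _ (abs_le.1 (hfA s hs)) _ (abs_le.1 (hfA t ht))).trans ?_
  gcongr
  exact hf s hs t ht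

theorem sup' {s : Finset ℕ} (hs : s.Nonempty) {f : ℕ → ℝ → ℝ} (hf : ∀ i ∈ s, LipOn T (f i)) :
    LipOn T fun t => s.sup' hs fun i => f i t := by
  choose! K hK h using hf
  refine ⟨∑ i ∈ s, K i, Finset.sum_nonneg hK, ?_⟩
  have key : ∀ a ∈ Icc 0 T, ∀ b ∈ Icc 0 T,
      (s.sup' hs fun i => f i a) ≤ (s.sup' hs fun i => f i b) + (∑ i ∈ s, K i) * |a - b| := by
    intro a ha b hb
    refine Finset.sup'_le _ _ fun i hi => ?_
    have h1 := (abs_le.1 (h i hi a ha b hb)).2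
    have h2 : f i b ≤ s.sup' hs fun i => f i b := Finset.le_sup' (fun i => f i b) hi
    have h3 : K i * |a - b| ≤ (∑ i ∈ s, K i) * |a - b| := by
      gcongr
      exact Finset.single_le_sum hK hi
    linarith
  intro a ha b hb
  have h1 := key a ha b hb
  have h2 := key b hb a ha
  rw [abs_sub_comm b a] at h2
  exact abs_sub_le_iff.2 ⟨by linarith, by linarith⟩

end LipOn

/-! ### Differential inequalities -/

theorem le_add_mul_of_ae_deriv_le {F : ℝ → ℝ} {T C : ℝ} (hF : LipOn T F)
    (h : ∀ᵐ t, t ∈ Ioo 0 T → ∀ d, HasDerivAt F d t → d ≤ C) {t : ℝ} (ht : t ∈ Icc 0 T) :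
    F t ≤ F 0 + C * t := by
  have hT : 0 ≤ T := ht.1.trans ht.2
  have hac := (hF.absolutelyContinuous hT).mono (c := 0) (d := t)
    (by rw [uIcc_of_le hT, uIcc_of_le ht.1]; exact Icc_subset_Icc_right ht.2)
  have h1 := hac.integral_deriv_eq_sub
  have h2 : ∫ s in (0 : ℝ)..t, deriv F s ≤ ∫ s in (0 : ℝ)..t, C := by
    refine intervalIntegral.integral_mono_ae_restrict ht.1 hac.intervalIntegrable_deriv (by simp) ?_
    rw [EventuallyLE, ← restrict_Ioo_eq_restrict_Icc, ae_restrict_iff' measurableSet_Ioo]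
    filter_upwards [h, hF.ae_differentiableAt hT] with s hs hd hst
    have hsT : s ∈ Ioo 0 T := ⟨hst.1, hst.2.trans_le ht.2⟩
    exact hs hsT _ (hd hsT).hasDerivAt
  rw [intervalIntegral.integral_const, smul_eq_mul, h1] at h2
  linarith

theorem deriv_eq_of_le_of_eq {f F : ℝ → ℝ} {d D t : ℝ} (hle : ∀ᶠ s in 𝓝 t, f s ≤ F s)
    (heq : f t = F t) (hf : HasDerivAt f d t) (hF : HasDerivAt F D t) : D = d := by
  have hmin : IsLocalMin (fun s => F s - f s) t := by
    filter_upwards [hle] with s hs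
    simpa [heq] using hs
  have := hmin.hasDerivAt_eq_zero (hF.sub hf)
  linarith

theorem hasDerivAt_abs_eq {f : ℝ → ℝ} {d D t : ℝ} (hf : HasDerivAt f d t)
    (hD : HasDerivAt (fun s => |f s|) D t) : D = Real.sign (f t) * d := by
  rcases lt_trichotomy (f t) 0 with h | h | h
  · rw [Real.sign_of_neg h]
    have := deriv_eq_of_le_of_eq (.of_forall fun s => neg_le_abs (f s)) (abs_of_neg h).symm hf.neg hD
    linarith
  · have := deriv_eq_of_le_of_eq (f := fun _ => 0) (.of_forall fun s => abs_nonneg (f s))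
      (by simp [h]) (hasDerivAt_const t 0) hD
    simp [this, h]
  · rw [Real.sign_of_pos h]
    have := deriv_eq_of_le_of_eq (.of_forall fun s => le_abs_self (f s)) (abs_of_pos h).symm hf hD
    linarith

theorem ae_deriv_sup'_le {T : ℝ} (hT : 0 ≤ T) {s : Finset ℕ} (hs : s.Nonempty) {f : ℕ → ℝ → ℝ}
    (hf : ∀ i ∈ s, LipOn T (f i)) {B : ℝ → ℝ}
    (h : ∀ i ∈ s, ∀ᵐ t, t ∈ Ioo 0 T → (∀ j ∈ s, f j t ≤ f i t) →
      ∀ d, HasDerivAt (f i) d t → d ≤ B (f i t)) :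
    ∀ᵐ t, t ∈ Ioo 0 T → ∀ d, HasDerivAt (fun t => s.sup' hs fun i => f i t) d t →
      d ≤ B (s.sup' hs fun i => f i t) := by
  have h1 : ∀ᵐ t, ∀ i ∈ s, t ∈ Ioo 0 T → DifferentiableAt ℝ (f i) t :=
    (Finset.eventually_all s).2 fun i hi => (hf i hi).ae_differentiableAt hT
  have h2 := (Finset.eventually_all s).2 h
  filter_upwards [h1, h2] with t h1 h2 ht d hd
  obtain ⟨i, hi, heq⟩ := Finset.exists_mem_eq_sup' hs fun i => f i t
  have hmax : ∀ j ∈ s, f j t ≤ f i t := fun j hj => by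
    rw [← heq]; exact Finset.le_sup' (fun i => f i t) hj
  have e := deriv_eq_of_le_of_eq
    (.of_forall fun r => Finset.le_sup' (fun i => f i r) hi) heq.symm (h1 i hi ht).hasDerivAt hd
  rw [heq, e]
  exact h2 i hi ht hmax _ (h1 i hi ht).hasDerivAt

theorem exists_bound_of_osgood {g : ℝ → ℝ} (hg : Continuous g) (hpos : ∀ r, 0 < g r)
    (hint : ¬ IntegrableOn (fun r => (g r)⁻¹) (Ioi 1)) (M₀ C T : ℝ) :
    ∃ R, ∀ F : ℝ → ℝ, LipOn T F → F 0 ≤ M₀ →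
      (∀ᵐ t, t ∈ Ioo 0 T → ∀ d, HasDerivAt F d t → d ≤ C * g (F t)) →
      ∀ t ∈ Icc 0 T, F t ≤ R := by
  have hgi : Continuous fun r => (g r)⁻¹ := hg.inv₀ fun r => (hpos r).ne'
  set G : ℝ → ℝ := fun s => ∫ r in (1 : ℝ)..s, (g r)⁻¹ with hG
  have hGd : ∀ s, HasDerivAt G (g s)⁻¹ s := fun s =>
    intervalIntegral.integral_hasDerivAt_right (hgi.intervalIntegrable _ _)
      hgi.stronglyMeasurable.stronglyMeasurableAtFilter hgi.continuousAt
  have hGm : StrictMono G := strictMono_of_hasDerivAt_pos hGd fun s => inv_pos.2 (hpos s)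
  obtain ⟨R, hR⟩ : ∃ R, G M₀ + |C| * |T| < G R := by
    by_contra! hcon
    refine hint (integrableOn_Ioi_of_intervalIntegral_norm_bounded (l := atTop) (b := id)
      (G M₀ + |C| * |T|) 1 (fun i => (hgi.integrableOn_Icc).mono_set Ioc_subset_Icc_self)
      tendsto_id (.of_forall fun i => ?_))
    have : ∀ r, ‖(g r)⁻¹‖ = (g r)⁻¹ := fun r => Real.norm_of_nonneg (inv_pos.2 (hpos r)).le
    simp only [this]
    exact hcon i
  refine ⟨R, fun F hF hF0 hd t ht => ?_⟩
  have hT : 0 ≤ T := ht.1.trans ht.2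
  have hGF : LipOn T fun t => G (F t) := by
    refine hF.comp_lipschitz fun r => ?_
    have hGc : ContDiff ℝ 1 G := contDiff_one_iff_deriv.2
      ⟨fun s => (hGd s).differentiableAt, by
        rw [funext fun s => (hGd s).deriv]; exact hgi⟩
    obtain ⟨K, hK⟩ := hGc.contDiffOn.exists_lipschitzOnWith (s := Icc (-r) r) one_ne_zero
      (convex_Icc _ _) isCompact_Icc
    exact ⟨K, K.2, fun a ha b hb => by simpa [Real.dist_eq] using hK.dist_le_mul a ha b hb⟩
  have key := le_add_mul_of_ae_deriv_le (C := |C|) hGF (by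
    filter_upwards [hd, hF.ae_differentiableAt hT] with s hs hds hst D hD
    have e := hD.unique ((hGd (F s)).comp s (hds hst).hasDerivAt)
    have h1 := hs hst _ (hds hst).hasDerivAt
    have h2 := hpos (F s)
    have h3 : D ≤ C := by
      rw [e, inv_mul_le_iff₀ h2, mul_comm]; exact h1
    exact h3.trans (le_abs_self C)) ht
  have h1 : |C| * t ≤ |C| * |T| := by
    gcongr
    exact ht.2.trans (le_abs_self T)
  have h2 := hGm.monotone hF0
  exact (hGm.lt_iff_lt.1 (by linarith)).le

theorem exists_bound_of_osgood_max {g : ℝ → ℝ} (hg : Continuous g) (hpos : ∀ r, 0 < g r)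
    (hint : ¬ IntegrableOn (fun r => (g r)⁻¹) (Ioi 1)) (M₀ C T : ℝ) :
    ∃ R, ∀ (s : Finset ℕ) (f : ℕ → ℝ → ℝ), (∀ i ∈ s, LipOn T (f i)) → (∀ i ∈ s, f i 0 ≤ M₀) →
      (∀ i ∈ s, ∀ᵐ t, t ∈ Ioo 0 T → (∀ j ∈ s, f j t ≤ f i t) →
        ∀ d, HasDerivAt (f i) d t → d ≤ C * g (f i t)) →
      ∀ i ∈ s, ∀ t ∈ Icc 0 T, f i t ≤ R := by
  obtain ⟨R, hR⟩ := exists_bound_of_osgood hg hpos hint M₀ C T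
  refine ⟨R, fun s f hf h0 hd i hi t ht => ?_⟩
  have hs : s.Nonempty := ⟨i, hi⟩
  refine (Finset.le_sup' (fun i => f i t) hi).trans
    (hR (fun t => s.sup' hs fun i => f i t) (LipOn.sup' hs hf) (Finset.sup'_le _ _ h0) ?_ t ht)
  exact ae_deriv_sup'_le (B := fun r => C * g r) (ht.1.trans ht.2) hs hf hd

theorem not_integrableOn_inv_max_one :
    ¬ IntegrableOn (fun r : ℝ => (max r 1)⁻¹) (Ioi 1) := by
  intro h
  refine not_integrableOn_Ioi_inv (a := (1 : ℝ)) (h.congr_fun (fun r hr => ?_) measurableSet_Ioi)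
  simp [max_eq_left (le_of_lt (mem_Ioi.1 hr))]

theorem exists_bound_of_linear_max (M₀ C T : ℝ) :
    ∃ R, ∀ (s : Finset ℕ) (f : ℕ → ℝ → ℝ), (∀ i ∈ s, LipOn T (f i)) → (∀ i ∈ s, f i 0 ≤ M₀) →
      (∀ i ∈ s, ∀ᵐ t, t ∈ Ioo 0 T → (∀ j ∈ s, f j t ≤ f i t) →
        ∀ d, HasDerivAt (f i) d t → d ≤ C * max (f i t) 1) →
      ∀ i ∈ s, ∀ t ∈ Icc 0 T, f i t ≤ R :=
  exists_bound_of_osgood_max (g := fun r => max r 1) (by fun_prop)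
    (fun r => zero_lt_one.trans_le (le_max_right _ _)) not_integrableOn_inv_max_one M₀ C T

/-! ### Constants that are uniform on bounded time intervals -/

/-- A bound `C n ≥ 0` on each `[0,n]` is dominated by a non-decreasing function of time. -/
theorem exists_monotone_of_forall_nat {p : ℝ → ℝ → Prop}
    (hp : ∀ t a b, a ≤ b → p t a → p t b)
    (h : ∀ T : ℝ, ∃ C, ∀ t ∈ Icc 0 T, p t C) :
    ∃ H : ℝ → ℝ, Monotone H ∧ (∀ t, 0 ≤ H t) ∧ ∀ t, 0 ≤ t → p t (H t) := by
  choose C hC using h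
  refine ⟨fun t => ∑ k ∈ Finset.range (⌈t⌉₊ + 1), |C k|, fun s t hst => ?_,
    fun t => Finset.sum_nonneg fun k _ => abs_nonneg _, fun t ht => ?_⟩
  · exact Finset.sum_le_sum_of_subset_of_nonneg
      (Finset.range_mono (Nat.add_le_add_right (Nat.ceil_mono hst) 1)) fun k _ _ => abs_nonneg _
  · refine hp t (C ⌈t⌉₊) _ ?_ (hC _ t ⟨ht, Nat.le_ceil t⟩)
    exact (le_abs_self _).trans (Finset.single_le_sum (f := fun k : ℕ => |C k|)
      (fun k _ => abs_nonneg _) (Finset.mem_range.2 (Nat.lt_succ_self _)))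

end Traffic

namespace Traffic

/-! ### Bounds on a time slice of the velocity field and of the potential -/

/-- The bounds on the slices `V = V(t,·)` and `W = W(t,·)` that govern particles in `[-S,S]`. -/
structure SliceBounds (V W : ℝ → ℝ) (S A : ℝ) : Prop where
  nonneg : 0 ≤ A
  V_bound : ∀ z ∈ Icc (-S) S, |V z| ≤ A
  V_lip : ∀ z ∈ Icc (-S) S, ∀ y ∈ Icc (-S) S, |V z - V y| ≤ A * |z - y|
  V_slope : ∀ (n : ℕ) (p : ℕ → ℝ), (∀ i ≤ n, p i < p (i + 1)) →
    (∀ i ≤ n + 1, p i ∈ Icc (-S) S) →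
    ∑ i ∈ Finset.range n, |slope V (p (i + 1)) (p (i + 2)) - slope V (p i) (p (i + 1))| ≤ A
  W_bound : ∀ z ∈ Icc (-(2 * S)) (2 * S), z ≠ 0 → |deriv W z| ≤ A
  W_lip : ∀ z ∈ Icc (-(2 * S)) (2 * S), ∀ y ∈ Icc (-(2 * S)) (2 * S), 0 < z * y →
    |deriv W z - deriv W y| ≤ A * |z - y|

theorem slope_eq_integral {f f' : ℝ → ℝ} {a b : ℝ} (hab : a < b)
    (hf : f b - f a = ∫ x in a..b, f' x) :
    slope f a b = ∫ θ in (0 : ℝ)..1, f' (a + (b - a) * θ) := by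
  have h := intervalIntegral.smul_integral_comp_add_mul (a := 0) (b := 1) f' (b - a) a
  have h0 : b - a ≠ 0 := by linarith
  rw [mul_zero, add_zero, mul_one, add_sub_cancel, ← hf] at h
  rw [slope_def_field, ← h, smul_eq_mul, mul_div_cancel_left₀ _ h0]

theorem intervalIntegrable_comp_affine {f : ℝ → ℝ} {a b : ℝ} (hab : a < b)
    (hf : IntervalIntegrable f volume a b) :
    IntervalIntegrable (fun θ => f (a + (b - a) * θ)) volume 0 1 := by
  have h0 : b - a ≠ 0 := by linarith
  have h := (hf.comp_add_left a).comp_mul_left (c := b - a)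
  rwa [sub_self, zero_div, div_self h0] at h

theorem sum_abs_slope_sub_le {f f' : ℝ → ℝ} {s : Set ℝ} (hs : Convex ℝ s) {C : ℝ} (hC : 0 ≤ C)
    (hint : ∀ a b, IntervalIntegrable f' volume a b ∧ f b - f a = ∫ x in a..b, f' x)
    (hvar : eVariationOn f' s ≤ ENNReal.ofReal C) (n : ℕ) (p : ℕ → ℝ)
    (hp : ∀ i ≤ n, p i < p (i + 1)) (hps : ∀ i ≤ n + 1, p i ∈ s) :
    ∑ i ∈ Finset.range n, |slope f (p (i + 1)) (p (i + 2)) - slope f (p i) (p (i + 1))| ≤ C := by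
  set u : ℝ → ℕ → ℝ := fun θ i => p i + (p (i + 1) - p i) * θ with hu
  have hi : ∀ i ≤ n, IntervalIntegrable (fun θ => f' (u θ i)) volume 0 1 := fun i h =>
    intervalIntegrable_comp_affine (hp i h) (hint _ _).1
  have hd : ∀ i < n, IntervalIntegrable (fun θ => |f' (u θ (i + 1)) - f' (u θ i)|) volume 0 1 :=
    fun i h => ((hi (i + 1) h).sub (hi i h.le)).abs
  have key : ∀ θ ∈ Icc (0 : ℝ) 1,
      ∑ i ∈ Finset.range n, |f' (u θ (i + 1)) - f' (u θ i)| ≤ C := by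
    intro θ hθ
    have h1 : MonotoneOn (u θ) (Iic n) := by
      refine monotoneOn_of_le_succ ordConnected_Iic fun i _ h1 h2 => ?_
      simp only [Order.succ_eq_add_one, mem_Iic, hu] at h1 h2 ⊢
      have h3 := hp i h1
      have h4 := hp (i + 1) h2
      have h5 : (p (i + 1) - p i) * θ ≤ p (i + 1) - p i :=
        mul_le_of_le_one_right (by linarith) hθ.2
      have h6 : 0 ≤ (p (i + 1 + 1) - p (i + 1)) * θ := mul_nonneg (by linarith) hθ.1
      linarith
    have h2 : ∀ i ≤ n, u θ i ∈ s := fun i hi => by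
      have := hs (hps i (by omega)) (hps (i + 1) (by omega)) (sub_nonneg.2 hθ.2) hθ.1 (by ring)
      convert this using 1
      simp only [hu, smul_eq_mul]
      ring
    have h3 := (eVariationOn.sum_le_of_monotoneOn_Iic (f := f') h1 h2).trans hvar
    simp only [edist_dist, Real.dist_eq] at h3
    rw [← ENNReal.ofReal_sum_of_nonneg fun i _ => abs_nonneg _] at h3
    exact (ENNReal.ofReal_le_ofReal_iff hC).1 h3
  calc ∑ i ∈ Finset.range n, |slope f (p (i + 1)) (p (i + 2)) - slope f (p i) (p (i + 1))|
      ≤ ∑ i ∈ Finset.range n, ∫ θ in (0 : ℝ)..1, |f' (u θ (i + 1)) - f' (u θ i)| := by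
        refine Finset.sum_le_sum fun i hin => ?_
        have hin := Finset.mem_range.1 hin
        rw [slope_eq_integral (hp i hin.le) (hint _ _).2,
          slope_eq_integral (hp (i + 1) hin) (hint _ _).2,
          ← intervalIntegral.integral_sub (hi (i + 1) hin) (hi i hin.le)]
        exact intervalIntegral.abs_integral_le_integral_abs zero_le_one
    _ = ∫ θ in (0 : ℝ)..1, ∑ i ∈ Finset.range n, |f' (u θ (i + 1)) - f' (u θ i)| :=
        (intervalIntegral.integral_finsetSum fun i h => hd i (Finset.mem_range.1 h)).symm
    _ ≤ ∫ _ in (0 : ℝ)..1, C := by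
        refine intervalIntegral.integral_mono_on zero_le_one ?_ (by simp) key
        simpa only [Finset.sum_fn] using IntervalIntegrable.sum (Finset.range n)
          fun i h => hd i (Finset.mem_range.1 h)
    _ = C := by simp

theorem Assumptions.exists_sliceBounds {v : ℝ → ℝ} {V W : ℝ → ℝ → ℝ} (hyp : Assumptions v V W)
    (T S : ℝ) : ∃ A, ∀ t ∈ Icc 0 T, SliceBounds (V t) (W t) S A := by
  obtain ⟨V', hV', hV'b⟩ := hyp.V_derivative
  obtain ⟨C₁, h₁⟩ := hyp.V_bounded T S
  obtain ⟨C₂, h₂⟩ := hV'b T S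
  obtain ⟨C₃, h₃⟩ := hyp.W_bounded T (2 * S)
  obtain ⟨C₄, h₄⟩ := hyp.W_lipschitz T (2 * S)
  set A := max (max C₁ C₂) (max C₃ (max C₄ 0)) with hA
  have a₁ : C₁ ≤ A := by simp [hA]
  have a₂ : C₂ ≤ A := by simp [hA]
  have a₃ : C₃ ≤ A := by simp [hA]
  have a₄ : C₄ ≤ A := by simp [hA]
  have a₀ : 0 ≤ A := by simp [hA]
  refine ⟨A, fun t ht => ⟨a₀, fun z hz => (h₁ t ht z hz).trans a₁, fun z hz y hy => ?_,
    fun n p hp hps => ?_, fun z hz h0 => (h₃ t ht z hz h0).trans a₃,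
    fun z hz y hy h0 => (h₄ t ht z hz y hy h0).trans (by gcongr)⟩⟩
  · rw [(hV' t ht.1 y z).2]
    refine intervalIntegral.norm_integral_le_of_norm_le_const (f := V' t) fun x hx => ?_
    refine ((h₂ t ht).1 x ?_).trans a₂
    exact uIcc_subset_Icc hy hz (uIoc_subset_uIcc hx)
  · exact sum_abs_slope_sub_le (convex_Icc _ _) a₀ (hV' t ht.1)
      ((h₂ t ht).2.trans (ENNReal.ofReal_le_ofReal a₂)) n p hp hps

theorem Assumptions.intervalIntegrable_deriv_W {v : ℝ → ℝ} {V W : ℝ → ℝ → ℝ}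
    (hyp : Assumptions v V W) {t : ℝ} (ht : 0 ≤ t) (a b : ℝ) :
    IntervalIntegrable (deriv (W t)) volume a b := by
  obtain ⟨C, hC⟩ := hyp.W_bounded t (max |a| |b|)
  rw [intervalIntegrable_iff]
  refine Measure.integrableOn_of_bounded (M := C) (by simp)
    (measurable_deriv _).aestronglyMeasurable ?_
  rw [ae_restrict_iff' measurableSet_uIoc]
  filter_upwards [Measure.ae_ne volume (0 : ℝ)] with x hx hxab
  refine hC t ⟨ht, le_rfl⟩ x ?_ hx
  have := uIoc_subset_uIcc hxab
  refine uIcc_subset_Icc ?_ ?_ this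
  · exact abs_le.1 (le_max_left _ _)
  · exact abs_le.1 (le_max_right _ _)

theorem Assumptions.integral_deriv_W {v : ℝ → ℝ} {V W : ℝ → ℝ → ℝ}
    (hyp : Assumptions v V W) {t : ℝ} (ht : 0 ≤ t) (a b : ℝ) :
    ∫ x in a..b, deriv (W t) x = W t b - W t a :=
  integral_eq_of_hasDerivAt_off_countable _ _ (countable_singleton (0 : ℝ))
    (hyp.W_continuous t ht).continuousOn
    (fun x hx => (hyp.W_differentiable t ht x hx.2).hasDerivAt)
    (hyp.intervalIntegrable_deriv_W ht a b)

theorem SliceBounds.jump_le {V W : ℝ → ℝ} {S A : ℝ} (h : SliceBounds V W S A)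
    (hj : ∀ a b : ℝ, Tendsto (deriv W) (𝓝[>] 0) (𝓝 a) → Tendsto (deriv W) (𝓝[<] 0) (𝓝 b) → a ≤ b)
    {z y : ℝ} (hz : z ∈ Icc (-(2 * S)) (2 * S)) (hy : y ∈ Icc (-(2 * S)) (2 * S))
    (hz0 : 0 < z) (hy0 : y < 0) : deriv W z - deriv W y ≤ A * (z - y) := by
  have hS : 0 < 2 * S := hz0.trans_le hz.2
  obtain ⟨g, hg, hge⟩ := (LipschitzOnWith.of_dist_le_mul (K := ⟨A, h.nonneg⟩) (f := deriv W)
    (s := Ioc 0 (2 * S)) fun a ha b hb => by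
      rw [Real.dist_eq, Real.dist_eq]
      exact h.W_lip a ⟨by linarith [ha.1], ha.2⟩ b ⟨by linarith [hb.1], hb.2⟩
        (mul_pos ha.1 hb.1)).extend_real
  obtain ⟨k, hk, hke⟩ := (LipschitzOnWith.of_dist_le_mul (K := ⟨A, h.nonneg⟩) (f := deriv W)
    (s := Ico (-(2 * S)) 0) fun a ha b hb => by
      rw [Real.dist_eq, Real.dist_eq]
      exact h.W_lip a ⟨ha.1, by linarith [ha.2]⟩ b ⟨hb.1, by linarith [hb.2]⟩
        (mul_pos_of_neg_of_neg ha.2 hb.2)).extend_real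
  have l1 : Tendsto (deriv W) (𝓝[>] 0) (𝓝 (g 0)) := by
    refine (hg.continuous.continuousWithinAt (s := Ioi 0) (x := 0)).tendsto.congr' ?_
    filter_upwards [Ioc_mem_nhdsGT hS] with x hx using (hge hx).symm
  have l2 : Tendsto (deriv W) (𝓝[<] 0) (𝓝 (k 0)) := by
    refine (hk.continuous.continuousWithinAt (s := Iio 0) (x := 0)).tendsto.congr' ?_
    filter_upwards [Ico_mem_nhdsLT (a := -(2 * S)) (b := 0) (by linarith)] with x hx
      using (hke hx).symm
  have h0 := hj _ _ l1 l2
  have e1 := hg.dist_le_mul z 0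
  have e2 := hk.dist_le_mul y 0
  rw [Real.dist_eq, Real.dist_eq, sub_zero, abs_of_pos hz0] at e1
  rw [Real.dist_eq, Real.dist_eq, sub_zero, abs_of_neg hy0] at e2
  change _ ≤ A * _ at e1
  change _ ≤ A * _ at e2
  rw [hge ⟨hz0, hz.2⟩, hke ⟨hy.1, hy0⟩]
  have := (abs_le.1 e1).2
  have := (abs_le.1 e2).1
  linarith

end Traffic

namespace Traffic

/-! ### The piecewise constant density -/

section Cells

variable {N : ℕ} {x : ℕ → ℝ → ℝ} {t : ℝ}

theorem node_le (hx : ∀ i < N, x i t < x (i + 1) t) {i j : ℕ} (hij : i ≤ j) (hj : j ≤ N) :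
    x i t ≤ x j t := by
  induction j, hij using Nat.le_induction with
  | base => exact le_rfl
  | succ j _ ih => exact (ih (by omega)).trans (hx j (by omega)).le

theorem node_mem_Icc (hx : ∀ i < N, x i t < x (i + 1) t) {S : ℝ} (h0 : -S ≤ x 0 t)
    (hN : x N t ≤ S) {i : ℕ} (hi : i ≤ N) : x i t ∈ Icc (-S) S :=
  ⟨h0.trans (node_le hx (Nat.zero_le _) hi), (node_le hx hi le_rfl).trans hN⟩

theorem cellDensity_zero : cellDensity N x 0 t = 0 := by simp [cellDensity]

theorem cellDensity_last : cellDensity N x (N + 1) t = 0 := by simp [cellDensity]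

theorem cellDensity_succ {i : ℕ} (hi : i < N) :
    cellDensity N x (i + 1) t = 1 / ((N : ℝ) * (x (i + 1) t - x i t)) := by
  simp [cellDensity, hi]

theorem cellDensity_pos (hx : ∀ i < N, x i t < x (i + 1) t) {i : ℕ} (hi : i < N) :
    0 < cellDensity N x (i + 1) t := by
  rw [cellDensity_succ hi]
  have h1 : (0 : ℝ) < N := by exact_mod_cast (Nat.zero_le i).trans_lt hi
  have h2 := hx i hi
  have h3 : 0 < x (i + 1) t - x i t := by linarith
  positivity

theorem cellDensity_nonneg (hx : ∀ i < N, x i t < x (i + 1) t) (i : ℕ) :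
    0 ≤ cellDensity N x i t := by
  by_cases h : 1 ≤ i ∧ i ≤ N
  · obtain ⟨k, rfl⟩ := Nat.exists_eq_add_of_le' h.1
    exact (cellDensity_pos hx h.2).le
  · simp [cellDensity, h]

theorem cellDensity_mul_gap (hx : ∀ i < N, x i t < x (i + 1) t) {i : ℕ} (hi : i < N) :
    cellDensity N x (i + 1) t * (x (i + 1) t - x i t) = 1 / N := by
  rw [cellDensity_succ hi]
  have h1 : (0 : ℝ) < N := by exact_mod_cast (Nat.zero_le i).trans_lt hi
  have h2 := hx i hi
  have h3 : x (i + 1) t - x i t ≠ 0 := by linarith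
  field_simp

theorem sum_Icc_one_eq (f : ℕ → ℝ) :
    ∑ i ∈ Finset.Icc 1 N, f i = ∑ i ∈ Finset.range N, f (i + 1) := by
  rw [Finset.range_eq_Ico, Finset.sum_Ico_add' f 0 N 1]
  rfl

theorem particleDensity_eq_sum (y : ℝ) : particleDensity N x t y =
    ∑ i ∈ Finset.range N, (Ioo (x i t) (x (i + 1) t)).indicator
      (fun _ => cellDensity N x (i + 1) t) y := by
  rw [particleDensity, sum_Icc_one_eq]
  simp

theorem particleDensity_of_mem (hx : ∀ i < N, x i t < x (i + 1) t) {i : ℕ} (hi : i < N) {y : ℝ}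
    (hy : y ∈ Ioo (x i t) (x (i + 1) t)) :
    particleDensity N x t y = cellDensity N x (i + 1) t := by
  rw [particleDensity_eq_sum, Finset.sum_eq_single_of_mem i (Finset.mem_range.2 hi),
    indicator_of_mem hy]
  intro j hj hji
  have hj := Finset.mem_range.1 hj
  refine indicator_of_notMem (fun h => ?_) _
  rcases lt_or_gt_of_ne hji with h1 | h1
  · have := node_le hx (Nat.succ_le_of_lt h1) hi.le
    linarith [h.2, hy.1]
  · have := node_le hx (Nat.succ_le_of_lt h1) hj.le
    linarith [h.1, hy.2]

theorem particleDensity_of_notMem (hx : ∀ i < N, x i t < x (i + 1) t) {y : ℝ}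
    (hy : y ∉ Ioo (x 0 t) (x N t)) : particleDensity N x t y = 0 := by
  rw [particleDensity_eq_sum]
  refine Finset.sum_eq_zero fun i hi => indicator_of_notMem (fun h => hy ?_) _
  have hi := Finset.mem_range.1 hi
  exact ⟨(node_le hx (Nat.zero_le i) hi.le).trans_lt h.1, h.2.trans_le (node_le hx hi le_rfl)⟩

theorem particleDensity_nonneg (hx : ∀ i < N, x i t < x (i + 1) t) (y : ℝ) :
    0 ≤ particleDensity N x t y := by
  rw [particleDensity_eq_sum]
  exact Finset.sum_nonneg fun i _ => indicator_nonneg (fun _ _ => cellDensity_nonneg hx _) _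

theorem particleDensity_eq_zero_or (hx : ∀ i < N, x i t < x (i + 1) t) (y : ℝ) :
    particleDensity N x t y = 0 ∨
      ∃ i < N, y ∈ Ioo (x i t) (x (i + 1) t) ∧
        particleDensity N x t y = cellDensity N x (i + 1) t := by
  by_cases h : ∃ i < N, y ∈ Ioo (x i t) (x (i + 1) t)
  · obtain ⟨i, hi, hy⟩ := h
    exact Or.inr ⟨i, hi, hy, particleDensity_of_mem hx hi hy⟩
  · push Not at h
    left
    rw [particleDensity_eq_sum]
    exact Finset.sum_eq_zero fun i hi => indicator_of_notMem (h i (Finset.mem_range.1 hi)) _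

theorem particleDensity_le (hx : ∀ i < N, x i t < x (i + 1) t) {R : ℝ} (hR : 0 ≤ R)
    (h : ∀ i < N, cellDensity N x (i + 1) t ≤ R) (y : ℝ) : particleDensity N x t y ≤ R := by
  rcases particleDensity_eq_zero_or hx y with h0 | ⟨i, hi, -, h0⟩
  · rwa [h0]
  · rw [h0]; exact h i hi

theorem integrable_mul_particleDensity {g : ℝ → ℝ} (hg : ∀ a b, IntervalIntegrable g volume a b) :
    Integrable fun y => g y * particleDensity N x t y := by
  simp only [particleDensity_eq_sum, Finset.mul_sum]
  refine integrable_finsetSum _ fun i hi => ?_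
  have hi := Finset.mem_range.1 hi
  have := ((hg (x i t) (x (i + 1) t)).1.mono_set Ioo_subset_Ioc_self).mul_const
    (cellDensity N x (i + 1) t)
  replace this := (integrable_indicator_iff measurableSet_Ioo).2 this
  refine this.congr (.of_forall fun y => ?_)
  by_cases h : y ∈ Ioo (x i t) (x (i + 1) t) <;> simp [h]

theorem integral_mul_particleDensity (hx : ∀ i < N, x i t < x (i + 1) t) {g : ℝ → ℝ}
    (hg : ∀ a b, IntervalIntegrable g volume a b) :
    ∫ y, g y * particleDensity N x t y =
      ∑ i ∈ Finset.range N, cellDensity N x (i + 1) t * ∫ y in x i t..x (i + 1) t, g y := by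
  simp only [particleDensity_eq_sum, Finset.mul_sum]
  have e : ∀ i, (fun y => g y * (Ioo (x i t) (x (i + 1) t)).indicator
      (fun _ => cellDensity N x (i + 1) t) y) = (Ioo (x i t) (x (i + 1) t)).indicator
      (fun y => g y * cellDensity N x (i + 1) t) := fun i => by
    ext y
    by_cases h : y ∈ Ioo (x i t) (x (i + 1) t) <;> simp [h]
  rw [integral_finsetSum]
  · refine Finset.sum_congr rfl fun i hi => ?_
    have hi := Finset.mem_range.1 hi
    rw [e, integral_indicator measurableSet_Ioo, ← integral_Ioc_eq_integral_Ioo,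
      ← intervalIntegral.integral_of_le (hx i hi).le, intervalIntegral.integral_mul_const, mul_comm]
  · intro i hi
    rw [e, integrable_indicator_iff measurableSet_Ioo]
    exact ((hg _ _).1.mono_set Ioo_subset_Ioc_self).mul_const _

theorem integrable_particleDensity (N : ℕ) (x : ℕ → ℝ → ℝ) (t : ℝ) :
    Integrable fun y => particleDensity N x t y := by
  simpa using integrable_mul_particleDensity (g := fun _ => 1) fun a b => by simp

theorem integral_particleDensity (hN : 1 ≤ N) (hx : ∀ i < N, x i t < x (i + 1) t) :
    ∫ y, particleDensity N x t y = 1 := by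
  have h := integral_mul_particleDensity hx (g := fun _ => 1) fun a b => by simp
  simp only [one_mul, intervalIntegral.integral_const, smul_eq_mul, mul_one] at h
  rw [h, Finset.sum_congr rfl fun i hi => cellDensity_mul_gap hx (Finset.mem_range.1 hi)]
  have h1 : (N : ℝ) ≠ 0 := by positivity
  simp [h1]

theorem setIntegral_cell_particleDensity (hx : ∀ i < N, x i t < x (i + 1) t) {i : ℕ} (hi : i < N) :
    ∫ y in Ioo (x i t) (x (i + 1) t), particleDensity N x t y = 1 / N := by
  rw [setIntegral_congr_fun measurableSet_Ioo fun y hy => particleDensity_of_mem hx hi hy,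
    setIntegral_const, measureReal_def, Real.volume_Ioo, ENNReal.toReal_ofReal
      (by linarith [hx i hi]), smul_eq_mul, mul_comm, cellDensity_mul_gap hx hi]

/-- Summation by parts over the cells; the densities outside of the support vanish. -/
theorem sum_cellDensity_mul_sub (f : ℕ → ℝ) :
    ∑ i ∈ Finset.range N, cellDensity N x (i + 1) t * (f i - f (i + 1)) =
      ∑ i ∈ Finset.range (N + 1), (cellDensity N x (i + 1) t - cellDensity N x i t) * f i := by
  have h : ∀ n, ∑ i ∈ Finset.range n, cellDensity N x (i + 1) t * (f i - f (i + 1)) =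
      ∑ i ∈ Finset.range n, (cellDensity N x (i + 1) t - cellDensity N x i t) * f i
        - cellDensity N x n t * f n := by
    intro n
    induction n with
    | zero => simp [cellDensity_zero]
    | succ n ih => rw [Finset.sum_range_succ, Finset.sum_range_succ, ih]; ring
  rw [h, Finset.sum_range_succ, cellDensity_last]
  ring

end Cells

/-! ### The velocity field of the particles -/

section Field

variable {v : ℝ → ℝ} {V W : ℝ → ℝ → ℝ} {N : ℕ} {x : ℕ → ℝ → ℝ} {t : ℝ}

theorem intervalIntegrable_kernel (hyp : Assumptions v V W) (ht : 0 ≤ t) (z a b : ℝ) :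
    IntervalIntegrable (fun y => deriv (W t) (z - y)) volume a b := by
  simpa using (hyp.intervalIntegrable_deriv_W ht (z - a) (z - b)).comp_sub_left z

theorem particleField_eq (hyp : Assumptions v V W) (ht : 0 ≤ t)
    (hx : ∀ i < N, x i t < x (i + 1) t) (z : ℝ) :
    particleField V W N x t z = V t z - ∑ i ∈ Finset.range (N + 1),
      (cellDensity N x (i + 1) t - cellDensity N x i t) * W t (z - x i t) := by
  rw [particleField, velocityField, integral_mul_particleDensity hx
    (intervalIntegrable_kernel hyp ht z), ← sum_cellDensity_mul_sub fun i => W t (z - x i t)]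
  congr 1
  refine Finset.sum_congr rfl fun i _ => ?_
  rw [intervalIntegral.integral_comp_sub_left (fun y => deriv (W t) y) z,
    hyp.integral_deriv_W ht]

theorem particleField_sub (hyp : Assumptions v V W) (ht : 0 ≤ t) (z z' : ℝ) :
    particleField V W N x t z - particleField V W N x t z' = V t z - V t z' -
      ∫ y, (deriv (W t) (z - y) - deriv (W t) (z' - y)) * particleDensity N x t y := by
  simp only [sub_mul]
  rw [integral_sub (integrable_mul_particleDensity (intervalIntegrable_kernel hyp ht z))
    (integrable_mul_particleDensity (intervalIntegrable_kernel hyp ht z')), particleField,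
    velocityField, velocityField]
  ring

variable {S A : ℝ}

theorem sub_mem_of_density_ne_zero (hx : ∀ i < N, x i t < x (i + 1) t) (h0 : -S ≤ x 0 t)
    (hN : x N t ≤ S) {y z : ℝ} (hy : particleDensity N x t y ≠ 0) (hz : z ∈ Icc (-S) S) :
    z - y ∈ Icc (-(2 * S)) (2 * S) := by
  have hy' : y ∈ Ioo (x 0 t) (x N t) := by
    by_contra h
    exact hy (particleDensity_of_notMem hx h)
  constructor <;> linarith [hy'.1, hy'.2, hz.1, hz.2]

theorem abs_particleField_le (hN1 : 1 ≤ N) (hx : ∀ i < N, x i t < x (i + 1) t) (hb : SliceBounds (V t) (W t) S A) (h0 : -S ≤ x 0 t)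
    (hN : x N t ≤ S) {z : ℝ} (hz : z ∈ Icc (-S) S) : |particleField V W N x t z| ≤ 2 * A := by
  rw [particleField, velocityField]
  have h1 : |∫ y, deriv (W t) (z - y) * particleDensity N x t y| ≤ A := by
    calc _ ≤ ∫ y, A * particleDensity N x t y := by
          refine norm_integral_le_of_norm_le
            (f := fun y => deriv (W t) (z - y) * particleDensity N x t y) ((integrable_particleDensity N x t).const_mul A) ?_
          filter_upwards [Measure.ae_ne volume z] with y hy
          rw [Real.norm_eq_abs, abs_mul, abs_of_nonneg (particleDensity_nonneg hx y)]
          by_cases h : particleDensity N x t y = 0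
          · simp [h]
          · gcongr
            · exact particleDensity_nonneg hx y
            · exact hb.W_bound _ (sub_mem_of_density_ne_zero hx h0 hN h hz)
                (sub_ne_zero.2 hy.symm)
      _ = A := by rw [integral_const_mul, integral_particleDensity hN1 hx, mul_one]
  have h2 := hb.V_bound z hz
  exact (abs_sub _ _).trans (by linarith)

/-- An integral of kernel differences against the density, when the kernel is `A`-Lipschitz up to
jumps of height at most `B`, which occur for `y ∈ (z', z)` only. -/
theorem integral_kernel_sub_le (hyp : Assumptions v V W) (ht : 0 ≤ t) (hN1 : 1 ≤ N)
    (hx : ∀ i < N, x i t < x (i + 1) t) (hb : SliceBounds (V t) (W t) S A) (h0 : -S ≤ x 0 t)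
    (hN : x N t ≤ S) {z z' : ℝ} (hz : z ∈ Icc (-S) S) (hz' : z' ∈ Icc (-S) S) (hzz : z' ≤ z)
    {s B : ℝ} (hs : s = 1 ∨ s = -1)
    (hB : ∀ p ∈ Icc (-(2 * S)) (2 * S), ∀ q ∈ Icc (-(2 * S)) (2 * S), 0 < p → q < 0 →
      s * (deriv (W t) p - deriv (W t) q) ≤ A * (p - q) + B) :
    s * ∫ y, (deriv (W t) (z - y) - deriv (W t) (z' - y)) * particleDensity N x t y ≤
      A * (z - z') + B * ∫ y in Ioo z' z, particleDensity N x t y := by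
  have hρ := integrable_particleDensity N x t
  rw [← integral_const_mul, ← integral_indicator measurableSet_Ioo]
  have e : A * (z - z') = ∫ y, A * (z - z') * particleDensity N x t y := by
    rw [integral_const_mul, integral_particleDensity hN1 hx, mul_one]
  rw [e, ← integral_const_mul, ← integral_add (hρ.const_mul _)
    ((hρ.indicator measurableSet_Ioo).const_mul _)]
  refine integral_mono_ae ?_ ((hρ.const_mul _).add
    ((hρ.indicator measurableSet_Ioo).const_mul _)) ?_
  · exact (integrable_mul_particleDensity fun a b => (intervalIntegrable_kernel hyp ht z a b).sub
      (intervalIntegrable_kernel hyp ht z' a b)).const_mul s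
  filter_upwards [Measure.ae_ne volume z, Measure.ae_ne volume z'] with y hy hy'
  by_cases h : particleDensity N x t y = 0
  · have : (Ioo z' z).indicator (particleDensity N x t) y = 0 := by
      by_cases hm : y ∈ Ioo z' z <;> simp [hm, h]
    simp [h, this]
  have hp := sub_mem_of_density_ne_zero hx h0 hN h hz
  have hq := sub_mem_of_density_ne_zero hx h0 hN h hz'
  have hd := particleDensity_nonneg hx y
  by_cases hm : y ∈ Ioo z' z
  · rw [indicator_of_mem hm, ← mul_assoc, ← add_mul]
    refine mul_le_mul_of_nonneg_right ?_ hd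
    have := hB _ hp _ hq (by linarith [hm.2]) (by linarith [hm.1])
    rwa [sub_sub_sub_cancel_right] at this
  · rw [indicator_of_notMem hm, mul_zero, add_zero, ← mul_assoc]
    refine mul_le_mul_of_nonneg_right ?_ hd
    have hsame : 0 < (z - y) * (z' - y) := by
      rcases lt_or_gt_of_ne hy' with h1 | h1
      · exact mul_pos (by linarith) (by linarith)
      · have h2 : z < y := lt_of_le_of_ne (not_lt.1 fun h2 => hm ⟨h1, h2⟩) hy.symm
        exact mul_pos_of_neg_of_neg (by linarith) (by linarith)
    have h3 := hb.W_lip _ hp _ hq hsame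
    rw [sub_sub_sub_cancel_right, abs_of_nonneg (sub_nonneg.2 hzz)] at h3
    have h4 := abs_le.1 h3
    rcases hs with rfl | rfl <;> linarith

theorem SliceBounds.jump_le_two_mul {V W : ℝ → ℝ} (hb : SliceBounds V W S A) {s : ℝ}
    (hs : s = 1 ∨ s = -1) : ∀ p ∈ Icc (-(2 * S)) (2 * S), ∀ q ∈ Icc (-(2 * S)) (2 * S), 0 < p →
      q < 0 → s * (deriv W p - deriv W q) ≤ A * (p - q) + 2 * A := by
  intro p hp q hq hp0 hq0
  have h1 := abs_le.1 (hb.W_bound p hp hp0.ne')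
  have h2 := abs_le.1 (hb.W_bound q hq hq0.ne)
  have h3 : 0 ≤ A * (p - q) := mul_nonneg hb.nonneg (by linarith)
  rcases hs with rfl | rfl <;> linarith

theorem abs_particleField_sub_le (hyp : Assumptions v V W) (ht : 0 ≤ t) (hN1 : 1 ≤ N)
    (hx : ∀ i < N, x i t < x (i + 1) t) (hb : SliceBounds (V t) (W t) S A) (h0 : -S ≤ x 0 t)
    (hN : x N t ≤ S) {R : ℝ} (hR : 0 ≤ R) (hρR : ∀ i < N, cellDensity N x (i + 1) t ≤ R)
    {z z' : ℝ} (hz : z ∈ Icc (-S) S) (hz' : z' ∈ Icc (-S) S) :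
    |particleField V W N x t z - particleField V W N x t z'| ≤ (2 * A + 2 * A * R) * |z - z'| := by
  wlog hzz : z' ≤ z generalizing z z'
  · rw [abs_sub_comm, abs_sub_comm z]
    exact this hz' hz (le_of_not_ge hzz)
  have hA := hb.nonneg
  have hI : ∫ y in Ioo z' z, particleDensity N x t y ≤ R * (z - z') := by
    calc _ ≤ ∫ y in Ioo z' z, R := by
          refine setIntegral_mono (integrable_particleDensity N x t).integrableOn ?_
            fun y => particleDensity_le hx hR hρR y
          simp
      _ = R * (z - z') := by
          rw [setIntegral_const, measureReal_def, Real.volume_Ioo, ENNReal.toReal_ofReal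
            (by linarith), smul_eq_mul, mul_comm]
  have hIA := mul_le_mul_of_nonneg_left hI (by positivity : 0 ≤ 2 * A)
  have k1 := integral_kernel_sub_le hyp ht hN1 hx hb h0 hN hz hz' hzz (Or.inl rfl)
    (hb.jump_le_two_mul (Or.inl rfl))
  have k2 := integral_kernel_sub_le hyp ht hN1 hx hb h0 hN hz hz' hzz (Or.inr rfl)
    (hb.jump_le_two_mul (Or.inr rfl))
  have hV := abs_le.1 (hb.V_lip z hz z' hz')
  rw [particleField_sub hyp ht, abs_of_nonneg (sub_nonneg.2 hzz)]
  rw [abs_of_nonneg (sub_nonneg.2 hzz)] at hV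
  exact abs_le.2 ⟨by linarith, by linarith⟩

theorem particleField_cell_sub_ge (hyp : Assumptions v V W) (ht : 0 ≤ t) (hN1 : 1 ≤ N)
    (hx : ∀ i < N, x i t < x (i + 1) t) (hb : SliceBounds (V t) (W t) S A) (h0 : -S ≤ x 0 t)
    (hN : x N t ≤ S) {B : ℝ}
    (hB : ∀ p ∈ Icc (-(2 * S)) (2 * S), ∀ q ∈ Icc (-(2 * S)) (2 * S), 0 < p → q < 0 →
      1 * (deriv (W t) p - deriv (W t) q) ≤ A * (p - q) + B) {i : ℕ} (hi : i < N) :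
    -(2 * A + B * cellDensity N x (i + 1) t) * (x (i + 1) t - x i t) ≤
      particleField V W N x t (x (i + 1) t) - particleField V W N x t (x i t) := by
  have hz := node_mem_Icc hx h0 hN (Nat.succ_le_of_lt hi)
  have hz' := node_mem_Icc hx h0 hN hi.le
  have hzz := hx i hi
  have k := integral_kernel_sub_le hyp ht hN1 hx hb h0 hN hz hz' hzz.le (Or.inl rfl) hB
  have hV := abs_le.1 (hb.V_lip _ hz _ hz')
  rw [particleField_sub hyp ht]
  rw [setIntegral_cell_particleDensity hx hi] at k
  rw [abs_of_nonneg (sub_nonneg.2 hzz.le)] at hV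
  have e : B * (1 / N) = B * cellDensity N x (i + 1) t * (x (i + 1) t - x i t) := by
    rw [mul_assoc, cellDensity_mul_gap hx hi]
  linarith

end Field

end Traffic

namespace Traffic

/-- The total variation of the piecewise constant density. -/
noncomputable def totalVar (N : ℕ) (x : ℕ → ℝ → ℝ) (t : ℝ) : ℝ :=
  ∑ i ∈ Finset.range (N + 1), |cellDensity N x (i + 1) t - cellDensity N x i t|

section Slopes

variable {v : ℝ → ℝ} {V W : ℝ → ℝ → ℝ} {x : ℕ → ℝ → ℝ} {t S A : ℝ}

theorem sum_abs_slope_potential_sub_le (hyp : Assumptions v V W) (ht : 0 ≤ t)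
    (hb : SliceBounds (V t) (W t) S A) {n : ℕ} {p : ℕ → ℝ} (hp : ∀ i ≤ n, p i < p (i + 1))
    (hpS : ∀ i ≤ n + 1, p i ∈ Icc (-S) S) {j : ℕ} (hj : j ≤ n + 1) :
    ∑ i ∈ Finset.range n, |slope (fun z => W t (z - p j)) (p (i + 1)) (p (i + 2))
      - slope (fun z => W t (z - p j)) (p i) (p (i + 1))| ≤ 4 * S * A + 2 * A := by
  have hmono : ∀ k l, k ≤ l → l ≤ n + 1 → p k ≤ p l := by
    intro k l hkl
    induction l, hkl using Nat.le_induction with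
    | base => exact fun _ => le_rfl
    | succ l _ ih => exact fun h => (ih (by omega)).trans (hp l (by omega)).le
  have hξ : ∀ i ≤ n, ∃ ξ ∈ Ioo (p i) (p (i + 1)),
      deriv (W t) (ξ - p j) = slope (fun z => W t (z - p j)) (p i) (p (i + 1)) := by
    intro i hi
    obtain ⟨ξ, hξ, he⟩ := exists_deriv_eq_slope (fun z => W t (z - p j)) (hp i hi)
      ((hyp.W_continuous t ht).comp (continuous_id.sub continuous_const)).continuousOn (by
        intro z hz
        refine DifferentiableAt.differentiableWithinAt ?_
        have hz0 : z - p j ≠ 0 := by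
          rcases Nat.lt_or_ge i j with h | h
          · have := hmono (i + 1) j h hj
            have := hz.2
            exact (by linarith : z - p j < 0).ne
          · have := hmono j i h (by omega)
            have := hz.1
            exact (by linarith : 0 < z - p j).ne'
        exact DifferentiableAt.comp (g := W t) (f := fun z => z - p j) z
          (hyp.W_differentiable t ht _ hz0) (by fun_prop))
    refine ⟨ξ, hξ, ?_⟩
    rw [slope_def_field, ← he]
    exact (deriv_comp_sub_const (f := W t) (a := p j) ξ).symm
  have hA := hb.nonneg
  have hterm : ∀ i ∈ Finset.range n, |slope (fun z => W t (z - p j)) (p (i + 1)) (p (i + 2))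
      - slope (fun z => W t (z - p j)) (p i) (p (i + 1))|
      ≤ A * (p (i + 2) - p i) + if j = i + 1 then 2 * A else 0 := by
    intro i hi
    have hi := Finset.mem_range.1 hi
    obtain ⟨ξ, hξ1, he1⟩ := hξ i hi.le
    obtain ⟨η, hη1, he2⟩ := hξ (i + 1) hi
    rw [← he1, ← he2]
    have b0 := hpS i (by omega)
    have b1 := hpS (i + 1) (by omega)
    have b2 := hpS (i + 2) (by omega)
    have bj := hpS j hj
    have hξS : ξ - p j ∈ Icc (-(2 * S)) (2 * S) := by
      constructor <;> linarith [hξ1.1, hξ1.2, b0.1, b1.2, bj.1, bj.2]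
    have hηS : η - p j ∈ Icc (-(2 * S)) (2 * S) := by
      constructor <;> linarith [hη1.1, hη1.2, b1.1, b2.2, bj.1, bj.2]
    have hle : A * (η - ξ) ≤ A * (p (i + 2) - p i) := by
      gcongr
      exacts [hη1.2.le, hξ1.1.le]
    have h0 : 0 ≤ A * (p (i + 2) - p i) := by
      refine le_trans (mul_nonneg hA ?_) hle
      linarith [hξ1.2, hη1.1]
    by_cases hji : j = i + 1
    · rw [if_pos hji]
      subst hji
      have h1 := hb.W_bound _ hξS (sub_ne_zero.2 hξ1.2.ne)
      have h2 := hb.W_bound _ hηS (sub_ne_zero.2 hη1.1.ne')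
      exact (abs_sub _ _).trans (by linarith)
    · rw [if_neg hji, add_zero]
      have hs : 0 < (η - p j) * (ξ - p j) := by
        rcases Nat.lt_or_ge (i + 1) j with h | h
        · have := hmono (i + 2) j h hj
          exact mul_pos_of_neg_of_neg (by linarith [hη1.2]) (by linarith [hξ1.2, hη1.1, hη1.2])
        · have := hmono j i (by omega) (by omega)
          exact mul_pos (by linarith [hη1.1, hξ1.1, hξ1.2]) (by linarith [hξ1.1])
      refine (hb.W_lip _ hηS _ hξS hs).trans ?_
      rw [sub_sub_sub_cancel_right, abs_of_nonneg (by linarith [hξ1.2, hη1.1])]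
      exact hle
  have htel : ∀ m, ∑ i ∈ Finset.range m, (p (i + 2) - p i) = p (m + 1) + p m - p 1 - p 0 := by
    intro m
    induction m with
    | zero => simp
    | succ m ih => rw [Finset.sum_range_succ, ih]; ring
  refine (Finset.sum_le_sum hterm).trans ?_
  rw [Finset.sum_add_distrib, ← Finset.mul_sum, htel]
  have e1 : p (n + 1) + p n - p 1 - p 0 ≤ 4 * S := by
    linarith [(hpS (n + 1) le_rfl).2, (hpS n (by omega)).2, (hpS 1 (by omega)).1,
      (hpS 0 (by omega)).1]
  have e2 : ∑ i ∈ Finset.range n, (if j = i + 1 then 2 * A else 0) ≤ 2 * A := by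
    rcases j with _ | k
    · simp [hA]
    · simp only [Nat.add_right_cancel_iff, Finset.sum_ite_eq]
      split_ifs
      · exact le_rfl
      · positivity
  have := mul_le_mul_of_nonneg_left e1 hA
  linarith

theorem sum_abs_slope_particleField_sub_le (hyp : Assumptions v V W) (ht : 0 ≤ t)
    (hb : SliceBounds (V t) (W t) S A) {n : ℕ} (hx : ∀ i < n + 1, x i t < x (i + 1) t)
    (h0 : -S ≤ x 0 t) (hN : x (n + 1) t ≤ S) :
    ∑ i ∈ Finset.range n, |slope (particleField V W (n + 1) x t) (x (i + 1) t) (x (i + 2) t)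
      - slope (particleField V W (n + 1) x t) (x i t) (x (i + 1) t)|
      ≤ A + totalVar (n + 1) x t * (4 * S * A + 2 * A) := by
  have hp : ∀ i ≤ n, x i t < x (i + 1) t := fun i hi => hx i (by omega)
  have hpS : ∀ i ≤ n + 1, x i t ∈ Icc (-S) S := fun i hi => node_mem_Icc hx h0 hN hi
  set c : ℕ → ℝ := fun j => cellDensity (n + 1) x (j + 1) t - cellDensity (n + 1) x j t with hc
  have hslope : ∀ a b, slope (particleField V W (n + 1) x t) a b = slope (V t) a b -
      ∑ j ∈ Finset.range (n + 1 + 1), c j * slope (fun z => W t (z - x j t)) a b := by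
    intro a b
    simp only [slope_def_field, particleField_eq hyp ht hx, hc]
    simp only [mul_div_assoc', ← Finset.sum_div, mul_sub, Finset.sum_sub_distrib]
    ring
  have hterm : ∀ i, |slope (particleField V W (n + 1) x t) (x (i + 1) t) (x (i + 2) t)
      - slope (particleField V W (n + 1) x t) (x i t) (x (i + 1) t)| ≤
      |slope (V t) (x (i + 1) t) (x (i + 2) t) - slope (V t) (x i t) (x (i + 1) t)| +
      ∑ j ∈ Finset.range (n + 1 + 1), |c j| *
        |slope (fun z => W t (z - x j t)) (x (i + 1) t) (x (i + 2) t)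
          - slope (fun z => W t (z - x j t)) (x i t) (x (i + 1) t)| := by
    intro i
    rw [hslope, hslope, sub_sub_sub_comm, ← Finset.sum_sub_distrib]
    refine (abs_sub _ _).trans ?_
    gcongr
    refine (Finset.abs_sum_le_sum_abs _ _).trans (le_of_eq ?_)
    exact Finset.sum_congr rfl fun j _ => by rw [← mul_sub, abs_mul]
  refine (Finset.sum_le_sum fun i _ => hterm i).trans ?_
  rw [Finset.sum_add_distrib, Finset.sum_comm]
  refine add_le_add (hb.V_slope n (fun i => x i t) hp hpS) ?_
  rw [totalVar, Finset.sum_mul]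
  refine Finset.sum_le_sum fun j hj => ?_
  rw [← Finset.mul_sum]
  gcongr
  exact sum_abs_slope_potential_sub_le hyp ht hb (p := fun i => x i t) hp hpS
    (by have := Finset.mem_range.1 hj; omega)

end Slopes

/-! ### Regularity of the particle paths -/

section Dynamics

variable {v : ℝ → ℝ} {V W : ℝ → ℝ → ℝ} {N : ℕ} {x : ℕ → ℝ → ℝ} {t T : ℝ}

theorem Assumptions.v_le (hyp : Assumptions v V W) {r : ℝ} (hr : 0 ≤ r) : v r ≤ v 0 :=
  hyp.v_antitone self_mem_Ici hr hr

theorem particleVelocity_of_neg {i : ℕ} (h : particleField V W N x t (x i t) < 0) :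
    particleVelocity v V W N x i t = v (cellDensity N x i t) * particleField V W N x t (x i t) := by
  rw [particleVelocity, if_pos h]

theorem particleVelocity_of_nonneg {i : ℕ} (h : 0 ≤ particleField V W N x t (x i t)) :
    particleVelocity v V W N x i t =
      v (cellDensity N x (i + 1) t) * particleField V W N x t (x i t) := by
  rw [particleVelocity, if_neg h.not_gt]

theorem exists_particleVelocity_eq (hyp : Assumptions v V W) (hx : ∀ i < N, x i t < x (i + 1) t)
    (i : ℕ) : ∃ w, 0 ≤ w ∧ w ≤ v 0 ∧
      particleVelocity v V W N x i t = w * particleField V W N x t (x i t) := by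
  have h := cellDensity_nonneg hx
  rcases lt_or_ge (particleField V W N x t (x i t)) 0 with h1 | h1
  · exact ⟨_, hyp.v_nonneg _ (h i), hyp.v_le (h i), particleVelocity_of_neg h1⟩
  · exact ⟨_, hyp.v_nonneg _ (h _), hyp.v_le (h _), particleVelocity_of_nonneg h1⟩

theorem abs_particleVelocity_le (hyp : Assumptions v V W) (hx : ∀ i < N, x i t < x (i + 1) t)
    {i : ℕ} {C : ℝ} (hC : |particleField V W N x t (x i t)| ≤ C) :
    |particleVelocity v V W N x i t| ≤ v 0 * C := by
  obtain ⟨w, h1, h2, h3⟩ := exists_particleVelocity_eq hyp hx i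
  rw [h3, abs_mul, abs_of_nonneg h1]
  exact mul_le_mul h2 hC (abs_nonneg _) (h1.trans h2)

theorem SolvesODE.continuousOn (hs : SolvesODE v V W N x) {i : ℕ} (hi : i ≤ N) :
    ContinuousOn (x i) (Icc 0 T) := by
  rcases lt_or_ge T 0 with h | h
  · simp [Icc_eq_empty_of_lt h]
  have h1 : ContinuousOn (fun t => x i 0 + ∫ s in (0 : ℝ)..t, particleVelocity v V W N x i s)
      (Icc 0 T) := by
    refine continuousOn_const.add ?_
    have := intervalIntegral.continuousOn_primitive_interval
      ((intervalIntegrable_iff' (f := particleVelocity v V W N x i) (μ := volume)).1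
        (hs.integrable i hi T h))
    rwa [uIcc_of_le h] at this
  exact h1.congr fun t ht => hs.solution i hi t ht.1

theorem SolvesODE.exists_support (hs : SolvesODE v V W N x) (T : ℝ) :
    ∃ S, 0 ≤ S ∧ ∀ t ∈ Icc 0 T, -S ≤ x 0 t ∧ x N t ≤ S := by
  obtain ⟨C, hC⟩ := isCompact_Icc.exists_bound_of_continuousOn
    (hs.continuousOn (T := T) (Nat.zero_le N))
  obtain ⟨D, hD⟩ := isCompact_Icc.exists_bound_of_continuousOn (hs.continuousOn (T := T) le_rfl)
  refine ⟨max 0 (max C D), le_max_left _ _, fun t ht => ⟨?_, ?_⟩⟩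
  · have := (abs_le.1 (hC t ht)).1
    have : C ≤ max 0 (max C D) := by simp
    linarith
  · have := (abs_le.1 (hD t ht)).2
    have : D ≤ max 0 (max C D) := by simp
    linarith

theorem SolvesODE.exists_velocity_bound (hyp : Assumptions v V W) (hs : SolvesODE v V W N x)
    (hN1 : 1 ≤ N) (T : ℝ) :
    ∃ C, 0 ≤ C ∧ ∀ t ∈ Icc 0 T, ∀ i ≤ N, |particleVelocity v V W N x i t| ≤ C := by
  obtain ⟨S, -, hS⟩ := hs.exists_support T
  obtain ⟨A, hA⟩ := hyp.exists_sliceBounds T S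
  refine ⟨max 0 (v 0 * (2 * A)), le_max_left _ _, fun t ht i hi => ?_⟩
  have hx := hs.ordered t ht.1
  exact (abs_particleVelocity_le hyp hx (abs_particleField_le hN1 hx (hA t ht) (hS t ht).1
    (hS t ht).2 (node_mem_Icc hx (hS t ht).1 (hS t ht).2 hi))).trans (le_max_right _ _)

theorem SolvesODE.sub_eq (hs : SolvesODE v V W N x) {i : ℕ} (hi : i ≤ N) {a b : ℝ} (ha : 0 ≤ a)
    (hb : 0 ≤ b) : x i a - x i b = ∫ s in b..a, particleVelocity v V W N x i s := by
  rw [hs.solution i hi a ha, hs.solution i hi b hb, add_sub_add_left_eq_sub,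
    intervalIntegral.integral_interval_sub_left (hs.integrable i hi a ha) (hs.integrable i hi b hb)]

theorem SolvesODE.lipOn (hyp : Assumptions v V W) (hs : SolvesODE v V W N x) (hN1 : 1 ≤ N)
    {i : ℕ} (hi : i ≤ N) : LipOn T (x i) := by
  obtain ⟨C, hC, h⟩ := hs.exists_velocity_bound hyp hN1 T
  refine ⟨C, hC, fun a ha b hb => ?_⟩
  rw [hs.sub_eq hi ha.1 hb.1]
  refine intervalIntegral.norm_integral_le_of_norm_le_const
    (f := particleVelocity v V W N x i) fun s hs => h s ?_ i hi
  exact uIcc_subset_Icc hb ha (uIoc_subset_uIcc hs)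

theorem SolvesODE.ae_hasDerivAt (hs : SolvesODE v V W N x) (T : ℝ) :
    ∀ᵐ t, t ∈ Ioo 0 T → ∀ i ≤ N, HasDerivAt (x i) (particleVelocity v V W N x i t) t := by
  rcases lt_or_ge T 0 with hT | hT
  · exact .of_forall fun t ht => absurd (ht.1.trans ht.2) hT.not_gt
  have h : ∀ i ∈ Finset.range (N + 1), ∀ᵐ t, t ∈ Ioo 0 T →
      HasDerivAt (x i) (particleVelocity v V W N x i t) t := by
    intro i hi
    have hi : i ≤ N := Nat.lt_succ_iff.1 (Finset.mem_range.1 hi)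
    filter_upwards [(hs.integrable i hi T hT).ae_hasDerivAt_integral] with t ht htT
    have h1 := ht (by rw [uIcc_of_le hT]; exact Ioo_subset_Icc_self htT) 0 (by simp)
    refine (h1.const_add (x i 0)).congr_of_eventuallyEq ?_
    filter_upwards [Ioi_mem_nhds htT.1] with s hs0 using hs.solution i hi s (le_of_lt hs0)
  filter_upwards [(Finset.eventually_all _).2 h] with t ht htT i hi
  exact ht i (Finset.mem_range.2 (Nat.lt_succ_of_le hi)) htT

/-- The rate of change of the density in the `i`-th cell. -/
noncomputable def densityRate (v : ℝ → ℝ) (V W : ℝ → ℝ → ℝ) (N : ℕ) (x : ℕ → ℝ → ℝ) (i : ℕ) (t : ℝ) : ℝ :=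
  -(N * cellDensity N x i t ^ 2 *
    (particleVelocity v V W N x i t - particleVelocity v V W N x (i - 1) t))

theorem densityRate_zero : densityRate v V W N x 0 t = 0 := by
  simp [densityRate, cellDensity_zero]

theorem densityRate_last : densityRate v V W N x (N + 1) t = 0 := by
  simp [densityRate, cellDensity_last]

theorem hasDerivAt_cellDensity (hx : ∀ i < N, x i t < x (i + 1) t)
    (hd : ∀ i ≤ N, HasDerivAt (x i) (particleVelocity v V W N x i t) t) {i : ℕ} (hi : i ≤ N + 1) :
    HasDerivAt (cellDensity N x i) (densityRate v V W N x i t) t := by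
  rcases Nat.eq_zero_or_pos i with rfl | h0
  · rw [densityRate_zero]
    simpa [funext fun s => cellDensity_zero (N := N) (x := x) (t := s)] using hasDerivAt_const t 0
  obtain ⟨k, rfl⟩ := Nat.exists_eq_add_of_le' h0
  rcases Nat.lt_or_ge k N with hk | hk
  · have hg : 0 < x (k + 1) t - x k t := by linarith [hx k hk]
    have hN : (0 : ℝ) < N := by exact_mod_cast (Nat.zero_le k).trans_lt hk
    have h1 := (((hd (k + 1) hk).sub (hd k hk.le)).const_mul (N : ℝ)).inv
      (mul_pos hN hg).ne'
    have e : cellDensity N x (k + 1) = fun s => ((N : ℝ) * (x (k + 1) s - x k s))⁻¹ :=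
      funext fun s => by rw [cellDensity_succ hk, one_div]
    rw [e]
    refine h1.congr_deriv ?_
    simp only [densityRate, e, Pi.sub_apply, Nat.add_sub_cancel]
    field_simp
  · obtain rfl : k = N := by omega
    rw [densityRate_last]
    simpa [funext fun s => cellDensity_last (N := k) (x := x) (t := s)] using hasDerivAt_const t 0

theorem SolvesODE.lipOn_cellDensity (hyp : Assumptions v V W) (hs : SolvesODE v V W N x)
    (hN1 : 1 ≤ N) {i : ℕ} (hi : i ≤ N + 1) : LipOn T (cellDensity N x i) := by
  rcases Nat.eq_zero_or_pos i with rfl | h0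
  · simpa [funext fun s => cellDensity_zero (N := N) (x := x) (t := s)] using LipOn.const 0
  obtain ⟨k, rfl⟩ := Nat.exists_eq_add_of_le' h0
  rcases Nat.lt_or_ge k N with hk | hk
  · have e : cellDensity N x (k + 1) = fun s => ((N : ℝ) * (x (k + 1) s - x k s))⁻¹ :=
      funext fun s => by rw [cellDensity_succ hk, one_div]
    have hN : (0 : ℝ) < N := by exact_mod_cast hN1
    rw [e]
    refine LipOn.inv ((LipOn.const (N : ℝ)).mul ((hs.lipOn hyp hN1 hk).sub
      (hs.lipOn hyp hN1 hk.le))) fun t ht => mul_pos hN ?_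
    linarith [hs.ordered t ht.1 k hk]
  · obtain rfl : k = N := by omega
    simpa [funext fun s => cellDensity_last (N := k) (x := x) (t := s)] using LipOn.const 0

end Dynamics

end Traffic

namespace Traffic

/-! ### The support grows at most exponentially -/

section Support

variable {v : ℝ → ℝ} {V W : ℝ → ℝ → ℝ} {N : ℕ} {x : ℕ → ℝ → ℝ} {t T : ℝ}

theorem le_mul_max_of_growth {h : ℝ → ℝ} {C₁ C z : ℝ} (hz : 0 < z) (hC₁ : 0 ≤ C₁)
    (h₁ : z ≤ 1 → h z ≤ C₁) (h₂ : z * h z ≤ C * (1 + z ^ 2)) :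
    h z ≤ (C₁ + 2 * |C|) * max z 1 := by
  rcases le_total z 1 with hz1 | hz1
  · rw [max_eq_right hz1]
    have := h₁ hz1
    have := abs_nonneg C
    linarith
  · rw [max_eq_left hz1]
    have h3 : C * (1 + z ^ 2) ≤ |C| * (2 * z ^ 2) := by
      have : 1 ≤ z ^ 2 := one_le_pow₀ hz1
      calc C * (1 + z ^ 2) ≤ |C| * (1 + z ^ 2) := by gcongr; exact le_abs_self C
        _ ≤ |C| * (2 * z ^ 2) := by gcongr; linarith
    have h4 : z * h z ≤ z * (2 * |C| * z) := by nlinarith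
    have h5 := le_of_mul_le_mul_left h4 hz
    have : 0 ≤ C₁ * z := by positivity
    linarith

theorem Assumptions.exists_growth (hyp : Assumptions v V W) (T : ℝ) :
    ∃ K, 0 ≤ K ∧ ∀ t ∈ Icc 0 T, ∀ z, 0 < z →
      V t z ≤ K * max z 1 ∧ -V t (-z) ≤ K * max z 1 ∧
      -deriv (W t) z ≤ K * max z 1 ∧ deriv (W t) (-z) ≤ K * max z 1 := by
  obtain ⟨C₁, h₁⟩ := hyp.V_bounded T 1
  obtain ⟨C₂, h₂⟩ := hyp.V_growth T
  obtain ⟨C₃, h₃⟩ := hyp.W_bounded T 1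
  obtain ⟨C₄, h₄⟩ := hyp.W_growth T
  refine ⟨(|C₁| + 2 * |C₂|) + (|C₃| + 2 * |C₄|), by positivity, fun t ht z hz => ?_⟩
  have hm : 0 ≤ max z 1 := zero_le_one.trans (le_max_right _ _)
  have k1 : (|C₁| + 2 * |C₂|) * max z 1 ≤
      ((|C₁| + 2 * |C₂|) + (|C₃| + 2 * |C₄|)) * max z 1 :=
    mul_le_mul_of_nonneg_right (by linarith [abs_nonneg C₃, abs_nonneg C₄]) hm
  have k2 : (|C₃| + 2 * |C₄|) * max z 1 ≤
      ((|C₁| + 2 * |C₂|) + (|C₃| + 2 * |C₄|)) * max z 1 :=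
    mul_le_mul_of_nonneg_right (by linarith [abs_nonneg C₁, abs_nonneg C₂]) hm
  have m1 : z ≤ 1 → z ∈ Icc (-1 : ℝ) 1 := fun h => ⟨by linarith, h⟩
  have m2 : z ≤ 1 → -z ∈ Icc (-1 : ℝ) 1 := fun h => ⟨by linarith, by linarith⟩
  refine ⟨(le_mul_max_of_growth (h := V t) hz (abs_nonneg _) (fun h => ?_) (h₂ t ht z)).trans k1,
    (le_mul_max_of_growth (h := fun z => -V t (-z)) hz (abs_nonneg _) (fun h => ?_) ?_).trans k1,
    (le_mul_max_of_growth (h := fun z => -deriv (W t) z) hz (abs_nonneg _)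
      (fun h => ?_) ?_).trans k2,
    (le_mul_max_of_growth (h := fun z => deriv (W t) (-z)) hz (abs_nonneg _)
      (fun h => ?_) ?_).trans k2⟩
  · exact (le_abs_self _).trans ((h₁ t ht z (m1 h)).trans (le_abs_self _))
  · exact (neg_le_abs _).trans ((h₁ t ht _ (m2 h)).trans (le_abs_self _))
  · have := h₂ t ht (-z)
    rw [neg_sq] at this
    linarith
  · exact (neg_le_abs _).trans ((h₃ t ht z (m1 h) hz.ne').trans (le_abs_self _))
  · have := h₄ t ht z hz.ne'
    linarith
  · exact (le_abs_self _).trans ((h₃ t ht _ (m2 h) (neg_ne_zero.2 hz.ne')).trans (le_abs_self _))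
  · have := h₄ t ht (-z) (neg_ne_zero.2 hz.ne')
    rw [neg_sq] at this
    linarith

theorem integral_kernel_le (hyp : Assumptions v V W) (ht : 0 ≤ t) (hN1 : 1 ≤ N)
    (hx : ∀ i < N, x i t < x (i + 1) t) (z s C : ℝ)
    (h : ∀ y ∈ Ioo (x 0 t) (x N t), s * deriv (W t) (z - y) ≤ C) :
    s * ∫ y, deriv (W t) (z - y) * particleDensity N x t y ≤ C := by
  have hρ := integrable_particleDensity N x t
  calc s * ∫ y, deriv (W t) (z - y) * particleDensity N x t y
      = ∫ y, s * (deriv (W t) (z - y) * particleDensity N x t y) := (integral_const_mul _ _).symm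
    _ ≤ ∫ y, C * particleDensity N x t y := by
      refine integral_mono ((integrable_mul_particleDensity
        (intervalIntegrable_kernel hyp ht z)).const_mul s) (hρ.const_mul C) fun y => ?_
      by_cases hy : y ∈ Ioo (x 0 t) (x N t)
      · simp only [← mul_assoc]
        exact mul_le_mul_of_nonneg_right (h y hy) (particleDensity_nonneg hx y)
      · simp [particleDensity_of_notMem hx hy]
    _ = C := by rw [integral_const_mul, integral_particleDensity hN1 hx, mul_one]

theorem SolvesODE.exists_uniform_support (hyp : Assumptions v V W) (T S₀ : ℝ) :
    ∃ S, 0 ≤ S ∧ ∀ (N : ℕ) (x : ℕ → ℝ → ℝ), 1 ≤ N → SolvesODE v V W N x → -S₀ ≤ x 0 0 →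
      x N 0 ≤ S₀ → ∀ t ∈ Icc 0 T, -S ≤ x 0 t ∧ x N t ≤ S := by
  obtain ⟨K, hK, hg⟩ := hyp.exists_growth T
  obtain ⟨R, hR⟩ := exists_bound_of_linear_max S₀ (v 0 * (3 * K)) T
  refine ⟨max R 0, le_max_right _ _, fun N x hN1 hs h0 hN => ?_⟩
  set f : ℕ → ℝ → ℝ := fun i => if i = 0 then x N else fun t => -x 0 t with hf
  have key := hR {0, 1} f ?_ ?_ ?_
  · intro t ht
    have h1 := key 0 (by simp) t ht
    have h2 := key 1 (by simp) t ht
    simp only [hf, if_true, one_ne_zero, if_false] at h1 h2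
    have := le_max_left R 0
    constructor <;> linarith
  · intro i hi
    simp only [Finset.mem_insert, Finset.mem_singleton] at hi
    rcases hi with rfl | rfl
    · exact hs.lipOn hyp hN1 le_rfl
    · exact (hs.lipOn hyp hN1 (Nat.zero_le N)).neg
  · intro i hi
    simp only [Finset.mem_insert, Finset.mem_singleton] at hi
    rcases hi with rfl | rfl
    · exact hN
    · simp only [hf, one_ne_zero, if_false]
      linarith
  · intro i hi
    filter_upwards [hs.ae_hasDerivAt T] with t hd ht hmax d hfd
    have hd := hd ht
    have hx := hs.ordered t ht.1.le
    have htT : t ∈ Icc 0 T := Ioo_subset_Icc_self ht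
    have h0N : x 0 t < x N t :=
      (hx 0 (by omega)).trans_le (node_le hx (i := 1) hN1 le_rfl)
    simp only [Finset.mem_insert, Finset.mem_singleton, forall_eq_or_imp, forall_eq] at hi hmax
    have hsum : ∀ a b : ℝ, 0 < a → b ≤ 2 * a → max b 1 ≤ 2 * max a 1 := by
      intro a b _ hb
      refine max_le ?_ ?_
      · linarith [le_max_left a 1]
      · linarith [le_max_right a 1]
    have fin : ∀ w r m : ℝ, 0 ≤ w → w ≤ v 0 → 0 ≤ m → r ≤ 3 * K * m →
        w * r ≤ v 0 * (3 * K) * m := by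
      intro w r m h1 h2 h3 h4
      calc w * r ≤ w * (3 * K * m) := by gcongr
        _ ≤ v 0 * (3 * K * m) := by gcongr
        _ = _ := by ring
    rcases hi with rfl | rfl
    · simp only [hf, if_true, one_ne_zero, if_false] at hmax hfd ⊢
      have hpos : 0 < x N t := by linarith [hmax.2]
      rw [hfd.unique (hd N le_rfl)]
      obtain ⟨w, hw0, hw1, hw⟩ := exists_particleVelocity_eq hyp hx N
      rw [hw]
      refine fin _ _ _ hw0 hw1 (zero_le_one.trans (le_max_right _ _)) ?_
      have h1 := (hg t htT _ hpos).1
      have h2 := integral_kernel_le hyp ht.1.le hN1 hx (x N t) (-1) (K * (2 * max (x N t) 1)) (by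
        intro y hy
        have h3 := (hg t htT (x N t - y) (by linarith [hy.2])).2.2.1
        rw [neg_one_mul]
        refine h3.trans ?_
        gcongr
        exact hsum _ _ hpos (by linarith [hy.1, hmax.2]))
      rw [particleField, velocityField]
      linarith
    · simp only [hf, if_true, one_ne_zero, if_false] at hmax hfd ⊢
      have hpos : 0 < -x 0 t := by linarith [hmax.1]
      rw [hfd.unique (hd 0 (Nat.zero_le N)).neg]
      obtain ⟨w, hw0, hw1, hw⟩ := exists_particleVelocity_eq hyp hx 0
      rw [hw, ← mul_neg]
      refine fin _ _ _ hw0 hw1 (zero_le_one.trans (le_max_right _ _)) ?_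
      have h1 := (hg t htT _ hpos).2.1
      have h2 := integral_kernel_le hyp ht.1.le hN1 hx (x 0 t) 1 (K * (2 * max (-x 0 t) 1)) (by
        intro y hy
        have h3 := (hg t htT (y - x 0 t) (by linarith [hy.1])).2.2.2
        rw [neg_sub] at h3
        rw [one_mul]
        refine h3.trans ?_
        gcongr
        exact hsum _ _ hpos (by linarith [hy.2, hmax.1]))
      rw [neg_neg] at h1
      rw [particleField, velocityField]
      linarith

end Support

/-! ### The density stays bounded -/

section Density

variable {v : ℝ → ℝ} {V W : ℝ → ℝ → ℝ} {N : ℕ} {x : ℕ → ℝ → ℝ} {t T : ℝ}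

theorem Assumptions.continuousOn_v (hyp : Assumptions v V W) : ContinuousOn v (Ici 0) := by
  intro r hr
  obtain ⟨K, hK⟩ := hyp.v_lipschitz (r + 1)
  have h : Icc 0 (r + 1) ∈ 𝓝[Ici 0] r := by
    rw [← Ici_inter_Iic]
    exact inter_mem_nhdsWithin _ (Iic_mem_nhds (by linarith))
  exact (hK.continuousOn r ⟨hr, by linarith⟩).mono_of_mem_nhdsWithin h

theorem densityRate_le_of_max (hyp : Assumptions v V W) (hx : ∀ i < N, x i t < x (i + 1) t)
    {A B : ℝ} {i : ℕ} (hi : i < N)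
    (hmax : ∀ j < N, cellDensity N x (j + 1) t ≤ cellDensity N x (i + 1) t)
    (hU : -(A + B * cellDensity N x (i + 1) t) * (x (i + 1) t - x i t) ≤
      particleField V W N x t (x (i + 1) t) - particleField V W N x t (x i t)) :
    densityRate v V W N x (i + 1) t ≤ cellDensity N x (i + 1) t * v (cellDensity N x (i + 1) t)
      * (A + B * cellDensity N x (i + 1) t) := by
  set ρ := cellDensity N x (i + 1) t with hρ
  have hpos : 0 < ρ := cellDensity_pos hx hi
  have hall : ∀ j, cellDensity N x j t ≤ ρ := by
    intro j
    by_cases h : 1 ≤ j ∧ j ≤ N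
    · obtain ⟨k, rfl⟩ := Nat.exists_eq_add_of_le' h.1
      exact hmax k h.2
    · simp [cellDensity, h, hpos.le]
  have hv : ∀ j, v ρ ≤ v (cellDensity N x j t) := fun j =>
    hyp.v_antitone (cellDensity_nonneg hx j) hpos.le (hall j)
  have h1 : v ρ * particleField V W N x t (x (i + 1) t) ≤ particleVelocity v V W N x (i + 1) t := by
    rcases lt_or_ge (particleField V W N x t (x (i + 1) t)) 0 with h | h
    · rw [particleVelocity_of_neg h]
    · rw [particleVelocity_of_nonneg h]
      exact mul_le_mul_of_nonneg_right (hv _) h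
  have h2 : particleVelocity v V W N x i t ≤ v ρ * particleField V W N x t (x i t) := by
    rcases lt_or_ge (particleField V W N x t (x i t)) 0 with h | h
    · rw [particleVelocity_of_neg h]
      exact mul_le_mul_of_nonpos_right (hv _) h.le
    · rw [particleVelocity_of_nonneg h]
  have hvρ : 0 ≤ v ρ := hyp.v_nonneg _ hpos.le
  have h3 := mul_le_mul_of_nonneg_left hU hvρ
  have h4 : -(particleVelocity v V W N x (i + 1) t - particleVelocity v V W N x i t) ≤
      v ρ * ((A + B * ρ) * (x (i + 1) t - x i t)) := by linarith
  have hgap := cellDensity_mul_gap hx hi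
  have hN : (0 : ℝ) < N := by exact_mod_cast (Nat.zero_le i).trans_lt hi
  have hNg : (N : ℝ) * (ρ * (x (i + 1) t - x i t)) = 1 := by
    rw [hgap]; field_simp
  have h5 := mul_le_mul_of_nonneg_left h4 (by positivity : 0 ≤ (N : ℝ) * ρ ^ 2)
  rw [densityRate, Nat.add_sub_cancel, ← hρ]
  calc -(N * ρ ^ 2 * (particleVelocity v V W N x (i + 1) t - particleVelocity v V W N x i t))
      ≤ N * ρ ^ 2 * (v ρ * ((A + B * ρ) * (x (i + 1) t - x i t))) := by linarith
    _ = ρ * v ρ * (A + B * ρ) * (N * (ρ * (x (i + 1) t - x i t))) := by ring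
    _ = _ := by rw [hNg, mul_one]

/-- The density bound, from an a priori differential inequality at maximal cells. -/
theorem exists_density_bound_of_rate (hyp : Assumptions v V W) {A B : ℝ} (hA : 0 ≤ A) (hB : 0 ≤ B)
    (hcong : B = 0 ∨ Osgood v) (T R₀ : ℝ) :
    ∃ R, 0 ≤ R ∧ ∀ (N : ℕ) (x : ℕ → ℝ → ℝ), 1 ≤ N → SolvesODE v V W N x →
      (∀ i < N, cellDensity N x (i + 1) 0 ≤ R₀) →
      (∀ t ∈ Icc 0 T, ∀ i < N, -(A + B * cellDensity N x (i + 1) t) * (x (i + 1) t - x i t) ≤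
        particleField V W N x t (x (i + 1) t) - particleField V W N x t (x i t)) →
      ∀ t ∈ Icc 0 T, ∀ i < N, cellDensity N x (i + 1) t ≤ R := by
  have hv0 : ∀ r, 0 ≤ r → 0 ≤ v r := hyp.v_nonneg
  suffices h : ∃ (g : ℝ → ℝ) (C : ℝ), Continuous g ∧ (∀ r, 0 < g r) ∧
      ¬ IntegrableOn (fun r => (g r)⁻¹) (Ioi 1) ∧
      ∀ r, 0 < r → r * v r * (A + B * r) ≤ C * g r by
    obtain ⟨g, C, hg, hpos, hint, hle⟩ := h
    obtain ⟨R, hR⟩ := exists_bound_of_osgood_max hg hpos hint R₀ C T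
    refine ⟨max R 0, le_max_right _ _, fun N x hN1 hs h0 hU t ht i hi => ?_⟩
    refine (hR (Finset.range N) (fun i => cellDensity N x (i + 1))
      (fun i hi => hs.lipOn_cellDensity hyp hN1 (by have := Finset.mem_range.1 hi; omega))
      (fun i hi => h0 i (Finset.mem_range.1 hi)) (fun i hi => ?_) i (Finset.mem_range.2 hi)
      t ht).trans (le_max_left _ _)
    have hi := Finset.mem_range.1 hi
    filter_upwards [hs.ae_hasDerivAt T] with s hd hsT hmax d hcd
    have hx := hs.ordered s hsT.1.le
    rw [hcd.unique (hasDerivAt_cellDensity hx (hd hsT) (by omega))]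
    exact (densityRate_le_of_max hyp hx hi (fun j hj => hmax j (Finset.mem_range.2 hj))
      (hU s (Ioo_subset_Icc_self hsT) i hi)).trans (hle _ (cellDensity_pos hx hi))
  have hmax1 : ∀ r : ℝ, 0 < max r 1 := fun r => zero_lt_one.trans_le (le_max_right _ _)
  rcases hcong with rfl | hO
  · refine ⟨fun r => max r 1, v 0 * A, by fun_prop, hmax1, not_integrableOn_inv_max_one,
      fun r hr => ?_⟩
    have h1 := hyp.v_le hr.le
    have h2 := hv0 r hr.le
    calc r * v r * (A + 0 * r) = v r * A * r := by ring
      _ ≤ v 0 * A * max r 1 := by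
        gcongr
        exact mul_nonneg (h2.trans h1) hA
        exact le_max_left _ _
  · by_cases hv : ∀ r, 1 ≤ r → 0 < v r
    · have hgpos : ∀ r, 0 < max r 1 ^ 2 * v (max r 1) := fun r =>
        mul_pos (pow_pos (hmax1 r) 2) (hv _ (le_max_right _ _))
      refine ⟨fun r => max r 1 ^ 2 * v (max r 1), (A + B) * (1 + v 0 / v 1), ?_, hgpos, ?_, ?_⟩
      · refine Continuous.mul (by fun_prop) ?_
        exact hyp.continuousOn_v.comp_continuous (by fun_prop) fun r => (hmax1 r).le
      · intro hint
        have hlt := hint.2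
        rw [hasFiniteIntegral_iff_ofReal (.of_forall fun r => (inv_pos.2 (hgpos r)).le)] at hlt
        refine hlt.ne ?_
        rw [← hO]
        refine setLIntegral_congr_fun measurableSet_Ioi fun r hr => ?_
        simp only [max_eq_left (le_of_lt (mem_Ioi.1 hr))]
        refine ENNReal.ofReal_inv_of_pos ?_
        exact mul_pos (pow_pos (zero_lt_one.trans hr) 2) (hv r (le_of_lt hr))
      · intro r hr
        have h1 := hyp.v_le hr.le
        have h2 := hv0 r hr.le
        have h3 := hv 1 le_rfl
        have h4 := hv0 0 le_rfl
        rcases le_total r 1 with h | h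
        · simp only [max_eq_right h]
          calc r * v r * (A + B * r) ≤ 1 * v 0 * (A + B * 1) := by gcongr
            _ = (A + B) * (v 0 / v 1) * (1 ^ 2 * v 1) := by field_simp
            _ ≤ (A + B) * (1 + v 0 / v 1) * (1 ^ 2 * v 1) := by
              gcongr
              linarith
        · simp only [max_eq_left h]
          have h5 : A + B * r ≤ (A + B) * r := by nlinarith
          calc r * v r * (A + B * r) ≤ r * v r * ((A + B) * r) := by gcongr
            _ = (A + B) * 1 * (r ^ 2 * v r) := by ring
            _ ≤ (A + B) * (1 + v 0 / v 1) * (r ^ 2 * v r) := by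
              gcongr
              have : 0 ≤ v 0 / v 1 := by positivity
              linarith
    · push Not at hv
      obtain ⟨r₀, h1, h2⟩ := hv
      refine ⟨fun r => max r 1, v 0 * (A + B * r₀), by fun_prop, hmax1,
        not_integrableOn_inv_max_one, fun r hr => ?_⟩
      have h4 := hv0 0 le_rfl
      have h5 := hv0 r hr.le
      have hr₀ : 0 ≤ r₀ := zero_le_one.trans h1
      rcases le_total r r₀ with h | h
      · calc r * v r * (A + B * r) = v r * (A + B * r) * r := by ring
          _ ≤ v 0 * (A + B * r₀) * max r 1 := by
            gcongr
            exacts [hyp.v_le hr.le, le_max_left _ _]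
      · have : v r = 0 := le_antisymm ((hyp.v_antitone hr₀ hr.le h).trans h2) h5
        rw [this, mul_zero, zero_mul]
        have := hmax1 r
        positivity

theorem SolvesODE.exists_uniform_density (hyp : Assumptions v V W) (T R₀ S : ℝ) :
    ∃ R, 0 ≤ R ∧ ∀ (N : ℕ) (x : ℕ → ℝ → ℝ), 1 ≤ N → SolvesODE v V W N x →
      (∀ t ∈ Icc 0 T, -S ≤ x 0 t ∧ x N t ≤ S) → (∀ i < N, cellDensity N x (i + 1) 0 ≤ R₀) →
      ∀ t ∈ Icc 0 T, ∀ i < N, cellDensity N x (i + 1) t ≤ R := by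
  rcases lt_or_ge T 0 with hT | hT
  · refine ⟨0, le_rfl, fun N x _ _ _ _ t ht => absurd (ht.1.trans ht.2) hT.not_ge⟩
  obtain ⟨A, hA⟩ := hyp.exists_sliceBounds T S
  have hA0 : 0 ≤ A := (hA 0 ⟨le_rfl, hT⟩).nonneg
  rcases hyp.congestion with hj | hO
  · obtain ⟨R, hR0, hR⟩ := exists_density_bound_of_rate hyp (A := 2 * A) (B := 0) (by positivity)
      le_rfl (Or.inl rfl) T R₀
    refine ⟨R, hR0, fun N x hN1 hs hS h0 => hR N x hN1 hs h0 fun t ht i hi => ?_⟩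
    refine particleField_cell_sub_ge hyp ht.1 hN1 (hs.ordered t ht.1) (hA t ht) (hS t ht).1
      (hS t ht).2 (fun p hp q hq hp0 hq0 => ?_) hi
    rw [one_mul, add_zero]
    exact (hA t ht).jump_le (hj t ht.1) hp hq hp0 hq0
  · obtain ⟨R, hR0, hR⟩ := exists_density_bound_of_rate hyp (A := 2 * A) (B := 2 * A)
      (by positivity) (by positivity) (Or.inr hO) T R₀
    refine ⟨R, hR0, fun N x hN1 hs hS h0 => hR N x hN1 hs h0 fun t ht i hi => ?_⟩
    exact particleField_cell_sub_ge hyp ht.1 hN1 (hs.ordered t ht.1) (hA t ht) (hS t ht).1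
      (hS t ht).2 ((hA t ht).jump_le_two_mul (Or.inl rfl)) hi

end Density

end Traffic

namespace Traffic

variable {v : ℝ → ℝ} {V W : ℝ → ℝ → ℝ} {N : ℕ} {x : ℕ → ℝ → ℝ} {t T : ℝ}

/-! ### Sign relations of the upwind scheme -/

theorem abs_sign_le_one (r : ℝ) : |Real.sign r| ≤ 1 := by
  rcases Real.sign_apply_eq r with h | h | h <;> simp [h]

theorem Assumptions.sign_mul_nonneg (hyp : Assumptions v V W) {p c s : ℝ} (hp : 0 ≤ p)
    (hc : 0 ≤ c) (hs : |s| ≤ 1) : 0 ≤ (s - Real.sign (p - c)) * (v p - v c) := by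
  have h1 := abs_le.1 hs
  rcases lt_trichotomy p c with h | h | h
  · rw [Real.sign_of_neg (sub_neg.2 h)]
    have := hyp.v_antitone hp hc h.le
    exact mul_nonneg (by linarith) (by linarith)
  · simp [h]
  · rw [Real.sign_of_pos (sub_pos.2 h)]
    have := hyp.v_antitone hc hp h.le
    exact mul_nonneg_of_nonpos_of_nonpos (by linarith) (by linarith)

theorem mul_particleVelocity_sub_nonneg {i : ℕ} {s w : ℝ}
    (h₁ : 0 ≤ s * (v (cellDensity N x (i + 1) t) - w))
    (h₂ : s * (v (cellDensity N x i t) - w) ≤ 0) :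
    0 ≤ s * (particleVelocity v V W N x i t - w * particleField V W N x t (x i t)) := by
  rcases lt_or_ge (particleField V W N x t (x i t)) 0 with h | h
  · rw [particleVelocity_of_neg h, ← sub_mul, ← mul_assoc]
    exact mul_nonneg_of_nonpos_of_nonpos h₂ h.le
  · rw [particleVelocity_of_nonneg h, ← sub_mul, ← mul_assoc]
    exact mul_nonneg h₁ h

theorem abs_particleVelocity_sub_le {i : ℕ} {w D C : ℝ} (hD : 0 ≤ D)
    (h₁ : |v (cellDensity N x (i + 1) t) - w| ≤ D) (h₂ : |v (cellDensity N x i t) - w| ≤ D)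
    (hC : |particleField V W N x t (x i t)| ≤ C) :
    |particleVelocity v V W N x i t - w * particleField V W N x t (x i t)| ≤ D * C := by
  rcases lt_or_ge (particleField V W N x t (x i t)) 0 with h | h
  · rw [particleVelocity_of_neg h, ← sub_mul, abs_mul]
    gcongr
  · rw [particleVelocity_of_nonneg h, ← sub_mul, abs_mul]
    gcongr

/-! ### The total variation stays bounded -/

theorem sum_mul_sub_eq_of_zero (σ r : ℕ → ℝ) (h0 : r 0 = 0) (hN : r (N + 1) = 0) :
    ∑ i ∈ Finset.range (N + 1), σ i * (r (i + 1) - r i) =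
      ∑ i ∈ Finset.range N, r (i + 1) * (σ i - σ (i + 1)) := by
  have h : ∀ n, ∑ i ∈ Finset.range n, r (i + 1) * (σ i - σ (i + 1)) =
      ∑ i ∈ Finset.range n, σ i * (r (i + 1) - r i) - r n * σ n := by
    intro n
    induction n with
    | zero => simp [h0]
    | succ n ih => rw [Finset.sum_range_succ, Finset.sum_range_succ, ih]; ring
  rw [h, Finset.sum_range_succ, hN]
  ring

theorem neg_sum_sign_sub_mul_le (σ q : ℕ → ℝ) (hσ : ∀ i, |σ i| ≤ 1) (n : ℕ) :
    -∑ i ∈ Finset.range (n + 1), (σ i - σ (i + 1)) * q i ≤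
      |q 0| + |q n| + ∑ i ∈ Finset.range n, |q (i + 1) - q i| := by
  have h : ∑ i ∈ Finset.range (n + 1), (σ i - σ (i + 1)) * q i =
      σ 0 * q 0 - σ (n + 1) * q n + ∑ i ∈ Finset.range n, σ (i + 1) * (q (i + 1) - q i) := by
    induction n with
    | zero => simp; ring
    | succ n ih => rw [Finset.sum_range_succ, ih, Finset.sum_range_succ _ n]; ring
  have hb : ∀ i r, |σ i * r| ≤ |r| := fun i r => by
    rw [abs_mul]
    exact mul_le_of_le_one_left (abs_nonneg _) (hσ i)
  have h1 := (abs_le.1 (hb 0 (q 0))).1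
  have h2 := (abs_le.1 (hb (n + 1) (q n))).2
  have h3 : -∑ i ∈ Finset.range n, |q (i + 1) - q i| ≤
      ∑ i ∈ Finset.range n, σ (i + 1) * (q (i + 1) - q i) := by
    rw [← Finset.sum_neg_distrib]
    exact Finset.sum_le_sum fun i _ => (abs_le.1 (hb (i + 1) _)).1
  rw [h]
  linarith

theorem densityRate_mul_le (hyp : Assumptions v V W) (hx : ∀ i < N, x i t < x (i + 1) t) {i : ℕ}
    (hi : i < N) :
    densityRate v V W N x (i + 1) t *
      (Real.sign (cellDensity N x (i + 1) t - cellDensity N x i t)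
        - Real.sign (cellDensity N x (i + 2) t - cellDensity N x (i + 1) t)) ≤
    -((Real.sign (cellDensity N x (i + 1) t - cellDensity N x i t)
        - Real.sign (cellDensity N x (i + 2) t - cellDensity N x (i + 1) t)) *
      (mobility v (cellDensity N x (i + 1) t)
        * slope (particleField V W N x t) (x i t) (x (i + 1) t))) := by
  have hρ := cellDensity_nonneg hx
  set σ := Real.sign (cellDensity N x (i + 1) t - cellDensity N x i t) with hσ
  set σ' := Real.sign (cellDensity N x (i + 2) t - cellDensity N x (i + 1) t) with hσ'
  have h1 : 0 ≤ (σ - σ') * (particleVelocity v V W N x (i + 1) t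
      - v (cellDensity N x (i + 1) t) * particleField V W N x t (x (i + 1) t)) :=
    mul_particleVelocity_sub_nonneg (hyp.sign_mul_nonneg (hρ _) (hρ _) (abs_sign_le_one _))
      (by simp)
  have h2 : 0 ≤ (σ' - σ) * (particleVelocity v V W N x i t
      - v (cellDensity N x (i + 1) t) * particleField V W N x t (x i t)) := by
    refine mul_particleVelocity_sub_nonneg (by simp) ?_
    have := hyp.sign_mul_nonneg (hρ i) (hρ (i + 1)) (s := -σ') (by
      rw [abs_neg]; exact abs_sign_le_one _)
    have e : Real.sign (cellDensity N x i t - cellDensity N x (i + 1) t) = -σ := by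
      rw [hσ, ← Real.sign_neg, neg_sub]
    rw [e] at this
    linarith
  set ρ := cellDensity N x (i + 1) t with hρe
  have hN : (0 : ℝ) < N := by exact_mod_cast (Nat.zero_le i).trans_lt hi
  have hg : 0 < x (i + 1) t - x i t := by linarith [hx i hi]
  have hgap := cellDensity_mul_gap hx hi
  have hNg : (N : ℝ) * ρ * (x (i + 1) t - x i t) = 1 := by
    rw [mul_assoc, hgap]; field_simp
  have hm : mobility v ρ * slope (particleField V W N x t) (x i t) (x (i + 1) t) =
      N * ρ ^ 2 * (v ρ * particleField V W N x t (x (i + 1) t)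
        - v ρ * particleField V W N x t (x i t)) := by
    rw [slope_def_field, mobility, mul_div_assoc', div_eq_iff hg.ne']
    linear_combination (-ρ * v ρ * (particleField V W N x t (x (i + 1) t)
      - particleField V W N x t (x i t))) * hNg
  have h3 := mul_nonneg (by positivity : 0 ≤ (N : ℝ) * ρ ^ 2) (add_nonneg h1 h2)
  rw [hm, densityRate, Nat.add_sub_cancel, ← hρe]
  linarith

theorem Assumptions.exists_lipschitz_v (hyp : Assumptions v V W) (R : ℝ) :
    ∃ K, 0 ≤ K ∧ ∀ a ∈ Icc 0 R, ∀ b ∈ Icc 0 R, |v a - v b| ≤ K * |a - b| := by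
  obtain ⟨K, hK⟩ := hyp.v_lipschitz R
  exact ⟨K, K.2, fun a ha b hb => by simpa [Real.dist_eq] using hK.dist_le_mul a ha b hb⟩

theorem Assumptions.mobility_nonneg (hyp : Assumptions v V W) {r : ℝ} (hr : 0 ≤ r) :
    0 ≤ mobility v r :=
  mul_nonneg hr (hyp.v_nonneg r hr)

theorem Assumptions.mobility_le (hyp : Assumptions v V W) {r R : ℝ} (hr : 0 ≤ r) (hrR : r ≤ R) :
    mobility v r ≤ R * v 0 :=
  mul_le_mul hrR (hyp.v_le hr) (hyp.v_nonneg r hr) (hr.trans hrR)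

theorem Assumptions.exists_lipschitz_mobility (hyp : Assumptions v V W) (R : ℝ) :
    ∃ K, 0 ≤ K ∧ ∀ a ∈ Icc 0 R, ∀ b ∈ Icc 0 R,
      |mobility v a - mobility v b| ≤ K * |a - b| := by
  rcases lt_or_ge R 0 with hR | hR
  · exact ⟨0, le_rfl, fun a ha => absurd (ha.1.trans ha.2) hR.not_ge⟩
  obtain ⟨K, hK, h⟩ := hyp.exists_lipschitz_v R
  have hv0 := hyp.v_nonneg 0 le_rfl
  refine ⟨R * K + v 0, by positivity, fun a ha b hb => ?_⟩
  calc |mobility v a - mobility v b| = |a * (v a - v b) + (a - b) * v b| := by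
        simp only [mobility]; ring_nf
    _ ≤ |a| * |v a - v b| + |a - b| * |v b| := by
        rw [← abs_mul, ← abs_mul]; exact abs_add_le _ _
    _ ≤ R * (K * |a - b|) + |a - b| * v 0 := by
        rw [abs_of_nonneg ha.1, abs_of_nonneg (hyp.v_nonneg b hb.1)]
        gcongr
        exacts [ha.2, h a ha b hb, hyp.v_le hb.1]
    _ = _ := by ring

theorem hasDerivAt_totalVar_eq (hx : ∀ i < N, x i t < x (i + 1) t)
    (hd : ∀ i ≤ N, HasDerivAt (x i) (particleVelocity v V W N x i t) t)
    (habs : ∀ i ≤ N,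
      DifferentiableAt ℝ (fun s => |cellDensity N x (i + 1) s - cellDensity N x i s|) t)
    {d : ℝ} (h : HasDerivAt (totalVar N x) d t) :
    d = ∑ i ∈ Finset.range N, densityRate v V W N x (i + 1) t *
      (Real.sign (cellDensity N x (i + 1) t - cellDensity N x i t)
        - Real.sign (cellDensity N x (i + 2) t - cellDensity N x (i + 1) t)) := by
  have hder : ∀ i ∈ Finset.range (N + 1),
      HasDerivAt (fun s => |cellDensity N x (i + 1) s - cellDensity N x i s|)
      (Real.sign (cellDensity N x (i + 1) t - cellDensity N x i t)
        * (densityRate v V W N x (i + 1) t - densityRate v V W N x i t)) t := by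
    intro i hi
    have hi : i ≤ N := Nat.lt_succ_iff.1 (Finset.mem_range.1 hi)
    have h1 := (hasDerivAt_cellDensity hx hd (i := i + 1) (by omega)).sub
      (hasDerivAt_cellDensity hx hd (i := i) (by omega))
    have h2 := (habs i hi).hasDerivAt
    rwa [hasDerivAt_abs_eq h1 h2] at h2
  rw [h.unique (HasDerivAt.fun_sum hder)]
  exact sum_mul_sub_eq_of_zero
    (fun i => Real.sign (cellDensity N x (i + 1) t - cellDensity N x i t))
    (fun i => densityRate v V W N x i t) densityRate_zero densityRate_last

theorem SolvesODE.exists_uniform_totalVar (hyp : Assumptions v V W) {R S : ℝ} (hR : 0 ≤ R)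
    (hS : 0 ≤ S) (T B₀ : ℝ) :
    ∃ B, ∀ (N : ℕ) (x : ℕ → ℝ → ℝ), 1 ≤ N → SolvesODE v V W N x →
      (∀ t ∈ Icc 0 T, -S ≤ x 0 t ∧ x N t ≤ S) →
      (∀ t ∈ Icc 0 T, ∀ i < N, cellDensity N x (i + 1) t ≤ R) → totalVar N x 0 ≤ B₀ →
      ∀ t ∈ Icc 0 T, totalVar N x t ≤ B := by
  rcases lt_or_ge T 0 with hT | hT
  · refine ⟨0, fun N x _ _ _ _ _ t ht => absurd (ht.1.trans ht.2) hT.not_ge⟩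
  obtain ⟨A, hA⟩ := hyp.exists_sliceBounds T S
  have hA0 : 0 ≤ A := (hA 0 ⟨le_rfl, hT⟩).nonneg
  obtain ⟨K, hK, hm⟩ := hyp.exists_lipschitz_mobility R
  have hv0 := hyp.v_nonneg 0 le_rfl
  set L := 2 * A + 2 * A * R with hL
  have hL0 : 0 ≤ L := by positivity
  set M := R * v 0 with hM
  have hM0 : 0 ≤ M := by positivity
  set C₁ := 2 * (M * L) + M * A with hC₁
  set C₂ := M * (4 * S * A + 2 * A) + L * K with hC₂
  have hC₁0 : 0 ≤ C₁ := by positivity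
  have hC₂0 : 0 ≤ C₂ := by positivity
  obtain ⟨B, hB⟩ := exists_bound_of_linear_max B₀ (C₁ + C₂) T
  refine ⟨B, fun N x hN1 hs hsupp hden h0 t ht => ?_⟩
  have hlip : ∀ i ≤ N, LipOn T fun s => |cellDensity N x (i + 1) s - cellDensity N x i s| :=
    fun i hi => ((hs.lipOn_cellDensity hyp hN1 (by omega)).sub
      (hs.lipOn_cellDensity hyp hN1 (by omega))).abs
  refine hB {0} (fun _ => totalVar N x) (fun _ _ => LipOn.sum _ fun i hi =>
    hlip i (Nat.lt_succ_iff.1 (Finset.mem_range.1 hi))) (fun _ _ => h0) (fun _ _ => ?_) 0 (by simp)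
    t ht
  have hdiff : ∀ᵐ s, ∀ i ∈ Finset.range (N + 1), s ∈ Ioo 0 T →
      DifferentiableAt ℝ (fun s => |cellDensity N x (i + 1) s - cellDensity N x i s|) s :=
    (Finset.eventually_all _).2 fun i hi =>
      (hlip i (Nat.lt_succ_iff.1 (Finset.mem_range.1 hi))).ae_differentiableAt hT
  filter_upwards [hs.ae_hasDerivAt T, hdiff] with s hd habs hsT _ d hdd
  have hsT' := Ioo_subset_Icc_self hsT
  have hx := hs.ordered s hsT.1.le
  obtain ⟨n, rfl⟩ := Nat.exists_eq_add_of_le' hN1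
  obtain ⟨l0, lN⟩ := hsupp s hsT'
  have hρ := cellDensity_nonneg hx
  set q : ℕ → ℝ := fun i => mobility v (cellDensity (n + 1) x (i + 1) s)
    * slope (particleField V W (n + 1) x s) (x i s) (x (i + 1) s) with hq
  have hslope : ∀ i < n + 1,
      |slope (particleField V W (n + 1) x s) (x i s) (x (i + 1) s)| ≤ L := by
    intro i hi
    have hg : 0 < x (i + 1) s - x i s := by linarith [hx i hi]
    rw [slope_def_field, abs_div, abs_of_pos hg, div_le_iff₀ hg]
    have := abs_particleField_sub_le hyp hsT.1.le hN1 hx (hA s hsT') l0 lN hR (hden s hsT')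
      (node_mem_Icc hx l0 lN (Nat.succ_le_of_lt hi)) (node_mem_Icc hx l0 lN hi.le)
    rwa [abs_of_pos hg] at this
  have hmob : ∀ i < n + 1, |mobility v (cellDensity (n + 1) x (i + 1) s)| ≤ M := by
    intro i hi
    rw [abs_of_nonneg (hyp.mobility_nonneg (hρ _))]
    exact hyp.mobility_le (hρ _) (hden s hsT' i hi)
  have hqb : ∀ i < n + 1, |q i| ≤ M * L := fun i hi => by
    rw [hq, abs_mul]
    exact mul_le_mul (hmob i hi) (hslope i hi) (abs_nonneg _) hM0
  have hqd : ∀ i ∈ Finset.range n, |q (i + 1) - q i| ≤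
      M * |slope (particleField V W (n + 1) x s) (x (i + 1) s) (x (i + 2) s)
        - slope (particleField V W (n + 1) x s) (x i s) (x (i + 1) s)|
      + L * K * |cellDensity (n + 1) x (i + 2) s - cellDensity (n + 1) x (i + 1) s| := by
    intro i hi
    have hi := Finset.mem_range.1 hi
    have e : q (i + 1) - q i = mobility v (cellDensity (n + 1) x (i + 2) s)
        * (slope (particleField V W (n + 1) x s) (x (i + 1) s) (x (i + 2) s)
          - slope (particleField V W (n + 1) x s) (x i s) (x (i + 1) s))
        + slope (particleField V W (n + 1) x s) (x i s) (x (i + 1) s)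
          * (mobility v (cellDensity (n + 1) x (i + 2) s)
            - mobility v (cellDensity (n + 1) x (i + 1) s)) := by
      simp only [hq]; ring
    rw [e]
    refine (abs_add_le _ _).trans ?_
    rw [abs_mul, abs_mul, mul_assoc L]
    gcongr
    · exact hmob (i + 1) (by omega)
    · exact hslope i (by omega)
    · exact hm _ ⟨hρ _, hden s hsT' (i + 1) (by omega)⟩ _ ⟨hρ _, hden s hsT' i (by omega)⟩
  have hsum := sum_abs_slope_particleField_sub_le hyp hsT.1.le (hA s hsT') hx l0 lN
  have hTV : ∑ i ∈ Finset.range n,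
      |cellDensity (n + 1) x (i + 2) s - cellDensity (n + 1) x (i + 1) s| ≤
      totalVar (n + 1) x s := by
    rw [totalVar, Finset.sum_range_succ' _ (n + 1), Finset.sum_range_succ _ n, add_assoc]
    exact le_add_of_nonneg_right (add_nonneg (abs_nonneg _) (abs_nonneg _))
  have hdmax : d ≤ C₁ + C₂ * totalVar (n + 1) x s := by
    rw [hasDerivAt_totalVar_eq hx (hd hsT)
      (fun i hi => habs i (Finset.mem_range.2 (Nat.lt_succ_of_le hi)) hsT) hdd]
    have k1 := Finset.sum_le_sum fun i (hi : i ∈ Finset.range (n + 1)) =>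
      densityRate_mul_le (v := v) (V := V) (W := W) (N := n + 1) (x := x) (t := s) hyp hx
        (Finset.mem_range.1 hi)
    rw [Finset.sum_neg_distrib] at k1
    have k2 := neg_sum_sign_sub_mul_le
      (fun i => Real.sign (cellDensity (n + 1) x (i + 1) s - cellDensity (n + 1) x i s)) q
      (fun i => abs_sign_le_one _) n
    have k3 := Finset.sum_le_sum hqd
    rw [Finset.sum_add_distrib, ← Finset.mul_sum, ← Finset.mul_sum] at k3
    have k4 := hqb 0 (by omega)
    have k5 := hqb n (by omega)
    have k6 := mul_le_mul_of_nonneg_left hsum hM0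
    have k7 := mul_le_mul_of_nonneg_left hTV (mul_nonneg hL0 hK)
    refine k1.trans (k2.trans ?_)
    simp only [hC₁, hC₂]
    linarith
  refine hdmax.trans ?_
  rw [add_mul C₁]
  exact add_le_add (le_mul_of_one_le_right hC₁0 (le_max_right _ _))
    (mul_le_mul_of_nonneg_left (le_max_left _ _) hC₂0)

/-! ### The mass of the error measure -/

theorem errorDensity_le (hyp : Assumptions v V W) (hx : ∀ i < N, x i t < x (i + 1) t) {L : ℝ}
    (hL0 : 0 ≤ L)
    (hL : ∀ z ∈ Icc (x 0 t) (x N t), ∀ y ∈ Icc (x 0 t) (x N t),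
      |particleField V W N x t z - particleField V W N x t y| ≤ L * |z - y|) (y : ℝ) :
    errorDensity v V W N x t y ≤ ∑ i ∈ Finset.range N, (Icc (x i t) (x (i + 1) t)).indicator
      (fun _ => cellDensity N x (i + 1) t * (v 0 * L * (x (i + 1) t - x i t)
        + (|particleVelocity v V W N x (i + 1) t - particleVelocity v V W N x i t|
          + |particleVelocity v V W N x i t
            - v (cellDensity N x (i + 1) t) * particleField V W N x t (x i t)|))) y := by
  have hρ := cellDensity_nonneg hx
  have hv0 := hyp.v_nonneg 0 le_rfl
  rw [errorDensity, sum_Icc_one_eq, sum_Icc_one_eq, ← Finset.sum_add_distrib]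
  refine Finset.sum_le_sum fun i hi => ?_
  have hi := Finset.mem_range.1 hi
  simp only [Nat.add_sub_cancel]
  by_cases hy : y ∈ Icc (x i t) (x (i + 1) t)
  · simp only [indicator_of_mem hy]
    rw [mul_add (cellDensity N x (i + 1) t) (v 0 * L * _)]
    refine add_le_add ?_ le_rfl
    have h0 := node_le hx (Nat.zero_le i) hi.le
    have h1 := node_le hx (Nat.succ_le_of_lt hi) le_rfl
    have h2 := hL y ⟨h0.trans hy.1, hy.2.trans h1⟩ (x i t) ⟨h0, (hx i hi).le.trans h1⟩
    rw [abs_of_nonneg (sub_nonneg.2 hy.1)] at h2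
    have h3 : L * (y - x i t) ≤ L * (x (i + 1) t - x i t) := by gcongr; exact hy.2
    rw [mobility, mul_assoc, mul_assoc]
    gcongr
    · exact hρ _
    · exact hyp.v_le (hρ _)
    · exact h2.trans h3
  · simp [indicator_of_notMem hy]

theorem lintegral_sum_indicator_le (hx : ∀ i < N, x i t < x (i + 1) t) {e : ℕ → ℝ}
    (he : ∀ i < N, 0 ≤ e i) {E : ℝ} (hE : ∑ i ∈ Finset.range N, e i ≤ E) :
    ∫⁻ y, ENNReal.ofReal (∑ i ∈ Finset.range N, (Icc (x i t) (x (i + 1) t)).indicator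
      (fun _ => cellDensity N x (i + 1) t * e i) y) ≤ ENNReal.ofReal (E / N) := by
  have hpos : ∀ i ∈ Finset.range N, 0 ≤ cellDensity N x (i + 1) t * e i := fun i hi =>
    mul_nonneg (cellDensity_nonneg hx _) (he i (Finset.mem_range.1 hi))
  have e1 : ∀ y, ENNReal.ofReal (∑ i ∈ Finset.range N, (Icc (x i t) (x (i + 1) t)).indicator
      (fun _ => cellDensity N x (i + 1) t * e i) y) =
      ∑ i ∈ Finset.range N, (Icc (x i t) (x (i + 1) t)).indicator
        (fun _ => ENNReal.ofReal (cellDensity N x (i + 1) t * e i)) y := by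
    intro y
    rw [ENNReal.ofReal_sum_of_nonneg fun i hi => indicator_nonneg (fun _ _ => hpos i hi) _]
    refine Finset.sum_congr rfl fun i _ => ?_
    by_cases h : y ∈ Icc (x i t) (x (i + 1) t) <;> simp [h]
  simp only [e1]
  rw [lintegral_finsetSum _ fun i _ => measurable_const.indicator measurableSet_Icc]
  have e2 : ∀ i ∈ Finset.range N, ∫⁻ y, (Icc (x i t) (x (i + 1) t)).indicator
      (fun _ => ENNReal.ofReal (cellDensity N x (i + 1) t * e i)) y = ENNReal.ofReal (e i / N) := by
    intro i hi
    have hi' := Finset.mem_range.1 hi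
    rw [lintegral_indicator measurableSet_Icc, setLIntegral_const, Real.volume_Icc,
      ← ENNReal.ofReal_mul (hpos i hi), mul_right_comm, cellDensity_mul_gap hx hi', one_div_mul_eq_div]
  rw [Finset.sum_congr rfl e2, ← ENNReal.ofReal_sum_of_nonneg fun i hi =>
    div_nonneg (he i (Finset.mem_range.1 hi)) (Nat.cast_nonneg N), ← Finset.sum_div]
  exact ENNReal.ofReal_le_ofReal (by gcongr)

theorem errorMeasure_univ_le (hyp : Assumptions v V W) (ht : 0 ≤ t) (hN1 : 1 ≤ N)
    (hx : ∀ i < N, x i t < x (i + 1) t) {S A R B K : ℝ} (hR : 0 ≤ R)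
    (hb : SliceBounds (V t) (W t) S A) (h0 : -S ≤ x 0 t) (hN : x N t ≤ S)
    (hρR : ∀ i < N, cellDensity N x (i + 1) t ≤ R) (hB : totalVar N x t ≤ B) (hK : 0 ≤ K)
    (hv : ∀ a ∈ Icc 0 R, ∀ b ∈ Icc 0 R, |v a - v b| ≤ K * |a - b|) :
    errorMeasure v V W N x t univ ≤ ENNReal.ofReal
      ((2 * (v 0 * (2 * A + 2 * A * R)) * (2 * S) + 3 * (K * (2 * A)) * B) / N) := by
  have hA := hb.nonneg
  have hv0 := hyp.v_nonneg 0 le_rfl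
  set L := 2 * A + 2 * A * R with hL
  have hL0 : 0 ≤ L := by positivity
  have hρ : ∀ j, cellDensity N x j t ∈ Icc 0 R := by
    intro j
    refine ⟨cellDensity_nonneg hx j, ?_⟩
    by_cases h : 1 ≤ j ∧ j ≤ N
    · obtain ⟨k, rfl⟩ := Nat.exists_eq_add_of_le' h.1
      exact hρR k h.2
    · simp [cellDensity, h, hR]
  have hU : ∀ i ≤ N, |particleField V W N x t (x i t)| ≤ 2 * A := fun i hi =>
    abs_particleField_le hN1 hx hb h0 hN (node_mem_Icc hx h0 hN hi)
  have hLip : ∀ z ∈ Icc (-S) S, ∀ y ∈ Icc (-S) S,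
      |particleField V W N x t z - particleField V W N x t y| ≤ L * |z - y| := fun z hz y hy =>
    abs_particleField_sub_le hyp ht hN1 hx hb h0 hN hR hρR hz hy
  set D : ℕ → ℝ := fun i => K * (2 * A) * |cellDensity N x (i + 1) t - cellDensity N x i t| with hD
  have hD0 : ∀ i, 0 ≤ D i := fun i => by positivity
  have hleft : ∀ i < N, |particleVelocity v V W N x i t
      - v (cellDensity N x (i + 1) t) * particleField V W N x t (x i t)| ≤ D i := by
    intro i hi
    have := abs_particleVelocity_sub_le (V := V) (W := W) (N := N) (x := x) (t := t) (i := i)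
      (w := v (cellDensity N x (i + 1) t))
      (D := K * |cellDensity N x (i + 1) t - cellDensity N x i t|) (by positivity)
      (by rw [sub_self, abs_zero]; positivity) (by
        rw [abs_sub_comm]; exact hv _ (hρ _) _ (hρ _)) (hU i hi.le)
    refine this.trans (le_of_eq ?_)
    simp only [hD]; ring
  have hright : ∀ i < N, |particleVelocity v V W N x (i + 1) t
      - v (cellDensity N x (i + 1) t) * particleField V W N x t (x (i + 1) t)| ≤ D (i + 1) := by
    intro i hi
    have := abs_particleVelocity_sub_le (V := V) (W := W) (N := N) (x := x) (t := t) (i := i + 1)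
      (w := v (cellDensity N x (i + 1) t))
      (D := K * |cellDensity N x (i + 1 + 1) t - cellDensity N x (i + 1) t|) (by positivity)
      (hv _ (hρ _) _ (hρ _)) (by rw [sub_self, abs_zero]; positivity) (hU (i + 1) hi)
    refine this.trans (le_of_eq ?_)
    simp only [hD]; ring
  have hdiff : ∀ i < N, |particleVelocity v V W N x (i + 1) t - particleVelocity v V W N x i t| ≤
      D (i + 1) + v 0 * L * (x (i + 1) t - x i t) + D i := by
    intro i hi
    have h1 := abs_le.1 (hleft i hi)
    have h2 := abs_le.1 (hright i hi)
    have h3 := hLip _ (node_mem_Icc hx h0 hN (Nat.succ_le_of_lt hi)) _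
      (node_mem_Icc hx h0 hN hi.le)
    rw [abs_of_nonneg (by linarith [hx i hi] : 0 ≤ x (i + 1) t - x i t)] at h3
    have h4 : |v (cellDensity N x (i + 1) t) * (particleField V W N x t (x (i + 1) t)
        - particleField V W N x t (x i t))| ≤ v 0 * L * (x (i + 1) t - x i t) := by
      rw [abs_mul, abs_of_nonneg (hyp.v_nonneg _ (hρ _).1), mul_assoc]
      exact mul_le_mul (hyp.v_le (hρ _).1) h3 (abs_nonneg _) hv0
    have h5 := abs_le.1 h4
    rw [mul_sub] at h5
    exact abs_le.2 ⟨by linarith, by linarith⟩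
  rw [errorMeasure, withDensity_apply _ MeasurableSet.univ, Measure.restrict_univ]
  refine (lintegral_mono fun y => ENNReal.ofReal_le_ofReal (errorDensity_le hyp hx hL0
    (fun z hz y hy => hLip z (Icc_subset_Icc h0 hN hz) y (Icc_subset_Icc h0 hN hy)) y)).trans ?_
  refine lintegral_sum_indicator_le hx (e := fun i => v 0 * L * (x (i + 1) t - x i t)
        + (|particleVelocity v V W N x (i + 1) t - particleVelocity v V W N x i t|
          + |particleVelocity v V W N x i t
            - v (cellDensity N x (i + 1) t) * particleField V W N x t (x i t)|)) (fun i hi => ?_) ?_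
  · have : 0 ≤ x (i + 1) t - x i t := by linarith [hx i hi]
    positivity
  have hterm : ∀ i ∈ Finset.range N, v 0 * L * (x (i + 1) t - x i t)
        + (|particleVelocity v V W N x (i + 1) t - particleVelocity v V W N x i t|
          + |particleVelocity v V W N x i t
            - v (cellDensity N x (i + 1) t) * particleField V W N x t (x i t)|) ≤
      2 * (v 0 * L) * (x (i + 1) t - x i t) + (D (i + 1) + 2 * D i) := by
    intro i hi
    have hi := Finset.mem_range.1 hi
    linarith [hdiff i hi, hleft i hi]
  refine (Finset.sum_le_sum hterm).trans ?_
  rw [Finset.sum_add_distrib, Finset.sum_add_distrib, ← Finset.mul_sum,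
    ← Finset.mul_sum (Finset.range N) D, Finset.sum_range_sub (fun i => x i t)]
  have hDsum : ∑ i ∈ Finset.range (N + 1), D i = K * (2 * A) * totalVar N x t := by
    rw [totalVar, Finset.mul_sum]
  have s1 : ∑ i ∈ Finset.range N, D i ≤ ∑ i ∈ Finset.range (N + 1), D i := by
    rw [Finset.sum_range_succ]; linarith [hD0 N]
  have s2 : ∑ i ∈ Finset.range N, D (i + 1) ≤ ∑ i ∈ Finset.range (N + 1), D i := by
    rw [Finset.sum_range_succ']; linarith [hD0 0]
  have s3 : K * (2 * A) * totalVar N x t ≤ K * (2 * A) * B := by gcongr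
  have s4 : 2 * (v 0 * L) * (x N t - x 0 t) ≤ 2 * (v 0 * L) * (2 * S) := by gcongr; linarith
  linarith

/-- On each time interval the mass of the error measure is at most `C / N`. -/
theorem exists_errorMeasure_bound (hyp : Assumptions v V W) (R₀ S₀ B₀ T : ℝ) :
    ∃ C, ∀ t ∈ Icc 0 T, ∀ (N : ℕ) (x : ℕ → ℝ → ℝ), 1 ≤ N → SolvesODE v V W N x →
      InitialBounds R₀ S₀ B₀ N x → errorMeasure v V W N x t univ ≤ ENNReal.ofReal (C / N) := by
  obtain ⟨S, hS, hsupp⟩ := SolvesODE.exists_uniform_support hyp T S₀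
  obtain ⟨R, hR, hden⟩ := SolvesODE.exists_uniform_density hyp T R₀ S
  obtain ⟨B, hB⟩ := SolvesODE.exists_uniform_totalVar hyp hR hS T B₀
  obtain ⟨A, hA⟩ := hyp.exists_sliceBounds T S
  obtain ⟨K, hK, hv⟩ := hyp.exists_lipschitz_v R
  refine ⟨2 * (v 0 * (2 * A + 2 * A * R)) * (2 * S) + 3 * (K * (2 * A)) * B,
    fun t ht N x hN1 hs h0 => ?_⟩
  have h1 := hsupp N x hN1 hs h0.support_left h0.support_right
  have h2 := hden N x hN1 hs h1 fun i hi => h0.density_le _ (Finset.mem_Icc.2 (by omega))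
  exact errorMeasure_univ_le hyp ht.1 hN1 (hs.ordered t ht.1) hR (hA t ht) (h1 t ht).1 (h1 t ht).2
    (h2 t ht) (hB N x hN1 hs h1 h2 h0.variation_le t ht) hK hv

end Traffic

namespace Traffic

variable {v : ℝ → ℝ} {V W : ℝ → ℝ → ℝ} {N : ℕ} {x : ℕ → ℝ → ℝ} {t T : ℝ}

/-! ### Joint measurability -/

theorem volume_restrict_Ici_prod :
    (volume : Measure (ℝ × ℝ)).restrict (Ici (0 : ℝ) ×ˢ (univ : Set ℝ)) =
      (volume.restrict (Ici (0 : ℝ))).prod volume := by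
  rw [← Measure.restrict_univ (μ := (volume : Measure ℝ)), Measure.prod_restrict,
    Measure.restrict_univ, Measure.volume_eq_prod]

/-- Carathéodory functions composed with measurable functions are measurable. -/
theorem aestronglyMeasurable_caratheodory {μ : Measure ℝ} {ν : Measure ℝ} {F : ℝ → ℝ → ℝ}
    (hF : ∀ q, AEStronglyMeasurable (fun t => F t q) μ) (hc : ∀ᵐ t ∂μ, Continuous (F t))
    {y : ℝ × ℝ → ℝ} (hy : AEMeasurable y (μ.prod ν)) :
    AEStronglyMeasurable (fun p : ℝ × ℝ => F p.1 (y p)) (μ.prod ν) := by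
  set G : ℚ → ℝ → ℝ := fun q => (hF q).mk (fun t => F t q) with hG
  have hGm : ∀ q, Measurable (G q) := fun q => (hF q).stronglyMeasurable_mk.measurable
  have hGe : ∀ᵐ t ∂μ, ∀ q : ℚ, F t q = G q t := ae_all_iff.2 fun q => (hF q).ae_eq_mk
  set Y := hy.mk y with hY
  have hGG : Measurable fun p : ℚ × ℝ => G p.1 p.2 := measurable_from_prod_countable_right hGm
  set r : ℕ → ℝ → ℚ := fun n z => (⌊z * ((n : ℝ) + 1)⌋ : ℚ) / ((n : ℚ) + 1) with hr
  have hrm : ∀ n, Measurable (r n) := fun n =>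
    (measurable_from_top (f := fun k : ℤ => (k : ℚ) / ((n : ℚ) + 1))).comp
      (Int.measurable_floor.comp (measurable_id.mul_const _))
  have hrl : ∀ z, Tendsto (fun n => ((r n z : ℚ) : ℝ)) atTop (𝓝 z) := by
    intro z
    refine tendsto_of_tendsto_of_tendsto_of_le_of_le (g := fun n : ℕ => z - 1 / ((n : ℝ) + 1))
      (h := fun _ => z) ?_ tendsto_const_nhds (fun n => ?_) (fun n => ?_)
    · simpa using tendsto_const_nhds.sub (tendsto_one_div_add_atTop_nhds_zero_nat (𝕜 := ℝ))
    · have hn : (0 : ℝ) < (n : ℝ) + 1 := by positivity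
      have := Int.sub_one_lt_floor (z * ((n : ℝ) + 1))
      simp only [hr]
      push_cast
      rw [le_div_iff₀ hn, sub_mul, one_div_mul_cancel hn.ne']
      exact this.le
    · have hn : (0 : ℝ) < (n : ℝ) + 1 := by positivity
      have := Int.floor_le (z * ((n : ℝ) + 1))
      simp only [hr]
      push_cast
      rwa [div_le_iff₀ hn]
  refine aestronglyMeasurable_of_tendsto_ae atTop (f := fun n p => G (r n (Y p)) p.1)
    (fun n => ?_) ?_
  · exact (hGG.comp (((hrm n).comp hy.measurable_mk).prodMk measurable_fst)).aestronglyMeasurable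
  · filter_upwards [Measure.quasiMeasurePreserving_fst.ae hGe,
      Measure.quasiMeasurePreserving_fst.ae hc, hy.ae_eq_mk] with p h1 h2 h3
    rw [h3]
    simp only [← h1]
    exact (h2.tendsto _).comp (hrl _)

theorem Assumptions.continuous_V (hyp : Assumptions v V W) (ht : 0 ≤ t) : Continuous (V t) := by
  obtain ⟨V', hV', -⟩ := hyp.V_derivative
  have h : V t = fun z => V t 0 + ∫ y in (0 : ℝ)..z, V' t y := funext fun z => by
    rw [← (hV' t ht 0 z).2]; ring
  rw [h]
  exact continuous_const.add
    (intervalIntegral.continuous_primitive (fun a b => (hV' t ht a b).1) 0)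

theorem continuous_particleField (hyp : Assumptions v V W) (ht : 0 ≤ t)
    (hx : ∀ i < N, x i t < x (i + 1) t) : Continuous (particleField V W N x t) := by
  rw [funext (particleField_eq hyp ht hx)]
  refine (hyp.continuous_V ht).sub (continuous_finsetSum _ fun i _ => continuous_const.mul ?_)
  exact (hyp.W_continuous t ht).comp (by fun_prop)

theorem continuousOn_Ici_of_Icc {f : ℝ → ℝ} (h : ∀ T, ContinuousOn f (Icc 0 T)) :
    ContinuousOn f (Ici 0) := by
  intro t ht
  have hmem : Icc 0 (t + 1) ∈ 𝓝[Ici 0] t := by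
    rw [← Ici_inter_Iic]
    exact inter_mem_nhdsWithin _ (Iic_mem_nhds (by linarith))
  exact (h (t + 1) t ⟨ht, by linarith⟩).mono_of_mem_nhdsWithin hmem

theorem SolvesODE.continuousOn_Ici (hs : SolvesODE v V W N x) {i : ℕ} (hi : i ≤ N) :
    ContinuousOn (x i) (Ici 0) :=
  continuousOn_Ici_of_Icc fun _ => hs.continuousOn hi

theorem SolvesODE.continuousOn_cellDensity (hyp : Assumptions v V W) (hs : SolvesODE v V W N x)
    (hN1 : 1 ≤ N) {i : ℕ} (hi : i ≤ N + 1) : ContinuousOn (cellDensity N x i) (Ici 0) :=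
  continuousOn_Ici_of_Icc fun _ => (hs.lipOn_cellDensity hyp hN1 hi).continuousOn

theorem SolvesODE.aemeasurable_node (hs : SolvesODE v V W N x) {i : ℕ} (hi : i ≤ N) :
    AEMeasurable (x i) (volume.restrict (Ici (0 : ℝ))) :=
  ((hs.continuousOn_Ici hi).aestronglyMeasurable measurableSet_Ici).aemeasurable

theorem SolvesODE.aemeasurable_cellDensity (hyp : Assumptions v V W) (hs : SolvesODE v V W N x)
    (hN1 : 1 ≤ N) {i : ℕ} (hi : i ≤ N + 1) :
    AEMeasurable (cellDensity N x i) (volume.restrict (Ici (0 : ℝ))) :=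
  ((hs.continuousOn_cellDensity hyp hN1 hi).aestronglyMeasurable measurableSet_Ici).aemeasurable

theorem ae_prod_Ici_nonneg :
    ∀ᵐ p ∂((volume.restrict (Ici (0 : ℝ))).prod (volume : Measure ℝ)), 0 ≤ p.1 :=
  Measure.quasiMeasurePreserving_fst.ae (ae_restrict_mem measurableSet_Ici)

/-- `Ū` composed with a measurable function is measurable. -/
theorem SolvesODE.aemeasurable_particleField (hyp : Assumptions v V W) (hs : SolvesODE v V W N x)
    (hN1 : 1 ≤ N) {y : ℝ × ℝ → ℝ}
    (hy : AEMeasurable y ((volume.restrict (Ici (0 : ℝ))).prod volume)) :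
    AEMeasurable (fun p : ℝ × ℝ => particleField V W N x p.1 (y p))
      ((volume.restrict (Ici (0 : ℝ))).prod volume) := by
  have h0 : ∀ᵐ t ∂(volume.restrict (Ici (0 : ℝ))), 0 ≤ t := ae_restrict_mem measurableSet_Ici
  have hV := (aestronglyMeasurable_caratheodory hyp.V_measurable
    (h0.mono fun t ht => hyp.continuous_V ht) hy).aemeasurable
  have hW : ∀ i ∈ Finset.range (N + 1), AEMeasurable (fun p : ℝ × ℝ =>
      (cellDensity N x (i + 1) p.1 - cellDensity N x i p.1) * W p.1 (y p - x i p.1))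
      ((volume.restrict (Ici (0 : ℝ))).prod volume) := by
    intro i hi
    have hi := Finset.mem_range.1 hi
    have hxi : AEMeasurable (fun p : ℝ × ℝ => x i p.1)
        ((volume.restrict (Ici (0 : ℝ))).prod volume) :=
      (hs.aemeasurable_node (by omega)).comp_fst
    have h1 := (hs.aemeasurable_cellDensity hyp hN1 (i := i + 1) (by omega)).sub
      (hs.aemeasurable_cellDensity hyp hN1 (i := i) (by omega))
    exact h1.comp_fst.mul (aestronglyMeasurable_caratheodory hyp.W_measurable
      (h0.mono fun t ht => hyp.W_continuous t ht) (hy.sub hxi)).aemeasurable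
  refine (hV.sub (Finset.aemeasurable_sum _ hW)).congr ?_
  filter_upwards [ae_prod_Ici_nonneg] with p hp
  rw [particleField_eq hyp hp (hs.ordered _ hp)]
  simp

theorem particleVelocity_eq_sub (i : ℕ) : particleVelocity v V W N x i t =
    v (cellDensity N x (i + 1) t) * max (particleField V W N x t (x i t)) 0
      - v (cellDensity N x i t) * max (-particleField V W N x t (x i t)) 0 := by
  rcases lt_or_ge (particleField V W N x t (x i t)) 0 with h | h
  · rw [particleVelocity_of_neg h, max_eq_right h.le, max_eq_left (by linarith)]
    ring
  · rw [particleVelocity_of_nonneg h, max_eq_left h, max_eq_right (by linarith)]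
    ring

theorem Assumptions.aemeasurable_v_comp (hyp : Assumptions v V W) {α : Type*}
    [MeasurableSpace α] {μ : Measure α} {f : α → ℝ} (hf : AEMeasurable f μ)
    (h0 : ∀ᵐ a ∂μ, 0 ≤ f a) : AEMeasurable (fun a => v (f a)) μ := by
  have hc : Continuous fun r => v (max r 0) :=
    hyp.continuousOn_v.comp_continuous (by fun_prop) fun r => mem_Ici.2 (le_max_right _ _)
  refine (hc.measurable.comp_aemeasurable hf).congr ?_
  filter_upwards [h0] with a ha
  simp [max_eq_left ha]

theorem SolvesODE.aemeasurable_v_cellDensity (hyp : Assumptions v V W)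
    (hs : SolvesODE v V W N x) (hN1 : 1 ≤ N) {i : ℕ} (hi : i ≤ N + 1) :
    AEMeasurable (fun p : ℝ × ℝ => v (cellDensity N x i p.1))
      ((volume.restrict (Ici (0 : ℝ))).prod volume) := by
  refine hyp.aemeasurable_v_comp (hs.aemeasurable_cellDensity hyp hN1 hi).comp_fst ?_
  filter_upwards [ae_prod_Ici_nonneg] with p hp
  exact cellDensity_nonneg (hs.ordered _ hp) _

theorem SolvesODE.aemeasurable_particleVelocity (hyp : Assumptions v V W)
    (hs : SolvesODE v V W N x) (hN1 : 1 ≤ N) {i : ℕ} (hi : i ≤ N) :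
    AEMeasurable (fun p : ℝ × ℝ => particleVelocity v V W N x i p.1)
      ((volume.restrict (Ici (0 : ℝ))).prod volume) := by
  have hU := hs.aemeasurable_particleField hyp hN1 (hs.aemeasurable_node hi).comp_fst
  simp only [particleVelocity_eq_sub]
  exact ((hs.aemeasurable_v_cellDensity hyp hN1 (by omega)).mul (hU.max aemeasurable_const)).sub
    ((hs.aemeasurable_v_cellDensity hyp hN1 (by omega)).mul (hU.neg.max aemeasurable_const))

theorem SolvesODE.nullMeasurableSet_cell (hs : SolvesODE v V W N x) {i : ℕ} (hi : i < N) :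
    NullMeasurableSet {p : ℝ × ℝ | p.2 ∈ Ioo (x i p.1) (x (i + 1) p.1)}
      ((volume.restrict (Ici (0 : ℝ))).prod volume) ∧
    NullMeasurableSet {p : ℝ × ℝ | p.2 ∈ Icc (x i p.1) (x (i + 1) p.1)}
      ((volume.restrict (Ici (0 : ℝ))).prod volume) := by
  have h1 := (hs.aemeasurable_node hi.le).comp_fst (ν := (volume : Measure ℝ))
  have h2 := (hs.aemeasurable_node (Nat.succ_le_of_lt hi)).comp_fst (ν := (volume : Measure ℝ))
  have h3 : AEMeasurable (fun p : ℝ × ℝ => p.2)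
    ((volume.restrict (Ici (0 : ℝ))).prod volume) := measurable_snd.aemeasurable
  exact ⟨(nullMeasurableSet_lt h1 h3).inter (nullMeasurableSet_lt h3 h2),
    (nullMeasurableSet_le h1 h3).inter (nullMeasurableSet_le h3 h2)⟩

theorem SolvesODE.aemeasurable_particleDensity (hyp : Assumptions v V W)
    (hs : SolvesODE v V W N x) (hN1 : 1 ≤ N) :
    AEMeasurable (fun p : ℝ × ℝ => particleDensity N x p.1 p.2)
      ((volume.restrict (Ici (0 : ℝ))).prod volume) := by
  simp only [particleDensity_eq_sum]
  refine Finset.aemeasurable_fun_sum _ fun i hi => ?_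
  have hi := Finset.mem_range.1 hi
  exact ((hs.aemeasurable_cellDensity hyp hN1 (i := i + 1) (by omega)).comp_fst
    (ν := (volume : Measure ℝ))).indicator₀ (hs.nullMeasurableSet_cell hi).1

theorem errorDensity_eq_sum (y : ℝ) : errorDensity v V W N x t y =
    ∑ i ∈ Finset.range N, (Icc (x i t) (x (i + 1) t)).indicator
      (fun z => mobility v (cellDensity N x (i + 1) t)
          * |particleField V W N x t z - particleField V W N x t (x i t)|
        + cellDensity N x (i + 1) t
          * (|particleVelocity v V W N x (i + 1) t - particleVelocity v V W N x i t|
            + |particleVelocity v V W N x i t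
              - v (cellDensity N x (i + 1) t) * particleField V W N x t (x i t)|)) y := by
  rw [errorDensity, sum_Icc_one_eq, sum_Icc_one_eq, ← Finset.sum_add_distrib]
  refine Finset.sum_congr rfl fun i _ => ?_
  by_cases h : y ∈ Icc (x i t) (x (i + 1) t) <;> simp [h]

theorem SolvesODE.aemeasurable_errorDensity (hyp : Assumptions v V W)
    (hs : SolvesODE v V W N x) (hN1 : 1 ≤ N) :
    AEMeasurable (fun p : ℝ × ℝ => errorDensity v V W N x p.1 p.2)
      ((volume.restrict (Ici (0 : ℝ))).prod volume) := by
  simp only [errorDensity_eq_sum]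
  refine Finset.aemeasurable_fun_sum _ fun i hi => ?_
  have hi := Finset.mem_range.1 hi
  have hρ := (hs.aemeasurable_cellDensity hyp hN1 (i := i + 1) (by omega)).comp_fst
    (ν := (volume : Measure ℝ))
  have hv := hs.aemeasurable_v_cellDensity hyp hN1 (i := i + 1) (by omega)
  have hU := hs.aemeasurable_particleField hyp hN1 (measurable_snd.aemeasurable)
  have hUi := hs.aemeasurable_particleField hyp hN1 (hs.aemeasurable_node hi.le).comp_fst
  have hw := hs.aemeasurable_particleVelocity hyp hN1 hi.le
  have hw' := hs.aemeasurable_particleVelocity hyp hN1 (Nat.succ_le_of_lt hi)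
  have h : AEMeasurable (fun p : ℝ × ℝ => mobility v (cellDensity N x (i + 1) p.1)
          * |particleField V W N x p.1 p.2 - particleField V W N x p.1 (x i p.1)|
        + cellDensity N x (i + 1) p.1
          * (|particleVelocity v V W N x (i + 1) p.1 - particleVelocity v V W N x i p.1|
            + |particleVelocity v V W N x i p.1
              - v (cellDensity N x (i + 1) p.1) * particleField V W N x p.1 (x i p.1)|))
      ((volume.restrict (Ici (0 : ℝ))).prod volume) :=
    ((hρ.mul hv).mul (hU.sub hUi).abs).add
      (hρ.mul ((hw'.sub hw).abs.add (hw.sub (hv.mul hUi)).abs))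
  exact h.indicator₀ (hs.nullMeasurableSet_cell hi).2

theorem errorDensity_nonneg (hyp : Assumptions v V W) (hx : ∀ i < N, x i t < x (i + 1) t) (y : ℝ) :
    0 ≤ errorDensity v V W N x t y := by
  rw [errorDensity_eq_sum]
  refine Finset.sum_nonneg fun i _ => indicator_nonneg (fun z _ => ?_) _
  have h1 := cellDensity_nonneg hx (i + 1)
  have h2 := hyp.mobility_nonneg h1
  positivity

theorem measurable_errorDensity (hyp : Assumptions v V W) (ht : 0 ≤ t)
    (hx : ∀ i < N, x i t < x (i + 1) t) : Measurable (errorDensity v V W N x t) := by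
  rw [funext (errorDensity_eq_sum (v := v) (V := V) (W := W) (N := N) (x := x) (t := t))]
  refine Finset.measurable_fun_sum _ fun i _ => Measurable.indicator ?_ measurableSet_Icc
  have := (continuous_particleField hyp ht hx).measurable
  fun_prop

/-! ### The error measure, and the density as a function of time -/

theorem SolvesODE.isL1locMeasure_error (hyp : Assumptions v V W) (hs : SolvesODE v V W N x)
    (hN1 : 1 ≤ N) {H : ℝ → ℝ} (hH : MonotoneOn H (Ici 0))
    (hb : ∀ t, 0 ≤ t → errorMeasure v V W N x t univ ≤ ENNReal.ofReal (H t / N)) :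
    IsL1locMeasure (errorMeasure v V W N x) where
  locallyFinite t ht := by
    have : IsFiniteMeasure (errorMeasure v V W N x t) :=
      ⟨(hb t ht).trans_lt ENNReal.ofReal_lt_top⟩
    infer_instance
  measurable A hA := by
    have h1 : AEMeasurable (fun p : ℝ × ℝ => ENNReal.ofReal (errorDensity v V W N x p.1 p.2))
        ((volume.restrict (Ici (0 : ℝ))).prod (volume.restrict A)) := by
      refine (hs.aemeasurable_errorDensity hyp hN1).ennreal_ofReal.mono_measure ?_
      exact Measure.prod_mono le_rfl Measure.restrict_le_self
    refine h1.lintegral_prod_right'.congr (.of_forall fun t => ?_)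
    simp only [errorMeasure, withDensity_apply _ hA]
  mass_lt_top K _ T := by
    calc ∫⁻ t in Icc 0 T, errorMeasure v V W N x t K
        ≤ ∫⁻ _ in Icc 0 T, ENNReal.ofReal (H T / N) := by
          refine setLIntegral_mono measurable_const fun t ht => ?_
          refine (measure_mono (subset_univ K)).trans ((hb t ht.1).trans ?_)
          refine ENNReal.ofReal_le_ofReal ?_
          gcongr
          exact hH ht.1 (mem_Ici.2 (ht.1.trans ht.2)) ht.2
      _ < ⊤ := by
          rw [setLIntegral_const, Real.volume_Icc]
          exact ENNReal.mul_lt_top ENNReal.ofReal_lt_top ENNReal.ofReal_lt_top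

theorem isL1locMeasure_zero : IsL1locMeasure fun _ => 0 where
  locallyFinite _ _ := inferInstance
  measurable _ _ := by simp
  mass_lt_top _ _ _ := by simp

theorem SolvesODE.exists_density_bound (hyp : Assumptions v V W) (hs : SolvesODE v V W N x)
    (hN1 : 1 ≤ N) (T : ℝ) :
    ∃ R, 0 ≤ R ∧ ∀ t ∈ Icc 0 T, ∀ i < N, cellDensity N x (i + 1) t ≤ R := by
  have h : ∀ i, ∃ R, 0 ≤ R ∧ ∀ t ∈ Icc 0 T, i < N → cellDensity N x (i + 1) t ≤ R := by
    intro i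
    by_cases hi : i < N
    · obtain ⟨R, hR, h⟩ := (hs.lipOn_cellDensity (T := T) hyp hN1 (i := i + 1)
        (by omega)).exists_bound
      exact ⟨R, hR, fun t ht _ => (le_abs_self _).trans (h t ht)⟩
    · exact ⟨0, le_rfl, fun t ht h => absurd h hi⟩
  choose R hR h using h
  refine ⟨∑ i ∈ Finset.range N, R i, Finset.sum_nonneg fun i _ => hR i, fun t ht i hi => ?_⟩
  exact (h i t ht hi).trans (Finset.single_le_sum (fun i _ => hR i) (Finset.mem_range.2 hi))

theorem SolvesODE.tendsto_particleDensity (hyp : Assumptions v V W) (hs : SolvesODE v V W N x)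
    (hN1 : 1 ≤ N) (ht : 0 ≤ t) {y : ℝ} (hy : ∀ i ≤ N, y ≠ x i t) :
    Tendsto (fun s => particleDensity N x s y) (𝓝[Ici 0] t) (𝓝 (particleDensity N x t y)) := by
  simp only [particleDensity_eq_sum]
  refine tendsto_finsetSum _ fun i hi => ?_
  have hi := Finset.mem_range.1 hi
  have hρ : Tendsto (cellDensity N x (i + 1)) (𝓝[Ici 0] t) (𝓝 (cellDensity N x (i + 1) t)) :=
    hs.continuousOn_cellDensity hyp hN1 (by omega) t ht
  have h1 : Tendsto (x i) (𝓝[Ici 0] t) (𝓝 (x i t)) := hs.continuousOn_Ici hi.le t ht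
  have h2 : Tendsto (x (i + 1)) (𝓝[Ici 0] t) (𝓝 (x (i + 1) t)) :=
    hs.continuousOn_Ici (Nat.succ_le_of_lt hi) t ht
  by_cases hm : y ∈ Ioo (x i t) (x (i + 1) t)
  · rw [indicator_of_mem hm]
    refine hρ.congr' ?_
    filter_upwards [h1.eventually (gt_mem_nhds hm.1), h2.eventually (lt_mem_nhds hm.2)] with s a b
    rw [indicator_of_mem (show y ∈ Ioo (x i s) (x (i + 1) s) from ⟨a, b⟩)]
  · rw [indicator_of_notMem hm]
    refine tendsto_const_nhds.congr' ?_
    rcases lt_or_gt_of_ne (hy i hi.le) with h | h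
    · filter_upwards [h1.eventually (lt_mem_nhds h)] with s a
      rw [indicator_of_notMem fun h' => (h'.1.trans a).false]
    · have h' : x (i + 1) t < y := lt_of_le_of_ne (not_lt.1 fun h' => hm ⟨h, h'⟩)
        (hy (i + 1) hi).symm
      filter_upwards [h2.eventually (gt_mem_nhds h')] with s a
      rw [indicator_of_notMem fun h' => (a.trans h'.2).false]

theorem SolvesODE.isContinuousL1loc (hyp : Assumptions v V W) (hs : SolvesODE v V W N x)
    (hN1 : 1 ≤ N) : IsContinuousL1loc (particleDensity N x) where
  measurable := by
    rw [volume_restrict_Ici_prod]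
    exact (hs.aemeasurable_particleDensity hyp hN1).aestronglyMeasurable
  locallyIntegrable t _ := (integrable_particleDensity N x t).locallyIntegrable
  continuous t ht r := by
    obtain ⟨R, hR, hb⟩ := hs.exists_density_bound hyp hN1 (t + 1)
    have hmem : Icc 0 (t + 1) ∈ 𝓝[Ici 0] t := by
      rw [← Ici_inter_Iic]
      exact inter_mem_nhdsWithin _ (Iic_mem_nhds (by linarith))
    have h := tendsto_integral_filter_of_dominated_convergence (μ := volume.restrict (Icc (-r) r))
      (F := fun s y => |particleDensity N x s y - particleDensity N x t y|) (f := fun _ => 0)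
      (l := 𝓝[Ici 0] t) (fun _ => R) (.of_forall fun s =>
        ((integrable_particleDensity N x s).sub
          (integrable_particleDensity N x t)).abs.aestronglyMeasurable.restrict) ?_ (by simp) ?_
    · simpa using h
    · filter_upwards [hmem] with s hs'
      refine .of_forall fun y => ?_
      have a1 := particleDensity_nonneg (hs.ordered s hs'.1) y
      have a2 := particleDensity_le (hs.ordered s hs'.1) hR (hb s hs') y
      have a3 := particleDensity_nonneg (hs.ordered t ht) y
      have a4 := particleDensity_le (hs.ordered t ht) hR (hb t ⟨ht, by linarith⟩) y
      rw [Real.norm_eq_abs, abs_abs]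
      exact abs_le.2 ⟨by linarith, by linarith⟩
    · refine ae_restrict_of_ae ?_
      have hne : ∀ᵐ y : ℝ, ∀ i ∈ Finset.range (N + 1), y ≠ x i t :=
        (Finset.eventually_all _).2 fun i _ => Measure.ae_ne volume (x i t)
      filter_upwards [hne] with y hy
      have h1 := (hs.tendsto_particleDensity hyp hN1 ht (y := y) fun i hi =>
        hy i (Finset.mem_range.2 (Nat.lt_succ_of_le hi))).sub_const (particleDensity N x t y)
      simpa using h1.abs

theorem SolvesODE.isBoundedBVloc (hyp : Assumptions v V W) (hs : SolvesODE v V W N x)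
    (hN1 : 1 ≤ N) : IsBoundedBVloc (particleDensity N x) := by
  intro T r
  obtain ⟨R, hR, hb⟩ := hs.exists_density_bound hyp hN1 T
  refine ⟨max 1 (N * (R * 2)), ?_⟩
  rw [ae_restrict_iff' measurableSet_Icc]
  refine .of_forall fun t ht => ⟨?_, fun ψ hψ _ _ hψ1 => ?_⟩
  · have hx := hs.ordered t ht.1
    refine le_trans ?_ (le_max_left _ _)
    simp only [abs_of_nonneg (particleDensity_nonneg hx _)]
    rw [← integral_particleDensity hN1 hx]
    exact setIntegral_le_integral (integrable_particleDensity N x t)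
      (.of_forall fun y => particleDensity_nonneg hx y)
  · have hx := hs.ordered t ht.1
    have hc : Continuous (deriv ψ) := hψ.continuous_deriv le_rfl
    refine le_trans ?_ (le_max_right _ _)
    simp only [mul_comm (particleDensity N x t _)]
    rw [integral_mul_particleDensity hx fun a b => hc.intervalIntegrable a b]
    have hterm : ∀ i ∈ Finset.range N, cellDensity N x (i + 1) t *
        ∫ y in x i t..x (i + 1) t, deriv ψ y ≤ R * 2 := by
      intro i hi
      rw [intervalIntegral.integral_deriv_eq_sub
        (fun y _ => (hψ.differentiable one_ne_zero).differentiableAt) (hc.intervalIntegrable _ _)]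
      have h1 := abs_le.1 (hψ1 (x (i + 1) t))
      have h2 := abs_le.1 (hψ1 (x i t))
      calc _ ≤ cellDensity N x (i + 1) t * 2 :=
            mul_le_mul_of_nonneg_left (by linarith) (cellDensity_nonneg hx _)
        _ ≤ R * 2 := by
            gcongr
            exact hb t ht i (Finset.mem_range.1 hi)
    refine (Finset.sum_le_sum hterm).trans (le_of_eq ?_)
    simp

end Traffic

namespace Traffic

variable {v : ℝ → ℝ} {V W : ℝ → ℝ → ℝ} {N : ℕ} {x : ℕ → ℝ → ℝ} {t T : ℝ}

/-! ### The weak derivative of a locally Lipschitz function -/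

/-- An upper right derivative; it depends measurably on parameters. -/
noncomputable def upperSlope (f : ℝ → ℝ) (z : ℝ) : ℝ :=
  limsup (fun n : ℕ => ((n : ℝ) + 1) * (f (z + 1 / ((n : ℝ) + 1)) - f z)) atTop

theorem upperSlope_eq_of_hasDerivAt {f : ℝ → ℝ} {d z : ℝ} (h : HasDerivAt f d z) :
    upperSlope f z = d := by
  have h1 : Tendsto (fun n : ℕ => 1 / ((n : ℝ) + 1)) atTop (𝓝[≠] 0) := by
    refine tendsto_nhdsWithin_iff.2 ⟨tendsto_one_div_add_atTop_nhds_zero_nat, .of_forall fun n => ?_⟩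
    have : (0 : ℝ) < 1 / ((n : ℝ) + 1) := by positivity
    exact this.ne'
  have h2 := (hasDerivAt_iff_tendsto_slope_zero.1 h).comp h1
  refine Tendsto.limsup_eq (h2.congr fun n => ?_)
  simp

theorem abs_upperSlope_le {f : ℝ → ℝ} {L z : ℝ}
    (h : ∀ y ∈ Ioc z (z + 1), |f y - f z| ≤ L * |y - z|) : |upperSlope f z| ≤ L := by
  have hb : ∀ n : ℕ, |((n : ℝ) + 1) * (f (z + 1 / ((n : ℝ) + 1)) - f z)| ≤ L := by
    intro n
    have hn : (0 : ℝ) < (n : ℝ) + 1 := by positivity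
    have h1 : 1 / ((n : ℝ) + 1) ≤ 1 := by
      rw [div_le_one hn]
      linarith [(Nat.cast_nonneg n : (0 : ℝ) ≤ n)]
    have h0 : 0 < 1 / ((n : ℝ) + 1) := by positivity
    have h2 := h (z + 1 / ((n : ℝ) + 1)) ⟨by linarith, by linarith⟩
    rw [add_sub_cancel_left, abs_of_pos h0] at h2
    rw [abs_mul, abs_of_pos hn]
    calc ((n : ℝ) + 1) * |f (z + 1 / ((n : ℝ) + 1)) - f z|
        ≤ ((n : ℝ) + 1) * (L * (1 / ((n : ℝ) + 1))) := by gcongr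
      _ = L := by field_simp
  have hup : IsBoundedUnder (· ≤ ·) atTop
      (fun n : ℕ => ((n : ℝ) + 1) * (f (z + 1 / ((n : ℝ) + 1)) - f z)) :=
    isBoundedUnder_of ⟨L, fun n => (abs_le.1 (hb n)).2⟩
  have hlo : IsBoundedUnder (· ≥ ·) atTop
      (fun n : ℕ => ((n : ℝ) + 1) * (f (z + 1 / ((n : ℝ) + 1)) - f z)) :=
    isBoundedUnder_of ⟨-L, fun n => (abs_le.1 (hb n)).1⟩
  refine abs_le.2 ⟨?_, ?_⟩
  · exact le_limsup_of_frequently_le (.of_forall fun n => (abs_le.1 (hb n)).1) hup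
  · exact limsup_le_of_le hlo.isCoboundedUnder_le (.of_forall fun n => (abs_le.1 (hb n)).2)

theorem absolutelyContinuous_of_lipschitz {f : ℝ → ℝ} {a b L : ℝ}
    (hL : ∀ z ∈ uIcc a b, ∀ y ∈ uIcc a b, |f z - f y| ≤ L * |z - y|) :
    AbsolutelyContinuousOnInterval f a b := by
  refine LipschitzOnWith.absolutelyContinuousOnInterval (K := L.toNNReal)
    (LipschitzOnWith.of_dist_le_mul fun z hz y hy => ?_)
  rw [Real.dist_eq, Real.dist_eq]
  refine (hL z hz y hy).trans ?_
  gcongr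
  exact Real.le_coe_toNNReal L

theorem ae_upperSlope_eq_deriv {f : ℝ → ℝ} {a b : ℝ} (hf : AbsolutelyContinuousOnInterval f a b) :
    ∀ᵐ z, z ∈ uIcc a b → upperSlope f z = deriv f z := by
  filter_upwards [hf.ae_differentiableAt] with z hz h
  exact upperSlope_eq_of_hasDerivAt (hz h).hasDerivAt

theorem intervalIntegrable_upperSlope {f : ℝ → ℝ} {a b : ℝ}
    (hf : AbsolutelyContinuousOnInterval f a b) : IntervalIntegrable (upperSlope f) volume a b := by
  refine hf.intervalIntegrable_deriv.congr_ae ?_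
  rw [EventuallyEq, ae_restrict_iff' measurableSet_uIoc]
  filter_upwards [ae_upperSlope_eq_deriv hf] with z hz h
  exact (hz (uIoc_subset_uIcc h)).symm

theorem integral_mul_deriv_add_upperSlope_mul {f g : ℝ → ℝ} {a b : ℝ}
    (hf : AbsolutelyContinuousOnInterval f a b) (hg : ContDiff ℝ 1 g) :
    (∫ z in a..b, f z * deriv g z) + ∫ z in a..b, upperSlope f z * g z = f b * g b - f a * g a := by
  rw [hf.integral_mul_deriv_eq_deriv_mul hg.contDiffOn.absolutelyContinuousOnInterval]
  have : ∫ z in a..b, upperSlope f z * g z = ∫ z in a..b, deriv f z * g z := by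
    refine intervalIntegral.integral_congr_ae ?_
    filter_upwards [ae_upperSlope_eq_deriv hf] with z hz h
    rw [hz (uIoc_subset_uIcc h)]
  rw [this]
  ring

theorem integral_eq_intervalIntegral_of_support {f : ℝ → ℝ} {r : ℝ} (hr : 0 ≤ r)
    (h : ∀ z, r ≤ |z| → f z = 0) : ∫ z, f z = ∫ z in (-r)..r, f z := by
  rw [intervalIntegral.integral_of_le (by linarith),
    setIntegral_eq_integral_of_forall_compl_eq_zero]
  intro z hz
  refine h z ?_
  by_contra hlt
  exact hz ⟨(abs_lt.1 (not_le.1 hlt)).1, (abs_lt.1 (not_le.1 hlt)).2.le⟩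

theorem integral_mul_deriv_eq_neg_upperSlope {f g : ℝ → ℝ} {r : ℝ} (hr : 0 ≤ r)
    (hf : AbsolutelyContinuousOnInterval f (-r) r) (hg : ContDiff ℝ 1 g)
    (hg0 : ∀ z, r ≤ |z| → g z = 0) (hg' : ∀ z, r ≤ |z| → deriv g z = 0) :
    ∫ z, f z * deriv g z = -∫ z, upperSlope f z * g z := by
  rw [integral_eq_intervalIntegral_of_support hr fun z hz => by rw [hg' z hz, mul_zero],
    integral_eq_intervalIntegral_of_support hr fun z hz => by rw [hg0 z hz, mul_zero]]
  have h := integral_mul_deriv_add_upperSlope_mul hf hg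
  rw [hg0 r (by rw [abs_of_nonneg hr]), hg0 (-r) (by rw [abs_neg, abs_of_nonneg hr])] at h
  linarith

/-! ### The flux is admissible -/

theorem SolvesODE.exists_field_bound (hyp : Assumptions v V W) (hs : SolvesODE v V W N x)
    (hN1 : 1 ≤ N) (T r : ℝ) : ∃ L, ∀ t ∈ Icc 0 T,
      (∀ z ∈ Icc (-r) r, |particleField V W N x t z| ≤ L) ∧
      ∀ z ∈ Icc (-r) r, ∀ y ∈ Icc (-r) r,
        |particleField V W N x t z - particleField V W N x t y| ≤ L * |z - y| := by
  obtain ⟨S, -, hS⟩ := hs.exists_support T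
  obtain ⟨R, hR, hρ⟩ := hs.exists_density_bound hyp hN1 T
  obtain ⟨A, hA⟩ := hyp.exists_sliceBounds T (max S r)
  refine ⟨2 * A + 2 * A * R, fun t ht => ?_⟩
  have hx := hs.ordered t ht.1
  have hA0 := (hA t ht).nonneg
  have h0 : -max S r ≤ x 0 t := (neg_le_neg (le_max_left S r)).trans (hS t ht).1
  have h1 : x N t ≤ max S r := (hS t ht).2.trans (le_max_left S r)
  have hsub : Icc (-r) r ⊆ Icc (-max S r) (max S r) :=
    Icc_subset_Icc (neg_le_neg (le_max_right S r)) (le_max_right S r)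
  refine ⟨fun z hz => ?_, fun z hz y hy => ?_⟩
  · have := abs_particleField_le hN1 hx (hA t ht) h0 h1 (hsub hz)
    have : 0 ≤ 2 * A * R := by positivity
    linarith
  · exact abs_particleField_sub_le hyp ht.1 hN1 hx (hA t ht) h0 h1 hR (hρ t ht) (hsub hz) (hsub hy)

theorem SolvesODE.absolutelyContinuous_field (hyp : Assumptions v V W)
    (hs : SolvesODE v V W N x) (hN1 : 1 ≤ N) (ht : 0 ≤ t) (a b : ℝ) :
    AbsolutelyContinuousOnInterval (particleField V W N x t) a b := by
  obtain ⟨L, hL⟩ := hs.exists_field_bound hyp hN1 t (max |a| |b|)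
  have hsub : uIcc a b ⊆ Icc (-max |a| |b|) (max |a| |b|) :=
    uIcc_subset_Icc (abs_le.1 (le_max_left _ _)) (abs_le.1 (le_max_right _ _))
  exact absolutelyContinuous_of_lipschitz fun z hz y hy =>
    (hL t ⟨ht, le_rfl⟩).2 z (hsub hz) y (hsub hy)

/-- The spatial divergence of the flux. -/
noncomputable def fluxDiv (v : ℝ → ℝ) (V W : ℝ → ℝ → ℝ) (N : ℕ) (x : ℕ → ℝ → ℝ) (t z s : ℝ) : ℝ :=
  mobility v s * upperSlope (particleField V W N x t) z

theorem SolvesODE.aemeasurable_upperSlope (hyp : Assumptions v V W) (hs : SolvesODE v V W N x)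
    (hN1 : 1 ≤ N) :
    AEMeasurable (fun p : ℝ × ℝ => upperSlope (particleField V W N x p.1) p.2)
      ((volume.restrict (Ici (0 : ℝ))).prod volume) := by
  have h : ∀ n : ℕ, AEMeasurable (fun p : ℝ × ℝ => ((n : ℝ) + 1) *
      (particleField V W N x p.1 (p.2 + 1 / ((n : ℝ) + 1)) - particleField V W N x p.1 p.2))
      ((volume.restrict (Ici (0 : ℝ))).prod volume) := fun n =>
    ((hs.aemeasurable_particleField hyp hN1 (y := fun p => p.2 + 1 / ((n : ℝ) + 1))
      (by fun_prop)).sub (hs.aemeasurable_particleField hyp hN1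
        measurable_snd.aemeasurable)).const_mul _
  refine ⟨fun p => limsup (fun n => (h n).mk _ p) atTop,
    Measurable.limsup fun n => (h n).measurable_mk, ?_⟩
  filter_upwards [ae_all_iff.2 fun n => (h n).ae_eq_mk] with p hp
  simp only [upperSlope, hp]

theorem locallyIntegrableOn_of_monotone {H : ℝ → ℝ} (hH : Monotone H) (c : ℝ) :
    LocallyIntegrableOn (fun t => c * H t) (Ici 0) :=
  (hH.locallyIntegrable.smul c).locallyIntegrableOn _

theorem SolvesODE.isAdmissibleFlux (hyp : Assumptions v V W) (hs : SolvesODE v V W N x)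
    (hN1 : 1 ≤ N) :
    IsAdmissibleFlux (trafficFlux v V W (particleDensity N x)) (fluxDiv v V W N x) where
  measurable_flux u _ := by
    rw [volume_restrict_Ici_prod]
    exact ((hs.aemeasurable_particleField hyp hN1
      measurable_snd.aemeasurable).const_mul (mobility v u)).aestronglyMeasurable
  measurable_div u _ := by
    rw [volume_restrict_Ici_prod]
    exact ((hs.aemeasurable_upperSlope hyp hN1).const_mul (mobility v u)).aestronglyMeasurable
  weak_div u _ := by
    filter_upwards [ae_restrict_mem measurableSet_Ici] with t ht ψ hψ hψc
    obtain ⟨r, hr⟩ := hψc.isCompact.isBounded.subset_ball 0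
    have hsupp : ∀ z, max r 0 ≤ |z| → z ∉ tsupport ψ := fun z hz hzψ => by
      have := hr hzψ
      rw [mem_ball_zero_iff, Real.norm_eq_abs] at this
      exact (this.trans_le ((le_max_left r 0).trans hz)).false
    have h := integral_mul_deriv_eq_neg_upperSlope (le_max_right r 0)
      (hs.absolutelyContinuous_field hyp hN1 ht _ _) (hψ.of_le (mod_cast le_top))
      (fun z hz => image_eq_zero_of_notMem_tsupport (hsupp z hz)) (fun z hz =>
        image_eq_zero_of_notMem_tsupport fun h => hsupp z hz (tsupport_deriv_subset h))
    simp only [trafficFlux, fluxDiv, mul_assoc, integral_const_mul]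
    rw [← mul_neg]
    exact congrArg _ h
  integrable_flux := by
    simpa [trafficFlux, mobility] using locallyIntegrableOn_zero
  integrable_div := by
    simpa [fluxDiv, mobility] using locallyIntegrableOn_zero
  lipschitz_flux R hR := by
    obtain ⟨H, hH, hH0, hHb⟩ := exists_monotone_of_forall_nat
      (p := fun t C => ∀ z ∈ Icc (-R) R, |particleField V W N x t z| ≤ C)
      (fun t a b hab h z hz => (h z hz).trans hab) fun T => by
        obtain ⟨L, hL⟩ := hs.exists_field_bound hyp hN1 T R
        exact ⟨L, fun t ht => (hL t ht).1⟩
    obtain ⟨K, hK, hm⟩ := hyp.exists_lipschitz_mobility R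
    refine ⟨fun t => K * H t, locallyIntegrableOn_of_monotone hH K, fun t ht =>
      ⟨mul_nonneg hK (hH0 t), fun z hz u hu w hw => ?_⟩⟩
    simp only [trafficFlux]
    rw [← sub_mul, abs_mul, mul_right_comm]
    exact mul_le_mul (hm u hu w hw) (hHb t ht z ⟨(abs_lt.1 hz).1.le, (abs_lt.1 hz).2.le⟩)
      (abs_nonneg _) (by positivity)
  lipschitz_div R hR := by
    obtain ⟨H, hH, hH0, hHb⟩ := exists_monotone_of_forall_nat
      (p := fun t C => ∀ z, |z| < R → |upperSlope (particleField V W N x t) z| ≤ C)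
      (fun t a b hab h z hz => (h z hz).trans hab) fun T => by
        obtain ⟨L, hL⟩ := hs.exists_field_bound hyp hN1 T (R + 1)
        refine ⟨L, fun t ht z hz => abs_upperSlope_le fun y hy => (hL t ht).2 y ?_ z ?_⟩
        · constructor <;> linarith [(abs_lt.1 hz).1, (abs_lt.1 hz).2, hy.1, hy.2]
        · constructor <;> linarith [(abs_lt.1 hz).1, (abs_lt.1 hz).2]
    obtain ⟨K, hK, hm⟩ := hyp.exists_lipschitz_mobility R
    refine ⟨fun t => K * H t, locallyIntegrableOn_of_monotone hH K, fun t ht =>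
      ⟨mul_nonneg hK (hH0 t), fun z hz u hu w hw => ?_⟩⟩
    simp only [fluxDiv]
    rw [← sub_mul, abs_mul, mul_right_comm]
    exact mul_le_mul (hm u hu w hw) (hHb t ht z hz) (abs_nonneg _) (by positivity)

end Traffic

namespace Traffic

/-! ### Test functions -/

/-- The partial derivative in time. -/
noncomputable def partialT (φ : ℝ × ℝ → ℝ) (t z : ℝ) : ℝ := deriv (fun s => φ (s, z)) t

/-- The partial derivative in space. -/
noncomputable def partialX (φ : ℝ × ℝ → ℝ) (t z : ℝ) : ℝ := deriv (fun y => φ (t, y)) z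

section Partial

variable {φ : ℝ × ℝ → ℝ}

theorem hasDerivAt_partialT (hφ : ContDiff ℝ 1 φ) (t z : ℝ) :
    HasDerivAt (fun s => φ (s, z)) (partialT φ t z) t := by
  have : DifferentiableAt ℝ (fun s => φ (s, z)) t :=
    (hφ.differentiable one_ne_zero).differentiableAt.comp t (by fun_prop)
  exact this.hasDerivAt

theorem hasDerivAt_partialX (hφ : ContDiff ℝ 1 φ) (t z : ℝ) :
    HasDerivAt (fun y => φ (t, y)) (partialX φ t z) z := by
  have : DifferentiableAt ℝ (fun y => φ (t, y)) z :=
    (hφ.differentiable one_ne_zero).differentiableAt.comp z (by fun_prop)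
  exact this.hasDerivAt

theorem partialT_eq_fderiv (hφ : ContDiff ℝ 1 φ) (t z : ℝ) :
    partialT φ t z = fderiv ℝ φ (t, z) (1, 0) := by
  have h1 := ((hφ.differentiable one_ne_zero).differentiableAt (x := (t, z))).hasFDerivAt
  exact (hasDerivAt_partialT hφ t z).unique
    (h1.comp_hasDerivAt t ((hasDerivAt_id t).prodMk (hasDerivAt_const t z)))

theorem partialX_eq_fderiv (hφ : ContDiff ℝ 1 φ) (t z : ℝ) :
    partialX φ t z = fderiv ℝ φ (t, z) (0, 1) := by
  have h1 := ((hφ.differentiable one_ne_zero).differentiableAt (x := (t, z))).hasFDerivAt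
  exact (hasDerivAt_partialX hφ t z).unique
    (h1.comp_hasDerivAt z ((hasDerivAt_const z t).prodMk (hasDerivAt_id z)))

theorem continuous_partialT (hφ : ContDiff ℝ 1 φ) :
    Continuous fun p : ℝ × ℝ => partialT φ p.1 p.2 := by
  simp only [partialT_eq_fderiv hφ]
  exact (hφ.continuous_fderiv one_ne_zero).clm_apply continuous_const

theorem continuous_partialX (hφ : ContDiff ℝ 1 φ) :
    Continuous fun p : ℝ × ℝ => partialX φ p.1 p.2 := by
  simp only [partialX_eq_fderiv hφ]
  exact (hφ.continuous_fderiv one_ne_zero).clm_apply continuous_const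

theorem contDiff_slice (hφ : ContDiff ℝ 1 φ) (t : ℝ) : ContDiff ℝ 1 fun y => φ (t, y) :=
  hφ.comp (by fun_prop)

end Partial

/-- A non-negative `C¹` function, bounded together with its partial derivatives by `M`, and
supported in `[0,A] × [-A,A]`. -/
structure TestBounds (φ : ℝ × ℝ → ℝ) (A M : ℝ) : Prop where
  smooth : ContDiff ℝ 1 φ
  nonneg : ∀ p, 0 ≤ φ p
  pos : 0 < A
  vanish : ∀ t z, A ≤ |z| ∨ A ≤ t ∨ t ≤ 0 → φ (t, z) = 0 ∧ partialT φ t z = 0 ∧ partialX φ t z = 0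
  bound : ∀ t z, |φ (t, z)| ≤ M ∧ |partialT φ t z| ≤ M ∧ |partialX φ t z| ≤ M

theorem exists_testBounds {φ : ℝ × ℝ → ℝ} (hφ : ContDiff ℝ (⊤ : ℕ∞) φ) (hc : HasCompactSupport φ)
    (hs : tsupport φ ⊆ Ioi (0 : ℝ) ×ˢ (univ : Set ℝ)) (h0 : ∀ p, 0 ≤ φ p) :
    ∃ A M, TestBounds φ A M := by
  have hφ1 : ContDiff ℝ 1 φ := hφ.of_le (mod_cast le_top)
  obtain ⟨r, hr⟩ := hc.isCompact.isBounded.subset_ball 0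
  have hout : ∀ t z, max r 1 ≤ |z| ∨ max r 1 ≤ t ∨ t ≤ 0 → (t, z) ∉ tsupport φ := by
    intro t z h hm
    have h1 := hr hm
    have h2 : 0 < t := (hs hm).1
    rw [mem_ball_zero_iff, Prod.norm_def, max_lt_iff, Real.norm_eq_abs, Real.norm_eq_abs] at h1
    have h3 := le_max_left r 1
    have h4 := le_abs_self t
    rcases h with h | h | h <;> linarith
  have hz : ∀ t z, (t, z) ∉ tsupport φ →
      φ (t, z) = 0 ∧ partialT φ t z = 0 ∧ partialX φ t z = 0 := by
    intro t z h
    have h1 : fderiv ℝ φ (t, z) = 0 := by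
      by_contra h2
      exact h (support_fderiv_subset ℝ h2)
    refine ⟨image_eq_zero_of_notMem_tsupport h, ?_, ?_⟩
    · rw [partialT_eq_fderiv hφ1, h1]; rfl
    · rw [partialX_eq_fderiv hφ1, h1]; rfl
  obtain ⟨M₁, h₁⟩ := hc.isCompact.exists_bound_of_continuousOn hφ1.continuous.continuousOn
  obtain ⟨M₂, h₂⟩ := hc.isCompact.exists_bound_of_continuousOn
    (continuous_partialT hφ1).continuousOn
  obtain ⟨M₃, h₃⟩ := hc.isCompact.exists_bound_of_continuousOn
    (continuous_partialX hφ1).continuousOn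
  refine ⟨max r 1, max (max M₁ M₂) (max M₃ 0), hφ1, h0, lt_max_of_lt_right one_pos,
    fun t z h => hz t z (hout t z h), fun t z => ?_⟩
  by_cases h : (t, z) ∈ tsupport φ
  · exact ⟨(h₁ _ h).trans (by simp), (h₂ _ h).trans (by simp), (h₃ _ h).trans (by simp)⟩
  · obtain ⟨e1, e2, e3⟩ := hz t z h
    simp [e1, e2, e3]

section Moving

variable {φ : ℝ × ℝ → ℝ} {A M T t : ℝ}

theorem hasDerivAt_integral_partialT (hφ : TestBounds φ A M) (t z : ℝ) :
    HasDerivAt (fun s => ∫ y in (0 : ℝ)..z, φ (s, y)) (∫ y in (0 : ℝ)..z, partialT φ t y) t := by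
  have hc := hφ.smooth.continuous
  refine (intervalIntegral.hasDerivAt_integral_of_dominated_loc_of_deriv_le
    (F := fun s y => φ (s, y)) (F' := fun s y => partialT φ s y) (bound := fun _ => M)
    univ_mem (.of_forall fun s => ?_) ?_ ?_ (.of_forall fun y _ s _ => (hφ.bound s y).2.1)
    (by simp) (.of_forall fun y _ s _ => hasDerivAt_partialT hφ.smooth s y)).2
  · exact (hc.comp (by fun_prop : Continuous fun y : ℝ => (s, y))).aestronglyMeasurable
  · exact (hc.comp (by fun_prop : Continuous fun y : ℝ => (t, y))).intervalIntegrable _ _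
  · exact ((continuous_partialT hφ.smooth).comp
      (by fun_prop : Continuous fun y : ℝ => (t, y))).aestronglyMeasurable

theorem hasDerivAt_integral_moving (hφ : TestBounds φ A M) {ξ : ℝ → ℝ} {ξ' : ℝ}
    (hξ : HasDerivAt ξ ξ' t) :
    HasDerivAt (fun s => ∫ y in (0 : ℝ)..ξ s, φ (s, y))
      ((∫ y in (0 : ℝ)..ξ t, partialT φ t y) + φ (t, ξ t) * ξ') t := by
  have hc := hφ.smooth.continuous
  have h := hasStrictFDerivAt_uncurry_coprod (𝕜 := ℝ) (u := (t, ξ t))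
    (f := fun s z => ∫ y in (0 : ℝ)..z, φ (s, y))
    (f₁ := fun s z => ContinuousLinearMap.toSpanSingleton ℝ (∫ y in (0 : ℝ)..z, partialT φ s y))
    (f₂ := fun s z => ContinuousLinearMap.toSpanSingleton ℝ (φ (s, z)))
    (.of_forall fun p => (hasDerivAt_integral_partialT hφ p.1 p.2).hasFDerivAt)
    (.of_forall fun p => by
      have hcs : Continuous fun y : ℝ => φ (p.1, y) := hc.comp (by fun_prop)
      exact (intervalIntegral.integral_hasDerivAt_right (hcs.intervalIntegrable _ _)
        hcs.stronglyMeasurable.stronglyMeasurableAtFilter hcs.continuousAt).hasFDerivAt)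
    (by
      refine Continuous.continuousAt ?_
      have : Continuous fun p : ℝ × ℝ => ∫ y in (0 : ℝ)..p.2, partialT φ p.1 y :=
        intervalIntegral.continuous_parametric_intervalIntegral_of_continuous
          (f := fun (p : ℝ × ℝ) y => partialT φ p.1 y)
          ((continuous_partialT hφ.smooth).comp
            (by fun_prop : Continuous fun q : (ℝ × ℝ) × ℝ => (q.1.1, q.2))) continuous_snd
      exact (ContinuousLinearMap.toSpanSingletonCLE (𝕜 := ℝ) (E := ℝ)).continuous.comp this)
    (by
      refine Continuous.continuousAt ?_
      exact (ContinuousLinearMap.toSpanSingletonCLE (𝕜 := ℝ) (E := ℝ)).continuous.comp hc)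
  have h2 := h.hasFDerivAt.comp_hasDerivAt t ((hasDerivAt_id t).prodMk hξ)
  refine h2.congr_deriv ?_
  simp [Function.HasUncurry.uncurry, mul_comm]

theorem lipOn_integral_moving (hφ : TestBounds φ A M) {ξ : ℝ → ℝ} (hξ : LipOn T ξ) :
    LipOn T fun s => ∫ y in (0 : ℝ)..ξ s, φ (s, y) := by
  have hc := hφ.smooth.continuous
  have hM : 0 ≤ M := (abs_nonneg _).trans (hφ.bound 0 0).1
  obtain ⟨B, hB, hξB⟩ := hξ.exists_bound
  obtain ⟨K, hK, hξ⟩ := hξ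
  have hi : ∀ s a b, IntervalIntegrable (fun y => φ (s, y)) volume a b := fun s a b =>
    (hc.comp (by fun_prop : Continuous fun y : ℝ => (s, y))).intervalIntegrable a b
  refine ⟨M * B + M * K, by positivity, fun s hs t ht => ?_⟩
  have e : (∫ y in (0 : ℝ)..ξ s, φ (s, y)) - ∫ y in (0 : ℝ)..ξ t, φ (t, y) =
      (∫ y in (0 : ℝ)..ξ s, (φ (s, y) - φ (t, y))) + ∫ y in ξ t..ξ s, φ (t, y) := by
    rw [intervalIntegral.integral_sub (hi _ _ _) (hi _ _ _),
      ← intervalIntegral.integral_interval_sub_left (hi t 0 (ξ s)) (hi t 0 (ξ t))]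
    ring
  have h1 : |∫ y in (0 : ℝ)..ξ s, (φ (s, y) - φ (t, y))| ≤ M * |s - t| * |ξ s - 0| := by
    refine intervalIntegral.norm_integral_le_of_norm_le_const
      (f := fun y => φ (s, y) - φ (t, y)) fun y _ => ?_
    exact Convex.norm_image_sub_le_of_norm_hasDerivWithin_le (s := univ) (f := fun s => φ (s, y))
      (fun r _ => (hasDerivAt_partialT hφ.smooth r y).hasDerivWithinAt)
      (fun r _ => (hφ.bound r y).2.1) convex_univ (mem_univ t) (mem_univ s)
  have h2 : |∫ y in ξ t..ξ s, φ (t, y)| ≤ M * |ξ s - ξ t| :=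
    intervalIntegral.norm_integral_le_of_norm_le_const (f := fun y => φ (t, y))
      fun y _ => (hφ.bound t y).1
  rw [sub_zero] at h1
  rw [e]
  calc _ ≤ M * |s - t| * |ξ s| + M * |ξ s - ξ t| := (abs_add_le _ _).trans (add_le_add h1 h2)
    _ ≤ M * |s - t| * B + M * (K * |s - t|) := by
        gcongr
        exacts [hξB s hs, hξ s hs t ht]
    _ = _ := by ring

end Moving

end Traffic

namespace Traffic

variable {v : ℝ → ℝ} {V W : ℝ → ℝ → ℝ} {N : ℕ} {x : ℕ → ℝ → ℝ} {t : ℝ}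

/-! ### The entropy inequality at a fixed time -/

theorem abs_eq_sign_mul (r : ℝ) : |r| = Real.sign r * r := by
  rcases lt_trichotomy r 0 with h | h | h
  · rw [Real.sign_of_neg h, abs_of_neg h]; ring
  · simp [h]
  · rw [Real.sign_of_pos h, abs_of_pos h]; ring

/-- The defect of a cell is controlled by the error density. -/
theorem abs_cell_defect_le {U g : ℝ → ℝ} {a b ρ w n wa wb : ℝ} (hab : a < b) (hU : Continuous U)
    (hg : ContDiff ℝ 1 g) (hρ : 0 ≤ ρ) (hw : 0 ≤ w) (hn : n * ρ * (b - a) = 1) :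
    |ρ * w * (∫ y in a..b, U y * deriv g y) + n * ρ ^ 2 * (wb - wa) * (∫ y in a..b, g y)
      - ρ * (g b * wb - g a * wa)| ≤
    ∫ y in a..b, |deriv g y| *
      (ρ * w * |U y - U a| + ρ * (|wb - wa| + |wa - w * U a|)) := by
  have hg' : Continuous (deriv g) := hg.continuous_deriv le_rfl
  have hgc : Continuous g := hg.continuous
  have hba : 0 < b - a := sub_pos.2 hab
  have hFTC : ∀ c d, ∫ y in c..d, deriv g y = g d - g c := fun c d =>
    intervalIntegral.integral_deriv_eq_sub
      (fun y _ => (hg.differentiable one_ne_zero).differentiableAt) (hg'.intervalIntegrable _ _)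
  have i1 : ∀ f : ℝ → ℝ, Continuous f → IntervalIntegrable f volume a b := fun f hf =>
    hf.intervalIntegrable a b
  set D := ∫ y in a..b, |deriv g y| with hD
  have hgD : ∀ y ∈ uIoc a b, ‖g y - g b‖ ≤ D := by
    intro y hy
    rw [uIoc_of_le hab.le] at hy
    rw [Real.norm_eq_abs, abs_sub_comm, ← hFTC y b]
    refine (intervalIntegral.abs_integral_le_integral_abs hy.2).trans ?_
    rw [hD, ← intervalIntegral.integral_add_adjacent_intervals
      (hg'.abs.intervalIntegrable a y) (hg'.abs.intervalIntegrable y b)]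
    exact le_add_of_nonneg_left
      (intervalIntegral.integral_nonneg hy.1.le fun z _ => abs_nonneg _)
  have hmean : |(∫ y in a..b, g y) - (b - a) * g b| ≤ D * (b - a) := by
    have h := intervalIntegral.norm_integral_le_of_norm_le_const hgD
    rw [intervalIntegral.integral_sub (i1 _ hgc) (by simp), intervalIntegral.integral_const,
      smul_eq_mul, abs_of_pos hba] at h
    exact h
  have e : ρ * w * (∫ y in a..b, U y * deriv g y) + n * ρ ^ 2 * (wb - wa) * (∫ y in a..b, g y)
      - ρ * (g b * wb - g a * wa) =
      (∫ y in a..b, (ρ * w * (U y - U a) - ρ * (wa - w * U a)) * deriv g y)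
        + ρ * (wb - wa) * (n * ρ * ((∫ y in a..b, g y) - (b - a) * g b)) := by
    have e1 : ∫ y in a..b, (ρ * w * (U y - U a) - ρ * (wa - w * U a)) * deriv g y =
        ρ * w * (∫ y in a..b, U y * deriv g y) - ρ * wa * (g b - g a) := by
      rw [← hFTC a b, ← intervalIntegral.integral_const_mul, ← intervalIntegral.integral_const_mul,
        ← intervalIntegral.integral_sub (i1 _ (by fun_prop)) (i1 _ (by fun_prop))]
      refine intervalIntegral.integral_congr fun y _ => ?_
      ring
    rw [e1]
    linear_combination ρ * (wb - wa) * g b * hn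
  have k1 : |∫ y in a..b, (ρ * w * (U y - U a) - ρ * (wa - w * U a)) * deriv g y| ≤
      ∫ y in a..b, |deriv g y| * (ρ * w * |U y - U a| + ρ * |wa - w * U a|) := by
    refine (intervalIntegral.abs_integral_le_integral_abs hab.le).trans ?_
    refine intervalIntegral.integral_mono_on hab.le (i1 _ (by fun_prop)) (i1 _ (by fun_prop))
      fun y _ => ?_
    rw [abs_mul, mul_comm]
    gcongr
    refine (abs_sub _ _).trans (le_of_eq ?_)
    rw [abs_mul, abs_mul, abs_mul, abs_of_nonneg hρ, abs_of_nonneg hw]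
  have k2 : |ρ * (wb - wa) * (n * ρ * ((∫ y in a..b, g y) - (b - a) * g b))| ≤
      ρ * |wb - wa| * D := by
    have hnρ : 0 < n * ρ := pos_of_mul_pos_left (by rw [hn]; exact one_pos) hba.le
    rw [abs_mul, abs_mul, abs_mul (n * ρ), abs_of_nonneg hρ, abs_of_pos hnρ]
    gcongr
    calc n * ρ * |(∫ y in a..b, g y) - (b - a) * g b| ≤ n * ρ * (D * (b - a)) := by gcongr
      _ = D := by linear_combination D * hn
  have e2 : ∫ y in a..b, |deriv g y| *
      (ρ * w * |U y - U a| + ρ * (|wb - wa| + |wa - w * U a|)) =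
      (∫ y in a..b, |deriv g y| * (ρ * w * |U y - U a| + ρ * |wa - w * U a|))
        + ρ * |wb - wa| * D := by
    rw [hD, ← intervalIntegral.integral_const_mul,
      ← intervalIntegral.integral_add (i1 _ (by fun_prop)) (i1 _ (by fun_prop))]
    refine intervalIntegral.integral_congr fun y _ => ?_
    ring
  rw [e, e2]
  exact (abs_add_le _ _).trans (add_le_add k1 k2)

/-- The integrand of the entropy inequality at a fixed time, with the density replaced by `r`. -/
noncomputable def entropyIntegrand (v U h g : ℝ → ℝ) (c r y : ℝ) : ℝ :=
  |r - c| * h y + Real.sign (r - c) * ((mobility v r * U y - mobility v c * U y) * deriv g y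
    - mobility v c * upperSlope U y * g y)

section Slice

variable {U h g : ℝ → ℝ} {A c : ℝ}

theorem intervalIntegrable_entropyIntegrand (hU : Continuous U)
    (hac : ∀ a b, AbsolutelyContinuousOnInterval U a b) (hh : Continuous h) (hg : ContDiff ℝ 1 g)
    (r a b : ℝ) : IntervalIntegrable (entropyIntegrand v U h g c r) volume a b := by
  have hg' : Continuous (deriv g) := hg.continuous_deriv le_rfl
  have h1 : IntervalIntegrable (fun y => mobility v c * upperSlope U y * g y) volume a b :=
    ((intervalIntegrable_upperSlope (hac a b)).const_mul _).mul_continuousOn hg.continuous.continuousOn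
  have h2 : Continuous fun y => (mobility v r * U y - mobility v c * U y) * deriv g y := by fun_prop
  have h3 : Continuous fun y => |r - c| * h y := by fun_prop
  exact (h3.intervalIntegrable a b).add (((h2.intervalIntegrable a b).sub h1).const_mul _)

theorem integral_entropyIntegrand (hU : Continuous U)
    (hac : ∀ a b, AbsolutelyContinuousOnInterval U a b) (hh : Continuous h) (hg : ContDiff ℝ 1 g)
    (r a b : ℝ) : ∫ y in a..b, entropyIntegrand v U h g c r y = |r - c| * (∫ y in a..b, h y)
      + Real.sign (r - c) * (mobility v r * (∫ y in a..b, U y * deriv g y)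
        - mobility v c * (U b * g b - U a * g a)) := by
  have hg' : Continuous (deriv g) := hg.continuous_deriv le_rfl
  have h1 : IntervalIntegrable (fun y => upperSlope U y * g y) volume a b :=
    (intervalIntegrable_upperSlope (hac a b)).mul_continuousOn hg.continuous.continuousOn
  have h2 : IntervalIntegrable (fun y => U y * deriv g y) volume a b :=
    (hU.mul hg').intervalIntegrable a b
  have e : ∀ y, entropyIntegrand v U h g c r y = |r - c| * h y
      + (Real.sign (r - c) * (mobility v r - mobility v c) * (U y * deriv g y)
        - Real.sign (r - c) * mobility v c * (upperSlope U y * g y)) := fun y => by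
    simp only [entropyIntegrand]; ring
  simp only [e]
  rw [intervalIntegral.integral_add ((hh.intervalIntegrable a b).const_mul _)
      ((h2.const_mul _).sub (h1.const_mul _)),
    intervalIntegral.integral_sub (h2.const_mul _) (h1.const_mul _),
    intervalIntegral.integral_const_mul, intervalIntegral.integral_const_mul,
    intervalIntegral.integral_const_mul, ← integral_mul_deriv_add_upperSlope_mul (hac a b) hg]
  ring

theorem entropyIntegrand_eq_zero (hv : ∀ z, A ≤ |z| → g z = 0 ∧ deriv g z = 0 ∧ h z = 0)
    {r y : ℝ} (hy : A ≤ |y|) : entropyIntegrand v U h g c r y = 0 := by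
  obtain ⟨h1, h2, h3⟩ := hv y hy
  simp [entropyIntegrand, h1, h2, h3]

theorem integrable_of_support {f : ℝ → ℝ} (hf : ∀ z, A ≤ |z| → f z = 0)
    (hi : IntervalIntegrable f volume (-A) A) : Integrable f := by
  refine (integrableOn_iff_integrable_of_support_subset (s := Ioc (-A) A) fun z hz => ?_).1 hi.1
  have h1 : |z| < A := lt_of_not_ge fun h => hz (hf z h)
  exact ⟨(abs_lt.1 h1).1, (abs_lt.1 h1).2.le⟩

theorem integral_comp_particleDensity (hx : ∀ i < N, x i t < x (i + 1) t) {Q : ℝ → ℝ → ℝ}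
    (hQ : ∀ r, Integrable (Q r)) :
    ∫ y, Q (particleDensity N x t y) y = (∫ y, Q 0 y) + ∑ i ∈ Finset.range N,
      ∫ y in x i t..x (i + 1) t, (Q (cellDensity N x (i + 1) t) y - Q 0 y) := by
  have e : ∀ y, Q (particleDensity N x t y) y = Q 0 y + ∑ i ∈ Finset.range N,
      (Ioo (x i t) (x (i + 1) t)).indicator
        (fun y => Q (cellDensity N x (i + 1) t) y - Q 0 y) y := by
    intro y
    by_cases h : ∃ i < N, y ∈ Ioo (x i t) (x (i + 1) t)
    · obtain ⟨i, hi, hy⟩ := h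
      rw [particleDensity_of_mem hx hi hy, Finset.sum_eq_single_of_mem i (Finset.mem_range.2 hi),
        indicator_of_mem hy]
      · ring
      · intro j hj hji
        have hj := Finset.mem_range.1 hj
        refine indicator_of_notMem (fun h => ?_) _
        rcases lt_or_gt_of_ne hji with h1 | h1
        · have := node_le hx (Nat.succ_le_of_lt h1) hi.le
          linarith [h.2, hy.1]
        · have := node_le hx (Nat.succ_le_of_lt h1) hj.le
          linarith [h.1, hy.2]
    · push Not at h
      rw [particleDensity_eq_sum, Finset.sum_eq_zero fun i hi =>
          indicator_of_notMem (h i (Finset.mem_range.1 hi)) _,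
        Finset.sum_eq_zero fun i hi => indicator_of_notMem (h i (Finset.mem_range.1 hi)) _, add_zero]
  simp only [e]
  have hind : ∀ i ∈ Finset.range N, Integrable ((Ioo (x i t) (x (i + 1) t)).indicator
      fun y => Q (cellDensity N x (i + 1) t) y - Q 0 y) := fun i _ =>
    ((hQ _).sub (hQ 0)).indicator measurableSet_Ioo
  rw [integral_add (hQ 0) (integrable_finsetSum _ hind), integral_finsetSum _ hind]
  congr 1
  refine Finset.sum_congr rfl fun i hi => ?_
  rw [integral_indicator measurableSet_Ioo, ← integral_Ioc_eq_integral_Ioo,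
    ← intervalIntegral.integral_of_le (hx i (Finset.mem_range.1 hi)).le]

theorem integral_abs_deriv_mul_errorDensity (hyp : Assumptions v V W) (ht : 0 ≤ t)
    (hx : ∀ i < N, x i t < x (i + 1) t) (hg : ContDiff ℝ 1 g) :
    ∫ y, |deriv g y| * errorDensity v V W N x t y = ∑ i ∈ Finset.range N,
      ∫ y in x i t..x (i + 1) t, |deriv g y| * (mobility v (cellDensity N x (i + 1) t)
          * |particleField V W N x t y - particleField V W N x t (x i t)|
        + cellDensity N x (i + 1) t
          * (|particleVelocity v V W N x (i + 1) t - particleVelocity v V W N x i t|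
            + |particleVelocity v V W N x i t
              - v (cellDensity N x (i + 1) t) * particleField V W N x t (x i t)|)) := by
  have hg' : Continuous (deriv g) := hg.continuous_deriv le_rfl
  have hU := continuous_particleField hyp ht hx
  have e : ∀ y, |deriv g y| * errorDensity v V W N x t y = ∑ i ∈ Finset.range N,
      (Icc (x i t) (x (i + 1) t)).indicator (fun y => |deriv g y|
        * (mobility v (cellDensity N x (i + 1) t)
          * |particleField V W N x t y - particleField V W N x t (x i t)|
        + cellDensity N x (i + 1) t
          * (|particleVelocity v V W N x (i + 1) t - particleVelocity v V W N x i t|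
            + |particleVelocity v V W N x i t
              - v (cellDensity N x (i + 1) t) * particleField V W N x t (x i t)|))) y := by
    intro y
    rw [errorDensity_eq_sum, Finset.mul_sum]
    refine Finset.sum_congr rfl fun i _ => ?_
    by_cases h : y ∈ Icc (x i t) (x (i + 1) t) <;> simp [h]
  simp only [e]
  rw [integral_finsetSum]
  · refine Finset.sum_congr rfl fun i hi => ?_
    rw [integral_indicator measurableSet_Icc, integral_Icc_eq_integral_Ioc,
      ← intervalIntegral.integral_of_le (hx i (Finset.mem_range.1 hi)).le]
  · intro i _
    rw [integrable_indicator_iff measurableSet_Icc]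
    refine Continuous.integrableOn_Icc ?_
    fun_prop

/-- The sum over the nodes that results from the jumps of the density is non-negative. -/
theorem node_sum_nonneg (hyp : Assumptions v V W) (hx : ∀ i < N, x i t < x (i + 1) t) (hc : 0 ≤ c)
    (hg0 : ∀ y, 0 ≤ g y) :
    0 ≤ ∑ i ∈ Finset.range N, (Real.sign (cellDensity N x (i + 1) t - c) - Real.sign (0 - c)) *
      (g (x (i + 1) t) * (c * (particleVelocity v V W N x (i + 1) t
          - v c * particleField V W N x t (x (i + 1) t)))
        - g (x i t) * (c * (particleVelocity v V W N x i t
          - v c * particleField V W N x t (x i t)))) := by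
  set G : ℕ → ℝ := fun i => g (x i t) * (c * (particleVelocity v V W N x i t
          - v c * particleField V W N x t (x i t))) with hG
  set s : ℕ → ℝ := fun i => Real.sign (cellDensity N x i t - c) with hs
  have h := sum_mul_sub_eq_of_zero (N := N) G (fun i => s i - Real.sign (0 - c))
    (by simp [hs, cellDensity_zero]) (by simp [hs, cellDensity_last])
  have e : ∑ i ∈ Finset.range N, (s (i + 1) - Real.sign (0 - c)) * (G (i + 1) - G i) =
      ∑ i ∈ Finset.range (N + 1), (s i - s (i + 1)) * G i := by
    have h1 : ∑ i ∈ Finset.range N, (s (i + 1) - Real.sign (0 - c)) * (G (i + 1) - G i) =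
        -∑ i ∈ Finset.range N, (s (i + 1) - Real.sign (0 - c)) * (G i - G (i + 1)) := by
      rw [← Finset.sum_neg_distrib]
      exact Finset.sum_congr rfl fun i _ => by ring
    rw [h1, ← h, ← Finset.sum_neg_distrib]
    exact Finset.sum_congr rfl fun i _ => by ring
  change 0 ≤ ∑ i ∈ Finset.range N, (s (i + 1) - Real.sign (0 - c)) * (G (i + 1) - G i)
  rw [e]
  refine Finset.sum_nonneg fun i _ => ?_
  have hρ := cellDensity_nonneg hx
  have k := mul_particleVelocity_sub_nonneg (v := v) (V := V) (W := W) (N := N) (x := x) (t := t)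
    (i := i) (s := s i - s (i + 1)) (w := v c)
    (hyp.sign_mul_nonneg (hρ _) hc (abs_sign_le_one _))
    (by
      have := hyp.sign_mul_nonneg (hρ i) hc (s := s (i + 1)) (abs_sign_le_one _)
      simp only [hs] at this ⊢
      linarith)
  have : (s i - s (i + 1)) * G i = g (x i t) * c * ((s i - s (i + 1)) *
      (particleVelocity v V W N x i t - v c * particleField V W N x t (x i t))) := by
    simp only [hG]; ring
  rw [this]
  exact mul_nonneg (mul_nonneg (hg0 _) hc) k

theorem slice_entropy_inequality (hyp : Assumptions v V W) (ht : 0 ≤ t)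
    (hx : ∀ i < N, x i t < x (i + 1) t)
    (hac : ∀ a b, AbsolutelyContinuousOnInterval (particleField V W N x t) a b) (hc : 0 ≤ c)
    (hA : 0 ≤ A) (hh : Continuous h) (hg : ContDiff ℝ 1 g) (hg0 : ∀ y, 0 ≤ g y)
    (hv : ∀ z, A ≤ |z| → g z = 0 ∧ deriv g z = 0 ∧ h z = 0) :
    c * (∫ y in (-A)..A, h y) + (∑ i ∈ Finset.range N,
      (Real.sign (cellDensity N x (i + 1) t - c) * densityRate v V W N x (i + 1) t
          * (∫ y in x i t..x (i + 1) t, g y)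
        + (|cellDensity N x (i + 1) t - c| - c) * ((∫ y in x i t..x (i + 1) t, h y)
          + (g (x (i + 1) t) * particleVelocity v V W N x (i + 1) t
            - g (x i t) * particleVelocity v V W N x i t))))
      - ∫ y, |deriv g y| * errorDensity v V W N x t y ≤
    ∫ y, entropyIntegrand v (particleField V W N x t) h g c (particleDensity N x t y) y := by
  have hU := continuous_particleField hyp ht hx
  have hρ := cellDensity_nonneg hx
  have hi : ∀ r a b,
      IntervalIntegrable (entropyIntegrand v (particleField V W N x t) h g c r) volume a b :=
    fun r a b => intervalIntegrable_entropyIntegrand hU hac hh hg r a b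
  rw [integral_comp_particleDensity hx fun r =>
    integrable_of_support (fun z hz => entropyIntegrand_eq_zero hv hz) (hi r (-A) A)]
  have hbg : ∫ y, entropyIntegrand v (particleField V W N x t) h g c 0 y =
      c * ∫ y in (-A)..A, h y := by
    rw [integral_eq_intervalIntegral_of_support hA fun z hz => entropyIntegrand_eq_zero hv hz,
      integral_entropyIntegrand hU hac hh hg, (hv A (le_abs_self A)).1,
      (hv (-A) (by rw [abs_neg]; exact le_abs_self A)).1]
    simp [mobility, abs_of_nonneg hc]
  rw [hbg, integral_abs_deriv_mul_errorDensity hyp ht hx hg, add_sub_assoc,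
    ← Finset.sum_sub_distrib]
  refine add_le_add le_rfl ?_
  have hn := node_sum_nonneg (g := g) hyp hx hc hg0
  rw [← sub_nonneg, ← Finset.sum_sub_distrib]
  refine hn.trans (Finset.sum_le_sum fun i hi' => ?_)
  replace hi' := Finset.mem_range.1 hi'
  rw [le_sub_iff_add_le]
  set ρ := cellDensity N x (i + 1) t with hρi
  have hN0 : (0 : ℝ) < N := by exact_mod_cast (Nat.zero_le i).trans_lt hi'
  have hNg : (N : ℝ) * ρ * (x (i + 1) t - x i t) = 1 := by
    rw [mul_assoc, cellDensity_mul_gap hx hi']; field_simp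
  have k := abs_cell_defect_le (wa := particleVelocity v V W N x i t)
    (wb := particleVelocity v V W N x (i + 1) t) (hx i hi') hU hg (hρ (i + 1))
    (hyp.v_nonneg _ (hρ (i + 1))) hNg
  rw [intervalIntegral.integral_sub (hi _ _ _) (hi _ _ _),
    integral_entropyIntegrand hU hac hh hg, integral_entropyIntegrand hU hac hh hg]
  have e1 := abs_eq_sign_mul (ρ - c)
  have e2 : c = Real.sign (0 - c) * (0 - c) := by
    rw [← abs_eq_sign_mul, zero_sub, abs_neg, abs_of_nonneg hc]
  have e3 : |0 - c| = c := by rw [zero_sub, abs_neg, abs_of_nonneg hc]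
  have e4 : mobility v 0 = 0 := by simp [mobility]
  have e5 : densityRate v V W N x (i + 1) t = -(N * ρ ^ 2 *
      (particleVelocity v V W N x (i + 1) t - particleVelocity v V W N x i t)) := by
    rw [densityRate, Nat.add_sub_cancel]
  rw [e3, e4, e5]
  change |mobility v ρ * _ + _ - _| ≤ ∫ y in _.._, |deriv g y| * (mobility v ρ * _ + _) at k
  set X := mobility v ρ * (∫ y in x i t..x (i + 1) t, particleField V W N x t y * deriv g y)
    + N * ρ ^ 2 * (particleVelocity v V W N x (i + 1) t - particleVelocity v V W N x i t)
      * (∫ y in x i t..x (i + 1) t, g y)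
    - ρ * (g (x (i + 1) t) * particleVelocity v V W N x (i + 1) t
      - g (x i t) * particleVelocity v V W N x i t) with hX
  have k2 : -|X| ≤ Real.sign (ρ - c) * X := by
    have : |Real.sign (ρ - c) * X| ≤ |X| := by
      rw [abs_mul]
      exact mul_le_of_le_one_left (abs_nonneg _) (abs_sign_le_one _)
    exact (abs_le.1 this).1
  have e6 : mobility v c = c * v c := rfl
  rw [e1, e6]
  replace k := k2.trans' (neg_le_neg k)
  have e7 := congrArg (· * (g (x (i + 1) t) * particleVelocity v V W N x (i + 1) t
      - g (x i t) * particleVelocity v V W N x i t)) e2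
  rw [hX] at k
  linarith

end Slice

end Traffic

namespace Traffic

variable {v : ℝ → ℝ} {V W : ℝ → ℝ → ℝ} {N : ℕ} {x : ℕ → ℝ → ℝ} {t c A M : ℝ} {φ : ℝ × ℝ → ℝ}

/-! ### Integration in time -/

/-- The integral of `|ρ̄ - c| φ` over `[-A,A]`. -/
noncomputable def entropyMass (N : ℕ) (x : ℕ → ℝ → ℝ) (φ : ℝ × ℝ → ℝ) (c A t : ℝ) : ℝ :=
  c * ((∫ y in (0 : ℝ)..A, φ (t, y)) - ∫ y in (0 : ℝ)..(-A), φ (t, y)) +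
    ∑ i ∈ Finset.range N, (|cellDensity N x (i + 1) t - c| - c) *
      ((∫ y in (0 : ℝ)..x (i + 1) t, φ (t, y)) - ∫ y in (0 : ℝ)..x i t, φ (t, y))

theorem SolvesODE.lipOn_entropyMass (hyp : Assumptions v V W) (hs : SolvesODE v V W N x)
    (hN1 : 1 ≤ N) (hφ : TestBounds φ A M) (c : ℝ) : LipOn A (entropyMass N x φ c A) := by
  refine LipOn.add ((LipOn.const c).mul ((lipOn_integral_moving hφ (.const A)).sub
    (lipOn_integral_moving hφ (.const (-A))))) (LipOn.sum _ fun i hi => ?_)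
  have hi := Finset.mem_range.1 hi
  exact (((hs.lipOn_cellDensity hyp hN1 (i := i + 1) (by omega)).sub (.const c)).abs.sub
    (.const c)).mul ((lipOn_integral_moving hφ (hs.lipOn hyp hN1 hi)).sub
      (lipOn_integral_moving hφ (hs.lipOn hyp hN1 hi.le)))

theorem entropyMass_eq_zero (hφ : TestBounds φ A M) (ht : A ≤ t ∨ t ≤ 0) :
    entropyMass N x φ c A t = 0 := by
  have h : ∀ y, φ (t, y) = 0 := fun y => (hφ.vanish t y (.inr ht)).1
  simp [entropyMass, h]

theorem SolvesODE.ae_hasDerivAt_entropyMass (hyp : Assumptions v V W) (hs : SolvesODE v V W N x)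
    (hN1 : 1 ≤ N) (hφ : TestBounds φ A M) (c : ℝ) : ∀ᵐ t, t ∈ Ioo 0 A →
    HasDerivAt (entropyMass N x φ c A) (c * (∫ y in (-A)..A, partialT φ t y)
      + ∑ i ∈ Finset.range N, (Real.sign (cellDensity N x (i + 1) t - c)
          * densityRate v V W N x (i + 1) t * (∫ y in x i t..x (i + 1) t, φ (t, y))
        + (|cellDensity N x (i + 1) t - c| - c) * ((∫ y in x i t..x (i + 1) t, partialT φ t y)
          + (φ (t, x (i + 1) t) * particleVelocity v V W N x (i + 1) t
            - φ (t, x i t) * particleVelocity v V W N x i t)))) t := by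
  have hρ : ∀ᵐ t, ∀ i ∈ Finset.range N, t ∈ Ioo 0 A →
      DifferentiableAt ℝ (fun s => |cellDensity N x (i + 1) s - c|) t :=
    (Finset.eventually_all _).2 fun i hi => LipOn.ae_differentiableAt
      ((hs.lipOn_cellDensity hyp hN1 (i := i + 1)
        (by have := Finset.mem_range.1 hi; omega)).sub (.const c)).abs hφ.pos.le
  filter_upwards [hρ, hs.ae_hasDerivAt A] with t h1 h2 ht
  have hφc : Continuous fun y => φ (t, y) := (contDiff_slice hφ.smooth t).continuous
  have hφt : Continuous fun y => partialT φ t y :=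
    (continuous_partialT hφ.smooth).comp (by fun_prop : Continuous fun y : ℝ => (t, y))
  have e : ∀ f : ℝ → ℝ, Continuous f → ∀ a b,
      ∫ y in a..b, f y = (∫ y in (0 : ℝ)..b, f y) - ∫ y in (0 : ℝ)..a, f y := fun f hf a b =>
    (intervalIntegral.integral_interval_sub_left (hf.intervalIntegrable _ _)
      (hf.intervalIntegrable _ _)).symm
  refine HasDerivAt.add ?_ (HasDerivAt.fun_sum fun i hi => ?_)
  · have h := ((hasDerivAt_integral_moving hφ (hasDerivAt_const t A)).sub
      (hasDerivAt_integral_moving hφ (hasDerivAt_const t (-A)))).const_mul c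
    refine h.congr_deriv ?_
    rw [e _ hφt (-A)]
    ring
  · have hiN := Finset.mem_range.1 hi
    have hd := hasDerivAt_cellDensity (hs.ordered t ht.1.le) (h2 ht) (i := i + 1) (by omega)
    have ha := (h1 i hi ht).hasDerivAt
    have hsg := hasDerivAt_abs_eq (hd.sub_const c) ha
    rw [hsg] at ha
    have h := (ha.sub_const c).mul ((hasDerivAt_integral_moving hφ (h2 ht (i + 1) hiN)).sub
      (hasDerivAt_integral_moving hφ (h2 ht i hiN.le)))
    refine h.congr_deriv ?_
    rw [e _ hφt (x i t), e _ hφc (x i t)]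
    simp only [Pi.sub_apply]
    ring

/-- The integral in space of the integrand of the entropy inequality. -/
noncomputable def entropyProduction (v : ℝ → ℝ) (V W : ℝ → ℝ → ℝ) (N : ℕ) (x : ℕ → ℝ → ℝ)
    (φ : ℝ × ℝ → ℝ) (c t : ℝ) : ℝ :=
  ∫ y, entropyIntegrand v (particleField V W N x t) (partialT φ t) (fun z => φ (t, z)) c
    (particleDensity N x t y) y

theorem measurable_sign : Measurable Real.sign := by
  unfold Real.sign
  exact Measurable.ite measurableSet_Iio measurable_const
    (Measurable.ite measurableSet_Ioi measurable_const measurable_const)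

theorem SolvesODE.aestronglyMeasurable_entropyProduction (hyp : Assumptions v V W)
    (hs : SolvesODE v V W N x) (hN1 : 1 ≤ N) (hφ : TestBounds φ A M) (c : ℝ) :
    AEStronglyMeasurable (entropyProduction v V W N x φ c) (volume.restrict (Ici (0 : ℝ))) := by
  have hρ := hs.aemeasurable_particleDensity hyp hN1
  have hU := hs.aemeasurable_particleField hyp hN1 (y := fun p => p.2) measurable_snd.aemeasurable
  have hD := hs.aemeasurable_upperSlope hyp hN1
  have hv : AEMeasurable (fun p : ℝ × ℝ => v (particleDensity N x p.1 p.2))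
      ((volume.restrict (Ici (0 : ℝ))).prod volume) :=
    hyp.aemeasurable_v_comp hρ <| by
      filter_upwards [ae_prod_Ici_nonneg] with p hp
      exact particleDensity_nonneg (hs.ordered _ hp) _
  have hT := (continuous_partialT hφ.smooth).measurable.aemeasurable
    (μ := (volume.restrict (Ici (0 : ℝ))).prod volume)
  have hX := (continuous_partialX hφ.smooth).measurable.aemeasurable
    (μ := (volume.restrict (Ici (0 : ℝ))).prod volume)
  have h0 := hφ.smooth.continuous.measurable.aemeasurable
    (μ := (volume.restrict (Ici (0 : ℝ))).prod volume)
  have h : AEMeasurable (fun p : ℝ × ℝ => entropyIntegrand v (particleField V W N x p.1)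
      (partialT φ p.1) (fun z => φ (p.1, z)) c (particleDensity N x p.1 p.2) p.2)
      ((volume.restrict (Ici (0 : ℝ))).prod volume) :=
    ((measurable_norm.comp_aemeasurable (hρ.sub_const c)).mul hT).add
      ((measurable_sign.comp_aemeasurable (hρ.sub_const c)).mul
        (((((hρ.mul hv).mul hU).sub (hU.const_mul (mobility v c))).mul hX).sub
          ((hD.const_mul (mobility v c)).mul h0)))
  exact h.aestronglyMeasurable.integral_prod_right'

theorem TestBounds.slice_vanish (hφ : TestBounds φ A M) (t z : ℝ) (hz : A ≤ |z|) :
    φ (t, z) = 0 ∧ deriv (fun y => φ (t, y)) z = 0 ∧ partialT φ t z = 0 :=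
  let ⟨h1, h2, h3⟩ := hφ.vanish t z (.inl hz)
  ⟨h1, h3, h2⟩

theorem SolvesODE.exists_entropyProduction_bound (hyp : Assumptions v V W)
    (hs : SolvesODE v V W N x) (hN1 : 1 ≤ N) (hφ : TestBounds φ A M) (hc : 0 ≤ c) :
    ∃ C, ∀ t ∈ Icc 0 A, |entropyProduction v V W N x φ c t| ≤ C := by
  obtain ⟨L, hL⟩ := hs.exists_field_bound hyp hN1 A (A + 1)
  obtain ⟨R, hR, hρ⟩ := hs.exists_density_bound hyp hN1 A
  have hv0 := hyp.v_nonneg 0 le_rfl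
  have hM : 0 ≤ M := (abs_nonneg _).trans (hφ.bound 0 0).1
  refine ⟨((R + c) * M + 1 * ((R * v 0 * L + c * v 0 * L) * M + c * v 0 * L * M)) * |A - -A|,
    fun t ht => ?_⟩
  rw [entropyProduction, integral_eq_intervalIntegral_of_support hφ.pos.le fun z hz =>
    entropyIntegrand_eq_zero (fun z hz => hφ.slice_vanish t z hz) hz]
  rw [← Real.norm_eq_abs (∫ y in (-A)..A, _)]
  refine intervalIntegral.norm_integral_le_of_norm_le_const fun y hy => ?_
  rw [uIoc_of_le (by linarith [hφ.pos])] at hy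
  have hx := hs.ordered t ht.1
  have r0 := particleDensity_nonneg hx y
  have r1 := particleDensity_le hx hR (hρ t ht) y
  have hy' : y ∈ Icc (-(A + 1)) (A + 1) := ⟨by linarith [hy.1], by linarith [hy.2]⟩
  have u1 := (hL t ht).1 y hy'
  have hL0 : 0 ≤ L := (abs_nonneg _).trans u1
  have u2 : |upperSlope (particleField V W N x t) y| ≤ L := abs_upperSlope_le fun z hz =>
    (hL t ht).2 z ⟨by linarith [hz.1, hy.1], by linarith [hz.2, hy.2]⟩ y hy'
  obtain ⟨b1, b2, b3⟩ := hφ.bound t y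
  have m1 : |mobility v (particleDensity N x t y)| ≤ R * v 0 := by
    rw [abs_of_nonneg (hyp.mobility_nonneg r0)]
    exact hyp.mobility_le r0 r1
  have m2 : |mobility v c| ≤ c * v 0 := by
    rw [abs_of_nonneg (hyp.mobility_nonneg hc)]
    exact hyp.mobility_le hc le_rfl
  have d1 : |particleDensity N x t y - c| ≤ R + c := abs_le.2 ⟨by linarith, by linarith⟩
  rw [entropyIntegrand, Real.norm_eq_abs]
  refine (abs_add_le _ _).trans ?_
  rw [abs_mul, abs_mul, abs_abs]
  gcongr
  · exact abs_sign_le_one _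
  · refine (abs_sub _ _).trans ?_
    rw [abs_mul, abs_mul, abs_mul (mobility v c)]
    gcongr
    · refine (abs_sub _ _).trans ?_
      rw [abs_mul, abs_mul]
      gcongr
    · exact b3

theorem integral_abs_deriv_errorMeasure (hyp : Assumptions v V W) (ht : 0 ≤ t)
    (hx : ∀ i < N, x i t < x (i + 1) t) (g : ℝ → ℝ) :
    ∫ y, g y ∂(errorMeasure v V W N x t) = ∫ y, g y * errorDensity v V W N x t y := by
  rw [errorMeasure, integral_withDensity_eq_integral_toReal_smul
    (measurable_errorDensity hyp ht hx).ennreal_ofReal (.of_forall fun _ => ENNReal.ofReal_lt_top)]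
  refine integral_congr_ae (.of_forall fun y => ?_)
  simp only [ENNReal.toReal_ofReal (errorDensity_nonneg hyp hx y), smul_eq_mul, mul_comm]

theorem setIntegral_Ioi_eq_of_vanish {f : ℝ → ℝ} (h : ∀ t, A ≤ t → f t = 0) (hA : 0 ≤ A) :
    ∫ t in Ioi (0 : ℝ), f t = ∫ t in (0 : ℝ)..A, f t := by
  rw [intervalIntegral.integral_of_le hA]
  refine setIntegral_eq_of_subset_of_forall_sdiff_eq_zero measurableSet_Ioi
    (fun t ht => ht.1) fun t ht => h t ?_
  by_contra hlt
  exact ht.2 ⟨ht.1, (not_le.1 hlt).le⟩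

theorem intervalIntegrable_of_bound {f : ℝ → ℝ} {C : ℝ} (hA : 0 ≤ A)
    (hf : AEStronglyMeasurable f (volume.restrict (Ici (0 : ℝ)))) (h : ∀ t ∈ Icc 0 A, |f t| ≤ C) :
    IntervalIntegrable f volume 0 A := by
  rw [intervalIntegrable_iff_integrableOn_Icc_of_le hA]
  have hf' : AEStronglyMeasurable f (volume.restrict (Icc 0 A)) :=
    hf.mono_measure (Measure.restrict_mono Icc_subset_Ici_self le_rfl)
  exact ⟨hf', HasFiniteIntegral.restrict_of_bounded C (by simp)
    (ae_restrict_of_forall_mem measurableSet_Icc h)⟩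

theorem SolvesODE.intervalIntegrable_error (hyp : Assumptions v V W) (hs : SolvesODE v V W N x)
    (hN1 : 1 ≤ N) (hφ : TestBounds φ A M) {C : ℝ}
    (hb : ∀ t ∈ Icc 0 A, errorMeasure v V W N x t univ ≤ ENNReal.ofReal C) :
    IntervalIntegrable (fun t => ∫ y, |deriv (fun z => φ (t, z)) y| ∂(errorMeasure v V W N x t))
      volume 0 A := by
  have hM : 0 ≤ M := (abs_nonneg _).trans (hφ.bound 0 0).1
  refine intervalIntegrable_of_bound (C := M * max C 0) hφ.pos.le ?_ fun t ht => ?_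
  · have h : AEMeasurable (fun p : ℝ × ℝ => |partialX φ p.1 p.2| * errorDensity v V W N x p.1 p.2)
        ((volume.restrict (Ici (0 : ℝ))).prod volume) :=
      (continuous_partialX hφ.smooth).abs.measurable.aemeasurable.mul
        (hs.aemeasurable_errorDensity hyp hN1)
    refine h.aestronglyMeasurable.integral_prod_right'.congr ?_
    filter_upwards [ae_restrict_mem measurableSet_Ici] with t ht
    exact (integral_abs_deriv_errorMeasure hyp ht (hs.ordered t ht) _).symm
  · have : IsFiniteMeasure (errorMeasure v V W N x t) := ⟨(hb t ht).trans_lt ENNReal.ofReal_lt_top⟩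
    rw [← Real.norm_eq_abs]
    refine (norm_integral_le_of_norm_le_const (C := M) (.of_forall fun y => ?_)).trans ?_
    · rw [Real.norm_eq_abs, abs_abs]
      exact (hφ.bound t y).2.2
    · gcongr
      rw [Measure.real, ← ENNReal.toReal_ofReal']
      exact ENNReal.toReal_mono ENNReal.ofReal_ne_top (hb t ht)

theorem SolvesODE.neg_integral_error_le (hyp : Assumptions v V W) (hs : SolvesODE v V W N x)
    (hN1 : 1 ≤ N) (hφ : TestBounds φ A M) (hc : 0 ≤ c) {C : ℝ}
    (hb : ∀ t ∈ Icc 0 A, errorMeasure v V W N x t univ ≤ ENNReal.ofReal C) :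
    -(∫ t in (0 : ℝ)..A, ∫ y, |deriv (fun z => φ (t, z)) y| ∂(errorMeasure v V W N x t)) ≤
      ∫ t in (0 : ℝ)..A, entropyProduction v V W N x φ c t := by
  obtain ⟨K, hK⟩ := hs.exists_entropyProduction_bound hyp hN1 hφ hc
  have hac := (hs.lipOn_entropyMass hyp hN1 hφ c).absolutelyContinuous hφ.pos.le
  have hE := hs.intervalIntegrable_error hyp hN1 hφ hb
  have h0 : ∫ t in (0 : ℝ)..A, deriv (entropyMass N x φ c A) t = 0 := by
    rw [hac.integral_deriv_eq_sub, entropyMass_eq_zero hφ (.inl le_rfl),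
      entropyMass_eq_zero hφ (.inr le_rfl), sub_zero]
  have e := intervalIntegral.integral_sub hac.intervalIntegrable_deriv hE
  rw [h0, zero_sub] at e
  rw [← e]
  refine intervalIntegral.integral_mono_ae_restrict hφ.pos.le
    (hac.intervalIntegrable_deriv.sub hE) (intervalIntegrable_of_bound hφ.pos.le
      (hs.aestronglyMeasurable_entropyProduction hyp hN1 hφ c) hK) ?_
  rw [← restrict_Ioo_eq_restrict_Icc]
  filter_upwards [ae_restrict_of_ae (hs.ae_hasDerivAt_entropyMass hyp hN1 hφ c),
    ae_restrict_mem measurableSet_Ioo] with t h1 ht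
  have hx := hs.ordered t ht.1.le
  rw [(h1 ht).deriv, integral_abs_deriv_errorMeasure hyp ht.1.le hx]
  exact slice_entropy_inequality hyp ht.1.le hx
    (fun a b => hs.absolutelyContinuous_field hyp hN1 ht.1.le a b) hc hφ.pos.le
    ((continuous_partialT hφ.smooth).comp (by fun_prop : Continuous fun y : ℝ => (t, y)))
    (contDiff_slice hφ.smooth t) (fun y => hφ.nonneg (t, y)) (hφ.slice_vanish t)

theorem SolvesODE.quasiEntropyInequality (hyp : Assumptions v V W) (hs : SolvesODE v V W N x)
    (hN1 : 1 ≤ N) (hb : ∀ T, ∃ C, ∀ t ∈ Icc 0 T,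
      errorMeasure v V W N x t univ ≤ ENNReal.ofReal C) :
    QuasiEntropyInequality (trafficFlux v V W (particleDensity N x)) (fluxDiv v V W N x)
      (particleDensity N x) (fun _ => 0) (errorMeasure v V W N x) := by
  intro c hc φ hφ hcs hsupp h0
  obtain ⟨A, M, hT⟩ := exists_testBounds hφ hcs hsupp h0
  obtain ⟨C, hC⟩ := hb A
  have h := hs.neg_integral_error_le hyp hN1 hT hc hC
  rw [← setIntegral_Ioi_eq_of_vanish (fun t ht => ?_) hT.pos.le,
    ← setIntegral_Ioi_eq_of_vanish (fun t ht => ?_) hT.pos.le] at h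
  · simp only [integral_zero_measure, integral_zero, neg_zero, zero_sub]
    exact h
  · have hv : ∀ y, φ (t, y) = 0 ∧ deriv (fun z => φ (t, z)) y = 0 ∧ partialT φ t y = 0 := fun y =>
      let ⟨h1, h2, h3⟩ := hT.vanish t y (.inr (.inl ht))
      ⟨h1, h3, h2⟩
    refine integral_eq_zero_of_ae (.of_forall fun y => ?_)
    exact entropyIntegrand_eq_zero (A := 0) (fun z _ => hv z) (abs_nonneg y)
  · have hv : ∀ y, deriv (fun z => φ (t, z)) y = 0 := fun y =>
      (hT.vanish t y (.inr (.inl ht))).2.2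
    simp [hv]

end Traffic

theorem mainTheorem8 (v : ℝ → ℝ) (V W : ℝ → ℝ → ℝ) (hyp : Traffic.Assumptions v V W)
    (R₀ S₀ B₀ : ℝ) :
    ∃ H : ℝ → ℝ, MonotoneOn H (Ici 0) ∧ (∀ t, 0 ≤ t → 0 ≤ H t) ∧
      ∀ N : ℕ, 1 ≤ N → ∀ x : ℕ → ℝ → ℝ,
        Traffic.SolvesODE v V W N x → Traffic.InitialBounds R₀ S₀ B₀ N x →
          Traffic.IsQuasiEntropySolution
              (Traffic.trafficFlux v V W (Traffic.particleDensity N x))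
              (Traffic.particleDensity N x) (fun _ => 0) (Traffic.errorMeasure v V W N x) ∧
            ∀ t, 0 ≤ t →
              Traffic.errorMeasure v V W N x t univ ≤ ENNReal.ofReal (H t / N) := by
  obtain ⟨H, hH, hH0, hHb⟩ := Traffic.exists_monotone_of_forall_nat
    (p := fun t C => ∀ (N : ℕ) (x : ℕ → ℝ → ℝ), 1 ≤ N → Traffic.SolvesODE v V W N x →
      Traffic.InitialBounds R₀ S₀ B₀ N x →
        Traffic.errorMeasure v V W N x t univ ≤ ENNReal.ofReal (C / N))
    (fun t a b hab h N x hN hs hi => (h N x hN hs hi).trans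
      (ENNReal.ofReal_le_ofReal (by gcongr)))
    (Traffic.exists_errorMeasure_bound hyp R₀ S₀ B₀)
  refine ⟨H, hH.monotoneOn _, fun t _ => hH0 t, fun N hN x hs hi => ?_⟩
  have hb : ∀ t, 0 ≤ t → Traffic.errorMeasure v V W N x t univ ≤ ENNReal.ofReal (H t / N) :=
    fun t ht => hHb t ht N x hN hs hi
  refine ⟨⟨Traffic.isL1locMeasure_zero, hs.isL1locMeasure_error hyp hN (hH.monotoneOn _) hb,
    fun t ht y => Traffic.particleDensity_nonneg (hs.ordered t ht) y, hs.isContinuousL1loc hyp hN,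
    hs.isBoundedBVloc hyp hN, Traffic.fluxDiv v V W N x, hs.isAdmissibleFlux hyp hN,
    hs.quasiEntropyInequality hyp hN fun T => ⟨H T / N, fun t ht => ?_⟩⟩, hb⟩
  refine (hb t ht.1).trans (ENNReal.ofReal_le_ofReal ?_)
  gcongr
  exact hH ht.2
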